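/- \textbf{Setting.} Fix $\eta\in\mathbb C$ with $\operatorname{Re}\eta\neq0$, put $q=e^{\eta}$ and $q^{x}=e^{\eta x}$ for $x\in\mathbb C$ (so $|q|\ne 1$), and $[x]_q=\frac{q^x-q^{-x}}{q-q^{-1}}$. Let $N\ge 1$ and let $\ell\in\mathbb C$ satisfy $q^{4\ell+2n}\neq1$ for all integers $n\ge 0$. The quantum space is $\mathbb C[z_1,\dots,z_N]$, the auxiliary space is $V_0=\mathbb C[z_0]$, $\partial_i=\partial/\partial z_i$, and $P_{ij}$ exchanges $z_i$ and $z_j$. Put $$\mathbf u_{ij}=\frac{z_j}{z_i}\bigl(1-q^{-2z_i\partial_i}\bigr),\qquad \mathbf v_i=q^{2z_i\partial_i},\qquad (x;p)_n=\prod_{k=0}^{n-1}(1-p^kx),$$ $$\mathbf e_{p}(x)=\sum_{n\ge0}\frac{x^n}{(p;p)_n},\qquad \mathbf e_{p}^{-1}(x)=\sum_{n\ge0}\frac{(-1)^np^{n(n-1)/2}x^n}{(p;p)_n};$$ these series in the locally nilpotent operators $\mathbf u_{ij}$ are locally finite on polynomials. Let $$\mathcal R^-_{ij}(u_+,u_-|v_-)=\mathbf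 e_{q^2}\bigl(q^{u_--u_++2}\mathbf u_{ij}\bigr)\, D^-\,\mathbf e_{q^2}^{-1}\bigl(q^{v_--u_++2}\mathbf u_{ij}\bigr),$$ $$\mathcal R^+_{ij}(u_+|v_+,v_-)=\mathbf e_{q^2}\bigl(q^{v_--v_++2}\mathbf u_{ji}\bigr)\, D^+\,\mathbf e_{q^2}^{-1}\bigl(q^{2+v_--u_+}\mathbf u_{ji}\bigr),$$ where $D^-$ multiplies a monomial of degree $n$ in $z_i$ by $q^{(v_--u_-)n}\frac{(q^{2u_+-2v_-};q^2)_n}{(q^{2u_+-2u_-};q^2)_n}$ and $D^+$ multiplies a monomial of degree $n$ in $z_j$ by $q^{(v_+-u_+)n}\frac{(q^{2u_+-2v_-};q^2)_n}{(q^{2v_+-2v_-};q^2)_n}$. (Equivalently, off removable singularities, $D^-=\frac{\mathbf e_{q^2}(q^{2u_+-2u_-})}{\mathbf e_{q^2}(q^{2u_+-2v_-})}\,\mathbf v_i^{(v_--u_-)/2}\,\frac{\mathbf e_{q^2}(q^{2u_+-2v_-}\mathbf v_i)}{\mathbf e_{q^2}(q^{2u_+-2u_-}\mathbf v_i)}$,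 and similarly for $D^+$.) Let $$\mathbb R_{k0}(u_1|u_2)=P_{k0}\,\mathcal R^+_{k0}(u+\ell\,|\,\ell_0,u-\ell)\,\mathcal R^-_{k0}(u+\ell,u-\ell\,|\,{-\ell_0}),\qquad u_1=1+u-\ell_0,\quad u_2=u+\ell_0 .$$ For the homogeneous periodic XXZ chain ($\ell_k=\ell$, $\delta_k=0$) put $$\mathbf t(u)=\operatorname{tr}_{\mathbb C^2}L_1(u)\cdots L_N(u),\qquad L_k(u)=\begin{pmatrix}[u+\ell+z_k\partial_k]_q&-\frac1{z_k}[z_k\partial_k]_q\\ z_k[2\ell+z_k\partial_k]_q&[u-\ell-z_k\partial_k]_q\end{pmatrix},$$ $$\mathbf Q(u_1|u_2)=\operatorname{tr}_{V_0}\mathbb R_{10}(u_1|u_2)\cdots\mathbb R_{N0}(u_1|u_2),$$ where the trace is $[(\operatorname{tr}_{V_0}A)\Psi](z_1,\dots,z_N)=\sum_{m\ge0}\frac1{m!}\partial_0^mA\,z_0^m\Psi\big|_{z_0=0}$, the series converging coefficientwise. Put $\mathbf Q_-(u)=\mathbf Q(1-\ell|u)$, $\mathbf Q_+(u)=\mathbf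 Q(u|\ell)$ and $\Delta_\pm(u)=[u\pm\ell]_q^N$. Call $u$ regular if $q^{2+2\ell-2u+2n}\ne1$ for all integers $n\ge0$ (that is, $\mathcal R^+_{k0}(u+\ell|1,u-\ell)$ has no pole). \textbf{Statement.} (a) For all $u,v\in\mathbb C$ the trace defining $\mathbf Q_-(u)$ exists, and $$\mathbf Q_-(u)=\operatorname{tr}_{V_0}P_{10}\mathcal R^-_{10}(u+\ell,u-\ell|0)\cdots P_{N0}\mathcal R^-_{N0}(u+\ell,u-\ell|0),$$ $$\mathbf Q_-(u)\mathbf Q_-(v)=\mathbf Q_-(v)\mathbf Q_-(u),\qquad \mathbf Q_-(u)\,\mathbf t(v)=\mathbf t(v)\,\mathbf Q_-(u),$$ $$\mathbf Q_-(u)\,\mathbf t(u)=\Delta_+(u)\,\mathbf Q_-(u+1)+\Delta_-(u)\,\mathbf Q_-(u-1).$$ (b) Suppose in addition that $|q^{\ell}|<1$ if $|q|<1$, respectively $|q^{\ell}|>1$ if $|q|>1$. For every regular $u$ the trace defining $\mathbf Q_+(u)$ converges, and $$\mathbf Q_+(u)=\operatorname{tr}_{V_0}P_{10}\mathcal R^+_{10}(u+\ell|1,u-\ell)\cdots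 P_{N0}\mathcal R^+_{N0}(u+\ell|1,u-\ell).$$ For every regular $u$ and every $v\in\mathbb C$ one has $\mathbf Q_+(u)\mathbf Q_-(v)=\mathbf Q_-(v)\mathbf Q_+(u)$ and $\mathbf Q_+(u)\,\mathbf t(v)=\mathbf t(v)\,\mathbf Q_+(u)$, and if $v$ is regular also $\mathbf Q_+(u)\mathbf Q_+(v)=\mathbf Q_+(v)\mathbf Q_+(u)$. If $u+1$ is regular (then so are $u$ and $u-1$, and $\Delta_-(u-1)\ne0$), then $$\mathbf t(u)\,\mathbf Q_+(u)=\frac{\Delta_+(u-1)\,\Delta_-(u)}{\Delta_-(u-1)}\,\mathbf Q_+(u-1)+\Delta_-(u)\,\mathbf Q_+(u+1).$$ -/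

import Mathlib

noncomputable section

namespace XXZ

open MvPolynomial

/-! ### `q`-numbers and `q`-exponentials

Throughout `η` is a fixed logarithm of `q`, so that `q = exp η` and `q ^ x = exp (η x)` for all
complex `x`. -/

/-- `q ^ x`, where `q = exp η`. -/
def qpow (η x : ℂ) : ℂ := Complex.exp (η * x)

/-- The `q`-number `[x]_q = (q ^ x - q ^ (-x)) / (q - q⁻¹)`. -/
def qnum (η x : ℂ) : ℂ := (qpow η x - qpow η (-x)) / (qpow η 1 - qpow η (-1))

/-- The finite `q`-product `(x; p)_n = (1 - x) (1 - p x) ⋯ (1 - p ^ (n - 1) x)`. -/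
def qPoch (x p : ℂ) (n : ℕ) : ℂ := ∏ k ∈ Finset.range n, (1 - p ^ k * x)

/-- The scalar `q`-exponential function: `e_p(x) = 1 / ∏_{k ≥ 0} (1 - p ^ k x)` for `|p| < 1`, and
`e_p(x) = ∏_{k ≥ 1} (1 - p ^ (-k) x)` for `|p| > 1`. -/
def qExp (p x : ℂ) : ℂ :=
  open Classical in
  if ‖p‖ < 1 then (∏' k : ℕ, (1 - p ^ k * x))⁻¹ else ∏' k : ℕ, (1 - p⁻¹ ^ (k + 1) * x)

theorem tprod_succ {p : ℂ} (hp : ‖p‖ < 1) (x : ℂ) :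
    ∏' k : ℕ, (1 - p ^ k * x) = (1 - x) * ∏' k : ℕ, (1 - p ^ k * (p * x)) := by
  have key : ∀ y : ℂ, Multipliable fun k : ℕ => (1 - p ^ k * y) := by
    intro y
    have hs : Summable fun k : ℕ => ‖-(p ^ k * y)‖ := by
      simp only [norm_neg, norm_mul, norm_pow]
      exact (summable_geometric_of_lt_one (norm_nonneg p) hp).mul_right _
    simpa [sub_eq_add_neg] using multipliable_one_add_of_summable hs
  have h2 : (fun k : ℕ => 1 - p ^ (k + 1) * x) = fun k : ℕ => 1 - p ^ k * (p * x) := by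
    ext k
    ring
  have h3 : Multipliable fun k : ℕ => 1 - p ^ (k + 1) * x := h2 ▸ key (p * x)
  have h4 := tprod_eq_zero_mul' (f := fun k : ℕ => 1 - p ^ k * x) h3
  rw [h4, h2, pow_zero, one_mul]

theorem qExp_mul_pow {p : ℂ} (h0 : p ≠ 0) (hp : ‖p‖ ≠ 1) (n : ℕ) :
    ∀ x : ℂ, qExp p x ≠ 0 → qExp p (x * p ^ n) = qPoch x p n * qExp p x := by
  induction n with
  | zero => intro x _; simp [qPoch]
  | succ n ih =>
    intro x hx
    have hstep : qExp p (x * p ^ n * p) = (1 - p ^ n * x) * qExp p (x * p ^ n) := by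
      by_cases h1 : ‖p‖ < 1
      · have e0 : ∀ y, qExp p y = (∏' k : ℕ, (1 - p ^ k * y))⁻¹ := fun y => by simp [qExp, h1]
        have hnz : ∀ m : ℕ, ∏' k : ℕ, (1 - p ^ k * (x * p ^ m)) ≠ 0 := by
          intro m
          induction m with
          | zero =>
            rw [e0] at hx
            simpa using hx
          | succ m ihm =>
            rw [tprod_succ h1] at ihm
            have := right_ne_zero_of_mul ihm
            rwa [show x * p ^ (m + 1) = p * (x * p ^ m) by ring]
        have hn := hnz n
        rw [e0, e0, show x * p ^ n * p = p * (x * p ^ n) by ring, tprod_succ h1 (x * p ^ n)]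
        rw [tprod_succ h1] at hn
        have a1 := left_ne_zero_of_mul hn
        rw [mul_inv, mul_comm (p ^ n) x, mul_inv_cancel_left₀ a1]
      · have e1 : ∀ y, qExp p y = ∏' k : ℕ, (1 - p⁻¹ ^ (k + 1) * y) := fun y => by
          simp [qExp, h1]
        have hp' : ‖p⁻¹‖ < 1 := by
          rw [norm_inv]
          exact inv_lt_one_of_one_lt₀ (lt_of_le_of_ne (not_lt.mp h1) (Ne.symm hp))
        have e2 : ∀ y, qExp p y = ∏' k : ℕ, (1 - p⁻¹ ^ k * (p⁻¹ * y)) := fun y => by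
          rw [e1]; congr 1; ext k; ring
        rw [e2, e2, show p⁻¹ * (x * p ^ n * p) = x * p ^ n by field_simp, tprod_succ hp',
          mul_comm (p ^ n) x]
    rw [pow_succ, ← mul_assoc, hstep, ih x hx, qPoch, qPoch, Finset.prod_range_succ]
    ring

/-- The normalised quotient of `q`-exponentials is a quotient of finite `q`-products. The left side
is the factor `e(b) / e(a) · e(a v) / e(b v)` evaluated at the eigenvalue `p ^ n` of `v`; the right
side also makes sense where `e(a)` has a pole and the quotient a removable singularity. -/
theorem qExp_ratio {p : ℂ} (h0 : p ≠ 0) (hp : ‖p‖ ≠ 1) (a b : ℂ) (ha : qExp p a ≠ 0)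
    (hb : qExp p b ≠ 0) (n : ℕ) :
    qExp p b / qExp p a * (qExp p (a * p ^ n) / qExp p (b * p ^ n)) =
      qPoch a p n / qPoch b p n := by
  rw [qExp_mul_pow h0 hp n a ha, qExp_mul_pow h0 hp n b hb]
  field_simp

/-! ### Elementary operators on polynomials -/

section Operators

variable {σ : Type*} [DecidableEq σ]

/-- The operator `f (z_i ∂_i)`: it multiplies a monomial of degree `n` in `z_i` by `f n`. -/
def diagOp (i : σ) (f : ℕ → ℂ) : Module.End ℂ (MvPolynomial σ ℂ) :=
  (basisMonomials σ ℂ).constr ℂ fun s => monomial s (f (s i))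

/-- Multiplication by `z_i`. -/
def mulVar (i : σ) : Module.End ℂ (MvPolynomial σ ℂ) := LinearMap.mulLeft ℂ (X i)

/-- Division by `z_i` (monomials without `z_i` are sent to `0`; below it is only applied after
an operator that kills these). -/
def divVar (i : σ) : Module.End ℂ (MvPolynomial σ ℂ) :=
  (basisMonomials σ ℂ).constr ℂ fun s =>
    if s i = 0 then 0 else monomial (s - Finsupp.single i 1) 1

/-- The permutation `P_{ij}` of the variables `z_i` and `z_j`. -/
def permOp (i j : σ) : Module.End ℂ (MvPolynomial σ ℂ) :=
  (rename (Equiv.swap i j) : MvPolynomial σ ℂ →ₐ[ℂ] MvPolynomial σ ℂ).toLinearMap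

/-- `u_{ij} = (z_j / z_i) (1 - q ^ (-2 z_i ∂_i))`. -/
def weylU (η : ℂ) (i j : σ) : Module.End ℂ (MvPolynomial σ ℂ) :=
  mulVar j * divVar i * diagOp i fun n => 1 - qpow η (-2 * n)

/-- The power series `∑_k c_k (u_{ij})^k`. As `u_{ij}` lowers the degree in `z_i` by one
(for `i ≠ j`), only the terms with `k ≤ s i` contribute on the monomial `z^s`. -/
def weylSeries (η : ℂ) (i j : σ) (c : ℕ → ℂ) : Module.End ℂ (MvPolynomial σ ℂ) :=
  (basisMonomials σ ℂ).constr ℂ fun s =>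
    ∑ k ∈ Finset.range (s i + 1), c k • (weylU η i j ^ k) (monomial s 1)

/-- `e_{q²}(c u_{ij})`, where `e_p(x) = ∑_k x ^ k / (p; p)_k`. -/
def expU (η : ℂ) (i j : σ) (c : ℂ) : Module.End ℂ (MvPolynomial σ ℂ) :=
  weylSeries η i j fun k => c ^ k / qPoch (qpow η 2) (qpow η 2) k

/-- `e_{q²}⁻¹(c u_{ij})`, where `e_p⁻¹(x) = ∑_k (-1)^k p ^ (k (k - 1) / 2) x ^ k / (p; p)_k`. -/
def expInvU (η : ℂ) (i j : σ) (c : ℂ) : Module.End ℂ (MvPolynomial σ ℂ) :=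
  weylSeries η i j fun k =>
    (-1) ^ k * qpow η 2 ^ (k * (k - 1) / 2) * c ^ k / qPoch (qpow η 2) (qpow η 2) k

/-- The truncation in `weylSeries` drops only terms that vanish. -/
theorem weylU_pow_monomial (η : ℂ) {i j : σ} (hij : i ≠ j) (s : σ →₀ ℕ) {k : ℕ} (hk : s i < k)
    (c : ℂ) : (weylU η i j ^ k) (monomial s c) = 0 := by
  have hdiag : ∀ (f : ℕ → ℂ) (s : σ →₀ ℕ) (c : ℂ),
      diagOp i f (monomial s c) = monomial s (f (s i) * c) := by
    intro f s c
    have : monomial s c = c • basisMonomials σ ℂ s := by simp [smul_monomial]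
    rw [this, map_smul, diagOp, Module.Basis.constr_basis, smul_monomial, smul_eq_mul, mul_comm]
  have hdiv : ∀ (s : σ →₀ ℕ) (c : ℂ), divVar i (monomial s c) =
      if s i = 0 then 0 else monomial (s - Finsupp.single i 1) c := by
    intro s c
    have : monomial s c = c • basisMonomials σ ℂ s := by simp [smul_monomial]
    rw [this, map_smul, divVar, Module.Basis.constr_basis]
    split_ifs <;> simp [smul_monomial]
  induction k generalizing s c with
  | zero => omega
  | succ k ih =>
    rw [pow_succ, Module.End.mul_apply]
    simp only [weylU, Module.End.mul_apply, hdiag, hdiv]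
    by_cases h : s i = 0
    · simp [h]
    · rw [if_neg h, mulVar, LinearMap.mulLeft_apply, X, monomial_mul]
      apply ih
      simp [hij]
      omega

/-! ### The factors of the Yang–Baxter operator -/

/-- `R⁻_{ij}(u₊, u₋ | v₋)`, namely
`e(q^{2u₊-2u₋}) / e(q^{2u₊-2v₋}) · e(q^{u₋-u₊+2} u_{ij}) · v_i^{(v₋-u₋)/2} ·`
`e(q^{2u₊-2v₋} v_i) / e(q^{2u₊-2u₋} v_i) · e⁻¹(q^{v₋-u₊+2} u_{ij})`
with `e = e_{q²}` and `v_i = q^{2 z_i ∂_i}`. The scalar prefactor is merged with the quotient of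
functions of `v_i`, as in `qExp_ratio`. -/
def Rminus (η : ℂ) (i j : σ) (up um vm : ℂ) : Module.End ℂ (MvPolynomial σ ℂ) :=
  expU η i j (qpow η (um - up + 2)) *
  diagOp i (fun n => qpow η ((vm - um) * n) *
    (qPoch (qpow η (2 * up - 2 * vm)) (qpow η 2) n /
      qPoch (qpow η (2 * up - 2 * um)) (qpow η 2) n)) *
  expInvU η i j (qpow η (vm - up + 2))

/-- `R⁺_{ij}(u₊ | v₊, v₋)`, namely
`e(q^{2v₊-2v₋}) / e(q^{2u₊-2v₋}) · e(q^{v₋-v₊+2} u_{ji}) · v_j^{(v₊-u₊)/2} ·`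
`e(q^{2u₊-2v₋} v_j) / e(q^{2v₊-2v₋} v_j) · e⁻¹(q^{2+v₋-u₊} u_{ji})`
with `e = e_{q²}` and `v_j = q^{2 z_j ∂_j}`; the scalar prefactor is merged as for `R⁻`. -/
def Rplus (η : ℂ) (i j : σ) (up vp vm : ℂ) : Module.End ℂ (MvPolynomial σ ℂ) :=
  expU η j i (qpow η (vm - vp + 2)) *
  diagOp j (fun n => qpow η ((vp - up) * n) *
    (qPoch (qpow η (2 * up - 2 * vm)) (qpow η 2) n /
      qPoch (qpow η (2 * vp - 2 * vm)) (qpow η 2) n)) *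
  expInvU η j i (qpow η (2 + vm - up))

/-- The general Yang–Baxter operator
`R_{ij}(u₊, u₋ | v₊, v₋) = P_{ij} R⁺_{ij}(u₊ | v₊, u₋) R⁻_{ij}(u₊, u₋ | v₋)`. -/
def yangBaxterR (η : ℂ) (i j : σ) (up um vp vm : ℂ) : Module.End ℂ (MvPolynomial σ ℂ) :=
  permOp i j * Rplus η i j up vp um * Rminus η i j up um vm

/-- The Lax operator `L_k(u)` of spin `ℓ`, with `S = z_k ∂_k + ℓ`, `S₋ = -(1/z_k) [z_k ∂_k]_q` and
`S₊ = z_k [z_k ∂_k + 2ℓ]_q`. -/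
def lax (η : ℂ) (k : σ) (u ℓ : ℂ) : Matrix (Fin 2) (Fin 2) (Module.End ℂ (MvPolynomial σ ℂ)) :=
  !![diagOp k fun n => qnum η (u + (n + ℓ)), -(divVar k * diagOp k fun n => qnum η n);
     mulVar k * diagOp k fun n => qnum η (n + 2 * ℓ), diagOp k fun n => qnum η (u - (n + ℓ))]

end Operators

/-! ### Traces over the auxiliary spaces

The quantum space of the chain is `ℂ[z_1, …, z_N]` (variables indexed by `Fin N`). Together with the
auxiliary space it is `ℂ[z_0, z_1, …, z_N]` (variables indexed by `Fin (N + 1)`, the index `0` being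
the auxiliary one). -/

variable {N : ℕ}

/-- The transfer matrix `t(u) = tr L_1(u + δ_1) ⋯ L_N(u + δ_N)`, trace over `ℂ²`. -/
def transferMatrix (η : ℂ) (ℓ δ : Fin N → ℂ) (u : ℂ) : Module.End ℂ (MvPolynomial (Fin N) ℂ) :=
  Matrix.trace (List.ofFn fun k => lax η k (u + δ k) (ℓ k)).prod

/-- `T` is the trace over `V_0 = ℂ[z_0]` of `A`:
`[T Ψ](z_1, …, z_N) = ∑_m (1 / m!) ∂_0^m A (z_0^m Ψ)(z_1, …, z_N)` at `z_0 = 0`, where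
every coefficient of the series converges (unconditionally). -/
def IsAuxTrace (A : Module.End ℂ (MvPolynomial (Fin (N + 1)) ℂ))
    (T : Module.End ℂ (MvPolynomial (Fin N) ℂ)) : Prop :=
  ∀ (Ψ : MvPolynomial (Fin N) ℂ) (a : Fin N →₀ ℕ),
    HasSum (fun m : ℕ => coeff (Finsupp.cons m a) (A (X 0 ^ m * rename Fin.succ Ψ)))
      (coeff a (T Ψ))

theorem IsAuxTrace.unique {A : Module.End ℂ (MvPolynomial (Fin (N + 1)) ℂ)}
    {T T' : Module.End ℂ (MvPolynomial (Fin N) ℂ)} (h : IsAuxTrace A T) (h' : IsAuxTrace A T') :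
    T = T' :=
  LinearMap.ext fun Ψ => MvPolynomial.ext _ _ fun a => (h Ψ a).unique (h' Ψ a)

open Classical in
/-- The trace over `V_0 = ℂ[z_0]` (and `0` if it does not exist). -/
def auxTrace (A : Module.End ℂ (MvPolynomial (Fin (N + 1)) ℂ)) :
    Module.End ℂ (MvPolynomial (Fin N) ℂ) :=
  if h : ∃ T, IsAuxTrace A T then h.choose else 0

theorem IsAuxTrace.auxTrace_eq {A : Module.End ℂ (MvPolynomial (Fin (N + 1)) ℂ)}
    {T : Module.End ℂ (MvPolynomial (Fin N) ℂ)} (h : IsAuxTrace A T) : auxTrace A = T := by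
  have hex : ∃ T, IsAuxTrace A T := ⟨T, h⟩
  rw [auxTrace, dif_pos hex]
  exact hex.choose_spec.unique h

/-- The product `R_{10}(u + δ_1) R_{20}(u + δ_2) ⋯ R_{N0}(u + δ_N)` with auxiliary spin `ℓ₀`. -/
def monodromy (η : ℂ) (ℓ δ : Fin N → ℂ) (u ℓ₀ : ℂ) :
    Module.End ℂ (MvPolynomial (Fin (N + 1)) ℂ) :=
  (List.ofFn fun k : Fin N =>
    yangBaxterR η k.succ 0 (u + δ k + ℓ k) (u + δ k - ℓ k) ℓ₀ (-ℓ₀)).prod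

/-- The generalized monodromy in the parameters `u₁ = 1 + u - ℓ₀`, `u₂ = u + ℓ₀`. -/
def monodromy₂ (η : ℂ) (ℓ δ : Fin N → ℂ) (u₁ u₂ : ℂ) :
    Module.End ℂ (MvPolynomial (Fin (N + 1)) ℂ) :=
  monodromy η ℓ δ ((u₁ + u₂ - 1) / 2) ((u₂ - u₁ + 1) / 2)

/-- The two-parametric operator `Q(u₁ | u₂)`, the trace over `V_0` of the product of the `R_{k0}`. -/
def Qop (η : ℂ) (ℓ δ : Fin N → ℂ) (u₁ u₂ : ℂ) : Module.End ℂ (MvPolynomial (Fin N) ℂ) :=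
  auxTrace (monodromy₂ η ℓ δ u₁ u₂)

/-- The product `P_{10} R⁻_{10}(u₊, u₋ | 0) ⋯ P_{N0} R⁻_{N0}(u₊, u₋ | 0)`, `u_± = u ± ℓ`. -/
def monodromyMinus (N : ℕ) (η ℓ u : ℂ) : Module.End ℂ (MvPolynomial (Fin (N + 1)) ℂ) :=
  (List.ofFn fun k : Fin N => permOp k.succ 0 * Rminus η k.succ 0 (u + ℓ) (u - ℓ) 0).prod

/-- The product `P_{10} R⁺_{10}(u₊ | 1, u₋) ⋯ P_{N0} R⁺_{N0}(u₊ | 1, u₋)`, `u_± = u ± ℓ`. -/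
def monodromyPlus (N : ℕ) (η ℓ u : ℂ) : Module.End ℂ (MvPolynomial (Fin (N + 1)) ℂ) :=
  (List.ofFn fun k : Fin N => permOp k.succ 0 * Rplus η k.succ 0 (u + ℓ) 1 (u - ℓ)).prod

/-! ### The homogeneous chain: `ℓ_k = ℓ`, `δ_k = 0` -/

/-- `t(u)` for the homogeneous chain. -/
def tHom (N : ℕ) (η ℓ u : ℂ) : Module.End ℂ (MvPolynomial (Fin N) ℂ) :=
  transferMatrix η (fun _ => ℓ) (fun _ => 0) u

/-- `Q(u₁ | u₂)` for the homogeneous chain. -/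
def QHom (N : ℕ) (η ℓ u₁ u₂ : ℂ) : Module.End ℂ (MvPolynomial (Fin N) ℂ) :=
  Qop η (fun _ => ℓ) (fun _ => 0) u₁ u₂

/-- `Q₋(u) = Q(1 - ℓ | u)`. -/
def Qminus (N : ℕ) (η ℓ u : ℂ) : Module.End ℂ (MvPolynomial (Fin N) ℂ) := QHom N η ℓ (1 - ℓ) u

/-- `Q₊(u) = Q(u | ℓ)`. -/
def Qplus (N : ℕ) (η ℓ u : ℂ) : Module.End ℂ (MvPolynomial (Fin N) ℂ) := QHom N η ℓ u ℓ

/-- `u` is not a pole of `R⁺_{k0}(u + ℓ | 1, u - ℓ)`: no factor `1 - q ^ (2 + 2ℓ - 2u + 2n)`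
vanishes. -/
def RegularPlus (η ℓ u : ℂ) : Prop := ∀ n : ℕ, qpow η (2 + 2 * ℓ - 2 * u + 2 * n) ≠ 1

end XXZ

end

/-!
The idea is to replace every trace over the auxiliary space by an explicit sum over paths, to prove
the two Baxter equations termwise, and to deduce all commutation relations from them.

**Matrix elements.** Both `R⁻` and `R⁺` are instances of one operator `weylConj`. A finite form of
the `q`-Chu–Vandermonde sum shows that its matrix elements on monomials factorise
(`weylConj_monomial`), and that it is the identity when its two parameters agree
(`weylConj_self`). The latter makes `R⁺` trivial at `u₁ = 1 - ℓ` and `R⁻` trivial at `u₂ = ℓ`, so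
`Q₋` and `Q₊` are traces of products of one kind of factor. The matrix elements of such a trace are
sums of products of local weights `kappaMinus`, `kappaPlus` (`auxTrace_hopping`). The sums are
finite for `Q₋` and converge geometrically for `Q₊`.

**Baxter equations.** The Lax matrix combined with the local weights becomes triangular after
conjugation by the unipotent matrix with off-diagonal entry `z_0`, and the diagonal entries are the
weights at the shifted spectral parameters `u ± 1` (`triangularizes_minus`, `triangularizes_plus`).
Triangularity is stable under products over the sites, and the trace of the product is the sum of
the traces of the diagonal entries (`Triangularizes.trace`), because the error telescopes. This
gives `t(u)` on the right for `Q₋` (`baxter_right`) and on the left for `Q₊` (`baxter_left`).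

**Commutation.** The transfer matrices commute with each other by the exchange relation with the
six-vertex `R`-matrix, and with the cyclic shift `rotOp` of the homogeneous chain. Moreover
`Q₋(ℓ) = Q₊(1 - ℓ) = rotOp`. Let `B` commute with `rotOp` and with all `t(v)`.

* `B` commutes with every `Q₋(u)` (`Qminus_commute`): as `Δ₋(ℓ) = 0`, the Baxter equation expresses
  `Q₋(ℓ + n)` successively through `rotOp` and transfer matrices, and the matrix elements of `Q₋(u)`
  are Laurent polynomials in `q ^ (-u)`, so infinitely many points suffice.
* If `B` also preserves the degree, then it commutes with `Q₊(u)` for every regular `u`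
  (`Qplus_commute`). One may assume `|q| < 1`, since the `q`-numbers do not change under
  `q ↦ q⁻¹`. In the variable `Y = q ^ (-u)` the matrix elements of `Q₊` are, up to a power of `Y`,
  analytic in a disc around `0` that contains the point `q ^ (ℓ - 1)`. A comparison of leading
  coefficients shows that an analytic solution of the Baxter equation is determined by its value at
  `Y = 0` (`IsBaxterSolution.eq_zero`). By the invertibility of `rotOp` it is then determined by its
  value at `Y = q ^ (ℓ - 1)` within the span of the columns of `Q₊`, where the commutator with `B`
  vanishes. Outside the disc the Baxter equation continues the commutation relation from `u - 1` and
  `u - 2` to `u`.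

Taking for `B` the operators `t(v)`, `rotOp`, `Q₋(v)` and `Q₊(v)` gives all the assertions.
-/

noncomputable section

namespace XXZ

open MvPolynomial Finset

/-! ### `q`-numbers and the coefficients of the factors of the Yang–Baxter operator -/

theorem qpow_add (η x y : ℂ) : qpow η (x + y) = qpow η x * qpow η y := by
  rw [qpow, mul_add, Complex.exp_add, qpow, qpow]

theorem qpow_ne_zero (η x : ℂ) : qpow η x ≠ 0 := Complex.exp_ne_zero _

theorem qpow_zero (η : ℂ) : qpow η 0 = 1 := by simp [qpow]

theorem qpow_neg (η x : ℂ) : qpow η (-x) = (qpow η x)⁻¹ := by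
  rw [qpow, mul_neg, Complex.exp_neg, qpow]

theorem qpow_sub (η x y : ℂ) : qpow η (x - y) = qpow η x / qpow η y := by
  rw [sub_eq_add_neg, qpow_add, qpow_neg, div_eq_mul_inv]

theorem qpow_nat_mul (η x : ℂ) (n : ℕ) : qpow η (n * x) = qpow η x ^ n := by
  rw [qpow, qpow, ← Complex.exp_nat_mul]; congr 1; ring

theorem qpow_mul_nat (η x : ℂ) (n : ℕ) : qpow η (x * n) = qpow η x ^ n := by
  rw [mul_comm, qpow_nat_mul]

theorem qpow_natCast (η : ℂ) (n : ℕ) : qpow η n = qpow η 1 ^ n := by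
  rw [← qpow_nat_mul, mul_one]

theorem qpow_two_mul (η x : ℂ) : qpow η (2 * x) = qpow η x ^ 2 := by
  rw [← qpow_nat_mul]; norm_num

theorem qpow_two (η : ℂ) : qpow η 2 = qpow η 1 ^ 2 := by
  rw [← qpow_two_mul, mul_one]

theorem norm_qpow (η x : ℂ) : ‖qpow η x‖ = Real.exp (η * x).re := by
  rw [qpow, Complex.norm_exp]

theorem norm_qpow_one_ne {η : ℂ} (hη : η.re ≠ 0) : ‖qpow η 1‖ ≠ 1 := by
  rw [norm_qpow, mul_one, Ne, Real.exp_eq_one_iff]; exact hη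

theorem qpow_two_pow_ne_one {η : ℂ} (hη : η.re ≠ 0) (n : ℕ) : 1 - qpow η 2 ^ (n + 1) ≠ 0 := by
  intro h
  have h1 : ‖qpow η 1‖ ^ (2 * (n + 1)) = 1 := by
    rw [← norm_pow, pow_mul, ← qpow_two, ← sub_eq_zero.1 h, norm_one]
  exact norm_qpow_one_ne hη ((pow_eq_one_iff_of_nonneg (norm_nonneg _) (by omega)).1 h1)

theorem q_sub_q_inv_ne_zero {η : ℂ} (hη : η.re ≠ 0) : qpow η 1 - qpow η (-1) ≠ 0 := by
  intro h
  have h2 := qpow_two_pow_ne_one hη 0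
  rw [qpow_neg] at h
  have h0 := qpow_ne_zero η 1
  apply h2
  field_simp at h
  rw [mul_zero] at h
  rw [zero_add, pow_one, qpow_two, sub_eq_zero]
  exact (sub_eq_zero.1 h).symm

theorem qnum_neg (η x : ℂ) : qnum η (-x) = -qnum η x := by
  rw [qnum, qnum, neg_neg, ← neg_div, neg_sub]

theorem qnum_zero (η : ℂ) : qnum η 0 = 0 := by simp [qnum]

theorem qnum_one {η : ℂ} (hη : η.re ≠ 0) : qnum η 1 = 1 := div_self (q_sub_q_inv_ne_zero hη)

/-- The `q`-numbers do not distinguish `q` from `q⁻¹`. -/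
theorem qnum_neg_eta (η x : ℂ) : qnum (-η) x = qnum η x := by
  have h : ∀ y, qpow (-η) y = qpow η (-y) := fun y => by simp [qpow]
  rw [qnum, qnum, h, h, h, h, neg_neg, neg_neg, ← neg_sub, ← neg_sub (qpow η 1), neg_div_neg_eq]

theorem one_sub_qpow {η : ℂ} (hη : η.re ≠ 0) (x : ℂ) :
    1 - qpow η (2 * x) = -((qpow η 1 - qpow η (-1)) * qpow η x * qnum η x) := by
  have h := q_sub_q_inv_ne_zero hη
  have h0 := qpow_ne_zero η x
  rw [qnum, qpow_neg η x, qpow_two_mul]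
  field_simp
  ring

theorem qnum_eq_zero_iff {η : ℂ} (hη : η.re ≠ 0) {x : ℂ} : qnum η x = 0 ↔ qpow η (2 * x) = 1 := by
  have h := one_sub_qpow hη x
  constructor
  · intro hx
    rw [hx, mul_zero, neg_zero, sub_eq_zero] at h
    exact h.symm
  · intro hx
    rw [hx, sub_self, eq_comm, neg_eq_zero] at h
    simpa [q_sub_q_inv_ne_zero hη, qpow_ne_zero] using h

theorem qnum_natCast_succ_ne_zero {η : ℂ} (hη : η.re ≠ 0) (n : ℕ) : qnum η (n + 1) ≠ 0 := by
  intro h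
  rw [qnum_eq_zero_iff hη, mul_comm, ← Nat.cast_succ, qpow_nat_mul] at h
  exact qpow_two_pow_ne_one hη n (by rw [h, sub_self])

/-- The identity behind all local exchange relations below. -/
theorem qnum_mul_sub (η x y c : ℂ) :
    qnum η x * qnum η y - qnum η (x - c) * qnum η (y + c) = qnum η c * qnum η (y - x + c) := by
  simp only [qnum, qpow_neg, qpow_sub, qpow_add]
  have hx := qpow_ne_zero η x
  have hy := qpow_ne_zero η y
  have hc := qpow_ne_zero η c
  generalize qpow η 1 - (qpow η 1)⁻¹ = d
  rcases eq_or_ne d 0 with rfl | hd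
  · simp
  field_simp
  ring

/-- The `q`-analogue `∏_{i < n} [x + i]_q / [i + 1]_q` of the binomial coefficient
`x (x + 1) ⋯ (x + n - 1) / n!`. -/
def riseBin (η x : ℂ) (n : ℕ) : ℂ := ∏ i ∈ range n, qnum η (x + i) / qnum η (i + 1)

@[simp] theorem riseBin_zero_right (η x : ℂ) : riseBin η x 0 = 1 := by simp [riseBin]

theorem riseBin_succ (η x : ℂ) (n : ℕ) :
    riseBin η x (n + 1) = riseBin η x n * (qnum η (x + n) / qnum η (n + 1)) := prod_range_succ _ _

theorem riseBin_succ_mul {η : ℂ} (hη : η.re ≠ 0) (x : ℂ) (n : ℕ) :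
    riseBin η x (n + 1) * qnum η (n + 1) = riseBin η x n * qnum η (x + n) := by
  have := qnum_natCast_succ_ne_zero hη n
  rw [riseBin_succ]
  field_simp

theorem qnum_mul_riseBin_add_one (η x : ℂ) (n : ℕ) :
    qnum η x * riseBin η (x + 1) n = riseBin η x n * qnum η (x + n) := by
  rw [riseBin, riseBin, prod_div_distrib, prod_div_distrib, mul_div_assoc', div_mul_eq_mul_div]
  congr 1
  rw [← prod_range_succ (fun i : ℕ => qnum η (x + i)), prod_range_succ', mul_comm]
  simp only [Nat.cast_add, Nat.cast_one, Nat.cast_zero, add_zero, add_assoc, add_comm (1 : ℂ)]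

theorem riseBin_zero_left (η : ℂ) (n : ℕ) : riseBin η 0 n = if n = 0 then 1 else 0 := by
  rcases n with _ | n
  · simp
  · rw [riseBin, prod_range_succ']
    simp [qnum_zero]

theorem riseBin_ne_zero {η : ℂ} (hη : η.re ≠ 0) {x : ℂ}
    (hx : ∀ n : ℕ, qpow η (2 * (x + n)) ≠ 1) (n : ℕ) : riseBin η x n ≠ 0 :=
  prod_ne_zero_iff.2 fun i _ =>
    div_ne_zero (fun h => hx i ((qnum_eq_zero_iff hη).1 h)) (qnum_natCast_succ_ne_zero hη i)

theorem qPoch_succ (x p : ℂ) (n : ℕ) : qPoch x p (n + 1) = qPoch x p n * (1 - p ^ n * x) :=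
  prod_range_succ _ _

theorem qPoch_succ' (x p : ℂ) (n : ℕ) : qPoch x p (n + 1) = (1 - x) * qPoch (p * x) p n := by
  rw [qPoch, prod_range_succ', qPoch, mul_comm, pow_zero, one_mul]
  congr 1
  exact prod_congr rfl fun i _ => by ring

theorem qPoch_add (x p : ℂ) (m n : ℕ) :
    qPoch x p (m + n) = qPoch x p m * qPoch (p ^ m * x) p n := by
  rw [qPoch, prod_range_add, qPoch, qPoch]
  congr 1
  exact prod_congr rfl fun i _ => by ring

theorem qPoch_self_ne_zero {η : ℂ} (hη : η.re ≠ 0) (n : ℕ) :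
    qPoch (qpow η 2) (qpow η 2) n ≠ 0 :=
  prod_ne_zero_iff.2 fun i _ => by rw [← pow_succ]; exact qpow_two_pow_ne_one hη i

/-- `riseBin` in terms of `q`-products. -/
theorem qPoch_eq_riseBin {η : ℂ} (hη : η.re ≠ 0) (x : ℂ) (n : ℕ) :
    qPoch (qpow η (2 * x)) (qpow η 2) n =
      qPoch (qpow η 2) (qpow η 2) n * qpow η (x - 1) ^ n * riseBin η x n := by
  induction n with
  | zero => simp [qPoch]
  | succ n ih =>
    rw [qPoch_succ, qPoch_succ, ih, riseBin_succ]
    have e1 : (1 : ℂ) - qpow η 2 ^ n * qpow η (2 * x) = 1 - qpow η (2 * (x + n)) := by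
      rw [mul_add, qpow_add, ← qpow_mul_nat, mul_comm]
    have e2 : (1 : ℂ) - qpow η 2 ^ n * qpow η 2 = 1 - qpow η (2 * (n + 1)) := by
      rw [mul_add, qpow_add, ← qpow_mul_nat, mul_one]
    have e3 : qpow η (x + n) = qpow η (x - 1) * qpow η (n + 1) := by
      rw [← qpow_add]; congr 1; ring
    have := qnum_natCast_succ_ne_zero hη n
    rw [e1, e2, one_sub_qpow hη, one_sub_qpow hη, e3]
    field_simp
    ring

theorem half_mul_succ (k : ℕ) : (k + 1) * (k + 1 - 1) / 2 = k * (k - 1) / 2 + k := by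
  have := Nat.triangle_succ k
  simpa using this

/-- The alternating sum over `k + j = n` whose weights are `q`-binomial coefficients obeys a
`q`-Pascal recursion. -/
theorem qPascal {p : ℂ} (hp : ∀ n : ℕ, qPoch p p n ≠ 0) (f : ℕ → ℂ) (n : ℕ) :
    (1 - p ^ (n + 1)) * ∑ x ∈ antidiagonal (n + 1),
        (-1) ^ x.1 * p ^ (x.1 * (x.1 - 1) / 2) / (qPoch p p x.1 * qPoch p p x.2) * f x.2 =
      ∑ x ∈ antidiagonal n, (-1) ^ x.1 * p ^ (x.1 * (x.1 - 1) / 2) /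
          (qPoch p p x.1 * qPoch p p x.2) * f (x.2 + 1) -
      p ^ n * ∑ x ∈ antidiagonal n, (-1) ^ x.1 * p ^ (x.1 * (x.1 - 1) / 2) /
          (qPoch p p x.1 * qPoch p p x.2) * f x.2 := by
  have hs : ∀ n, qPoch p p (n + 1) = qPoch p p n * (1 - p ^ (n + 1)) := fun n => by
    rw [qPoch_succ, pow_succ]
  have hne : ∀ n, (1 : ℂ) - p ^ (n + 1) ≠ 0 := fun n h => hp (n + 1) (by rw [hs, h, mul_zero])
  have split : ∀ x ∈ antidiagonal (n + 1),
      (1 - p ^ (n + 1)) * ((-1) ^ x.1 * p ^ (x.1 * (x.1 - 1) / 2) /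
        (qPoch p p x.1 * qPoch p p x.2) * f x.2) =
      (1 - p ^ x.2) * ((-1) ^ x.1 * p ^ (x.1 * (x.1 - 1) / 2) /
        (qPoch p p x.1 * qPoch p p x.2) * f x.2) +
      p ^ x.2 * (1 - p ^ x.1) * ((-1) ^ x.1 * p ^ (x.1 * (x.1 - 1) / 2) /
        (qPoch p p x.1 * qPoch p p x.2) * f x.2) := by
    intro x hx
    rw [HasAntidiagonal.mem_antidiagonal] at hx
    rw [← hx, pow_add]
    ring
  rw [mul_sum, sum_congr rfl split, sum_add_distrib, sub_eq_add_neg]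
  congr 1
  · rw [Finset.Nat.sum_antidiagonal_succ']
    simp only [pow_zero, sub_self, zero_mul, zero_add]
    refine sum_congr rfl fun x _ => ?_
    rw [hs]
    have := hne x.2
    have := hp x.1
    have := hp x.2
    field_simp
  · rw [Finset.Nat.sum_antidiagonal_succ, mul_sum, ← sum_neg_distrib]
    simp only [pow_zero, sub_self, zero_mul, zero_add, mul_zero]
    refine sum_congr rfl fun x hx => ?_
    rw [HasAntidiagonal.mem_antidiagonal] at hx
    rw [hs, half_mul_succ, ← hx]
    have := hne x.1
    have := hp x.1
    have := hp x.2
    field_simp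
    ring

/-- A finite form of the `q`-Chu–Vandermonde summation: iterated `q`-differences of
`(A; p)_m / (B; p)_m` factorise. -/
theorem qVandermonde {p A B : ℂ} (hp : ∀ n : ℕ, qPoch p p n ≠ 0) (hB : ∀ n : ℕ, qPoch B p n ≠ 0)
    (n r : ℕ) :
    ∑ x ∈ antidiagonal n, (-1) ^ x.1 * p ^ (x.1 * (x.1 - 1) / 2) /
        (qPoch p p x.1 * qPoch p p x.2) * (qPoch A p (r + x.2) / qPoch B p (r + x.2)) =
      qPoch A p r / qPoch B p (r + n) * p ^ (n * r + n * (n - 1) / 2) *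
        (∏ i ∈ range n, (B * p ^ i - A)) / qPoch p p n := by
  induction n generalizing r with
  | zero => simp [qPoch]
  | succ n ih =>
    have hs : qPoch p p (n + 1) = qPoch p p n * (1 - p ^ (n + 1)) := by
      rw [qPoch_succ, pow_succ]
    have hne : (1 : ℂ) - p ^ (n + 1) ≠ 0 := fun h => hp (n + 1) (by rw [hs, h, mul_zero])
    have key := qPascal hp (fun m => qPoch A p (r + m) / qPoch B p (r + m)) n
    have ih1 := ih (r + 1)
    have ih0 := ih r
    simp only [add_assoc, add_comm 1] at ih1
    rw [ih1, ih0] at key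
    rw [← mul_right_inj' hne, key, hs, prod_range_succ, half_mul_succ, qPoch_succ A p r,
      show r + (n + 1) = r + n + 1 by ring, qPoch_succ B p (r + n)]
    have h1 := hB (r + n)
    have h2 : 1 - p ^ (r + n) * B ≠ 0 := fun h => hB (r + n + 1) (by rw [qPoch_succ, h, mul_zero])
    have h3 := hp n
    field_simp
    ring

/-- Reversal of the order of the factors in `(p ^ (-(r + n)); p)_n`. -/
theorem qPoch_neg_pow {p : ℂ} (h0 : p ≠ 0) (r n : ℕ) :
    qPoch ((p ^ (r + n))⁻¹) p n * qPoch p p r * p ^ (n * r + n * (n - 1) / 2 + n) =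
      (-1) ^ n * qPoch p p (r + n) := by
  induction n with
  | zero => simp [qPoch]
  | succ n ih =>
    rw [qPoch_succ', show r + (n + 1) = r + n + 1 by ring, qPoch_succ p p (r + n), half_mul_succ,
      show p * (p ^ (r + n + 1))⁻¹ = (p ^ (r + n))⁻¹ by field_simp; ring, pow_succ (-1 : ℂ)]
    have e : (1 - (p ^ (r + n + 1))⁻¹) * p ^ (r + n + 1) = -(1 - p ^ (r + n) * p) := by
      field_simp; ring
    linear_combination (1 - (p ^ (r + n + 1))⁻¹) * p ^ (r + n + 1) * ih
      + (-1) ^ n * qPoch p p (r + n) * e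

section Operators

variable {σ : Type*}

theorem diagOp_monomial (i : σ) (f : ℕ → ℂ) (s : σ →₀ ℕ) (c : ℂ) :
    diagOp i f (monomial s c) = monomial s (f (s i) * c) := by
  have : monomial s c = c • basisMonomials σ ℂ s := by simp [smul_monomial]
  rw [this, map_smul, diagOp, Module.Basis.constr_basis, smul_monomial, smul_eq_mul, mul_comm]

theorem divVar_monomial (i : σ) (s : σ →₀ ℕ) (c : ℂ) : divVar i (monomial s c) =
    if s i = 0 then 0 else monomial (s - Finsupp.single i 1) c := by
  have : monomial s c = c • basisMonomials σ ℂ s := by simp [smul_monomial]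
  rw [this, map_smul, divVar, Module.Basis.constr_basis]
  split_ifs <;> simp [smul_monomial]

theorem mulVar_monomial (i : σ) (s : σ →₀ ℕ) (c : ℂ) :
    mulVar i (monomial s c) = monomial (s + Finsupp.single i 1) c := by
  rw [mulVar, LinearMap.mulLeft_apply, X, monomial_mul, one_mul, add_comm]

/-- The common shape of `R⁻_{ij}` and `R⁺_{ji}`: `x` and `y` are the differences of spectral
parameters in the numerator and in the denominator of the middle factor. -/
def weylConj (η : ℂ) (i j : σ) (x y : ℂ) : Module.End ℂ (MvPolynomial σ ℂ) :=
  expU η i j (qpow η (2 - y)) *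
  diagOp i (fun n => qpow η ((y - x) * n) *
    (qPoch (qpow η (2 * x)) (qpow η 2) n / qPoch (qpow η (2 * y)) (qpow η 2) n)) *
  expInvU η i j (qpow η (2 - x))

theorem Rminus_eq_weylConj (η : ℂ) (i j : σ) (up um vm : ℂ) :
    Rminus η i j up um vm = weylConj η i j (up - vm) (up - um) := by
  have e1 : 2 - (up - vm) = vm - up + 2 := by ring
  have e2 : 2 - (up - um) = um - up + 2 := by ring
  have e3 : up - um - (up - vm) = vm - um := by ring
  have e4 : 2 * (up - vm) = 2 * up - 2 * vm := by ring
  have e5 : 2 * (up - um) = 2 * up - 2 * um := by ring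
  rw [Rminus, weylConj, e1, e2, e3, e4, e5]

theorem Rplus_eq_weylConj (η : ℂ) (i j : σ) (up vp vm : ℂ) :
    Rplus η i j up vp vm = weylConj η j i (up - vm) (vp - vm) := by
  have e1 : 2 - (up - vm) = 2 + vm - up := by ring
  have e2 : 2 - (vp - vm) = vm - vp + 2 := by ring
  have e3 : vp - vm - (up - vm) = vp - up := by ring
  have e4 : 2 * (up - vm) = 2 * up - 2 * vm := by ring
  have e5 : 2 * (vp - vm) = 2 * vp - 2 * vm := by ring
  rw [Rplus, weylConj, e1, e2, e3, e4, e5]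

theorem qpow_neg_two_mul_nat (η : ℂ) (n : ℕ) : qpow η (-2 * n) = (qpow η 2 ^ n)⁻¹ := by
  rw [neg_mul, qpow_neg, qpow_mul_nat]

theorem weylU_monomial (η : ℂ) {i j : σ} (hij : i ≠ j) {t : σ →₀ ℕ} (ht : t i = 0) (a b : ℕ) :
    weylU η i j (monomial (t + Finsupp.single i (a + 1) + Finsupp.single j b) 1) =
      (1 - (qpow η 2 ^ (a + 1))⁻¹) •
        monomial (t + Finsupp.single i a + Finsupp.single j (b + 1)) (1 : ℂ) := by
  rw [weylU, Module.End.mul_apply, Module.End.mul_apply, diagOp_monomial, divVar_monomial,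
    qpow_neg_two_mul_nat]
  have h1 : (t + Finsupp.single i (a + 1) + Finsupp.single j b) i = a + 1 := by simp [ht, hij]
  rw [h1, if_neg (Nat.succ_ne_zero a), mulVar_monomial, smul_monomial, smul_eq_mul]
  congr 2
  rw [Finsupp.single_add i, Finsupp.single_add j, ← add_assoc, ← add_assoc, add_right_comm _
    (Finsupp.single i 1), add_tsub_cancel_right]

theorem weylU_pow_monomial_eq (η : ℂ) {i j : σ} (hij : i ≠ j) {t : σ →₀ ℕ} (ht : t i = 0)
    (k r b : ℕ) :
    (weylU η i j ^ k) (monomial (t + Finsupp.single i (r + k) + Finsupp.single j b) 1) =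
      qPoch ((qpow η 2 ^ (r + k))⁻¹) (qpow η 2) k •
        monomial (t + Finsupp.single i r + Finsupp.single j (b + k)) (1 : ℂ) := by
  induction k generalizing b with
  | zero => simp [qPoch]
  | succ k ih =>
    have h0 := qpow_ne_zero η 2
    rw [pow_succ, Module.End.mul_apply, ← add_assoc r, weylU_monomial η hij ht, map_smul, ih,
      smul_smul, qPoch_succ', show qpow η 2 * (qpow η 2 ^ (r + k + 1))⁻¹ = (qpow η 2 ^ (r + k))⁻¹ by
        field_simp; ring, add_assoc b, add_comm 1 k]

theorem weylSeries_monomial (η : ℂ) {i j : σ} (hij : i ≠ j) {t : σ →₀ ℕ} (ht : t i = 0)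
    (c : ℕ → ℂ) (a b : ℕ) :
    weylSeries η i j c (monomial (t + Finsupp.single i a + Finsupp.single j b) 1) =
      ∑ x ∈ antidiagonal a, (c x.1 * qPoch ((qpow η 2 ^ a)⁻¹) (qpow η 2) x.1) •
        monomial (t + Finsupp.single i x.2 + Finsupp.single j (b + x.1)) (1 : ℂ) := by
  have h1 : (t + Finsupp.single i a + Finsupp.single j b) i = a := by simp [ht, hij]
  have h2 := (basisMonomials σ ℂ).constr_basis ℂ
    (fun s => ∑ k ∈ range (s i + 1), c k • (weylU η i j ^ k) (monomial s 1))
    (t + Finsupp.single i a + Finsupp.single j b)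
  rw [coe_basisMonomials, h1] at h2
  rw [weylSeries, h2, ← Finset.Nat.sum_antidiagonal_eq_sum_range_succ_mk
    (fun x : ℕ × ℕ => c x.1 • (weylU η i j ^ x.1)
      (monomial (t + Finsupp.single i a + Finsupp.single j b) 1))]
  refine sum_congr rfl fun x hx => ?_
  rw [HasAntidiagonal.mem_antidiagonal, add_comm] at hx
  rw [← hx, weylU_pow_monomial_eq η hij ht, smul_smul]

theorem sum_antidiagonal_assoc {M : Type*} [AddCommMonoid M] (f : ℕ → ℕ → ℕ → M) (a : ℕ) :
    ∑ x ∈ antidiagonal a, ∑ y ∈ antidiagonal x.2, f x.1 y.1 y.2 =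
      ∑ x ∈ antidiagonal a, ∑ y ∈ antidiagonal x.1, f y.1 y.2 x.2 := by
  rw [sum_sigma', sum_sigma']
  refine sum_nbij' (fun x => ⟨(x.1.1 + x.2.1, x.2.2), (x.1.1, x.2.1)⟩)
    (fun x => ⟨(x.2.1, x.2.2 + x.1.2), (x.2.2, x.1.2)⟩) ?_ ?_ ?_ ?_ ?_ <;>
  simp only [mem_sigma, HasAntidiagonal.mem_antidiagonal, Sigma.forall, Prod.forall] <;> grind

theorem prod_mul_pow_sub {p A B : ℂ} (hA : A ≠ 0) (n : ℕ) :
    ∏ i ∈ range n, (B * p ^ i - A) = (-1) ^ n * A ^ n * qPoch (B / A) p n := by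
  rw [qPoch, ← mul_pow, ← card_range n, ← prod_const, card_range, ← prod_mul_distrib]
  refine prod_congr rfl fun i _ => ?_
  field_simp
  ring

/-- The coefficient of `z_i ^ r z_j ^ n` in the image of `z_i ^ (r + n)` under `weylConj`. -/
theorem weylConj_coeff {η : ℂ} (hη : η.re ≠ 0) (x : ℂ) {y : ℂ}
    (hy : ∀ n : ℕ, qpow η (2 * (y + n)) ≠ 1) (r n : ℕ) :
    ∑ k ∈ antidiagonal n, ((-1) ^ k.1 * qpow η 2 ^ (k.1 * (k.1 - 1) / 2) * qpow η (2 - x) ^ k.1 /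
        qPoch (qpow η 2) (qpow η 2) k.1 * qPoch ((qpow η 2 ^ (r + n))⁻¹) (qpow η 2) k.1) *
      (qpow η ((y - x) * (r + k.2 : ℕ)) * (qPoch (qpow η (2 * x)) (qpow η 2) (r + k.2) /
        qPoch (qpow η (2 * y)) (qpow η 2) (r + k.2))) *
      (qpow η (2 - y) ^ k.2 / qPoch (qpow η 2) (qpow η 2) k.2 *
        qPoch ((qpow η 2 ^ (r + k.2))⁻¹) (qpow η 2) k.2) =
      riseBin η x r * riseBin η (y - x) n / riseBin η y (r + n) := by
  set p := qpow η 2 with hpdef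
  have hp0 : p ≠ 0 := qpow_ne_zero η 2
  have hp : ∀ n, qPoch p p n ≠ 0 := qPoch_self_ne_zero hη
  have hBy : ∀ n, riseBin η y n ≠ 0 := riseBin_ne_zero hη hy
  have hB : ∀ n, qPoch (qpow η (2 * y)) p n ≠ 0 := fun n => by
    rw [qPoch_eq_riseBin hη]
    exact mul_ne_zero (mul_ne_zero (hp n) (pow_ne_zero _ (qpow_ne_zero _ _))) (hBy n)
  have hA0 : qpow η (2 * x) ≠ 0 := qpow_ne_zero _ _
  -- Every term is, up to a common factor, a term of the `q`-Chu–Vandermonde sum.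
  have step : ∀ k ∈ antidiagonal n,
      ((-1) ^ k.1 * p ^ (k.1 * (k.1 - 1) / 2) * qpow η (2 - x) ^ k.1 /
        qPoch p p k.1 * qPoch ((p ^ (r + n))⁻¹) p k.1) *
      (qpow η ((y - x) * (r + k.2 : ℕ)) * (qPoch (qpow η (2 * x)) p (r + k.2) /
        qPoch (qpow η (2 * y)) p (r + k.2))) *
      (qpow η (2 - y) ^ k.2 / qPoch p p k.2 * qPoch ((p ^ (r + k.2))⁻¹) p k.2) =
      (qPoch ((p ^ (r + n))⁻¹) p n * (qpow η (2 - y) ^ n * qpow η (y - x) ^ (r + n))) *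
      ((-1) ^ k.1 * p ^ (k.1 * (k.1 - 1) / 2) / (qPoch p p k.1 * qPoch p p k.2) *
        (qPoch (qpow η (2 * x)) p (r + k.2) / qPoch (qpow η (2 * y)) p (r + k.2))) := by
    intro k hk
    rw [HasAntidiagonal.mem_antidiagonal] at hk
    have e1 : qPoch ((p ^ (r + n))⁻¹) p n =
        qPoch ((p ^ (r + n))⁻¹) p k.1 * qPoch ((p ^ (r + k.2))⁻¹) p k.2 := by
      rw [← hk, qPoch_add]
      congr 2
      rw [show r + (k.1 + k.2) = k.1 + (r + k.2) by ring, pow_add]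
      field_simp
    have e2 : qpow η (2 - x) = qpow η (2 - y) * qpow η (y - x) := by
      rw [← qpow_add]; congr 1; ring
    rw [e1, e2, qpow_mul_nat, ← hk]
    ring
  rw [sum_congr rfl step, ← mul_sum, qVandermonde hp hB, prod_mul_pow_sub hA0]
  have e3 : qpow η (2 * y) / qpow η (2 * x) = qpow η (2 * (y - x)) := by
    rw [mul_sub, qpow_sub]
  have key := qPoch_neg_pow hp0 r n
  rw [e3, qPoch_eq_riseBin hη, qPoch_eq_riseBin hη (y - x), qPoch_eq_riseBin hη y]
  have h1 := hp r
  have h2 := hp n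
  have h3 := hp (r + n)
  have h4 := hBy (r + n)
  have h5 := qpow_ne_zero η x
  have h6 := qpow_ne_zero η y
  have h7 := qpow_ne_zero η 1
  have hsq : ((-1 : ℂ) ^ n) * (-1) ^ n = 1 := by rw [← mul_pow]; norm_num
  have h8 : qPoch ((p ^ (r + n))⁻¹) p n * qPoch p p r * p ^ (n * r + n * (n - 1) / 2) =
      (-1) ^ n * qPoch p p (r + n) / p ^ n := by
    rw [eq_div_iff (pow_ne_zero _ hp0), ← key, pow_add]
    ring
  have h9 : qpow η (2 - y) ^ n * qpow η (y - x) ^ (r + n) * qpow η (x - 1) ^ r *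
      qpow η (2 * x) ^ n * qpow η (y - x - 1) ^ n = qpow η (y - 1) ^ (r + n) * p ^ n := by
    have a1 : qpow η (y - 1) = qpow η (y - x) * qpow η (x - 1) := by
      rw [← qpow_add]; congr 1; ring
    have a2 : qpow η (y - 1) * p =
        qpow η (2 - y) * qpow η (y - x) * qpow η (2 * x) * qpow η (y - x - 1) := by
      rw [hpdef, ← qpow_add, ← qpow_add, ← qpow_add, ← qpow_add]; congr 1; ring
    rw [pow_add (qpow η (y - 1)), mul_assoc _ _ (p ^ n), ← mul_pow _ p, a2, a1]
    ring
  have h10 := pow_ne_zero (r + n) (qpow_ne_zero η (y - 1))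
  have h11 := pow_ne_zero n hp0
  rw [← hpdef]
  generalize qPoch ((p ^ (r + n))⁻¹) p n = Z at h8 ⊢
  generalize (-1 : ℂ) ^ n = ε at hsq h8 ⊢
  calc _ = (Z * qPoch p p r * p ^ (n * r + n * (n - 1) / 2)) *
        (qpow η (2 - y) ^ n * qpow η (y - x) ^ (r + n) * qpow η (x - 1) ^ r * qpow η (2 * x) ^ n *
          qpow η (y - x - 1) ^ n) * ε * (riseBin η x r * riseBin η (y - x) n) /
        (qPoch p p (r + n) * qpow η (y - 1) ^ (r + n) * riseBin η y (r + n)) := by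
        field_simp
    _ = (ε * ε) * (riseBin η x r * riseBin η (y - x) n) / riseBin η y (r + n) := by
        rw [h8, h9]
        field_simp
    _ = _ := by rw [hsq, one_mul]

/-- Closed form of `weylConj` on monomials. -/
theorem weylConj_monomial {η : ℂ} (hη : η.re ≠ 0) (x : ℂ) {y : ℂ}
    (hy : ∀ n : ℕ, qpow η (2 * (y + n)) ≠ 1) {i j : σ} (hij : i ≠ j) {t : σ →₀ ℕ} (ht : t i = 0)
    (a b : ℕ) :
    weylConj η i j x y (monomial (t + Finsupp.single i a + Finsupp.single j b) 1) =
      ∑ k ∈ antidiagonal a, (riseBin η x k.2 * riseBin η (y - x) k.1 / riseBin η y a) •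
        monomial (t + Finsupp.single i k.2 + Finsupp.single j (b + k.1)) (1 : ℂ) := by
  have hd : ∀ (f : ℕ → ℂ) (a b : ℕ),
      diagOp i f (monomial (t + Finsupp.single i a + Finsupp.single j b) 1) =
        f a • monomial (t + Finsupp.single i a + Finsupp.single j b) (1 : ℂ) := by
    intro f a b
    rw [diagOp_monomial, smul_monomial, smul_eq_mul]
    congr 3
    simp [ht, hij]
  rw [weylConj, Module.End.mul_apply, Module.End.mul_apply, expInvU, expU,
    weylSeries_monomial η hij ht]
  simp only [map_sum, map_smul, hd, weylSeries_monomial η hij ht, smul_sum, smul_smul]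
  have key := sum_antidiagonal_assoc (fun k m r =>
    ((-1) ^ k * qpow η 2 ^ (k * (k - 1) / 2) * qpow η (2 - x) ^ k /
        qPoch (qpow η 2) (qpow η 2) k * qPoch ((qpow η 2 ^ a)⁻¹) (qpow η 2) k *
      (qpow η ((y - x) * (r + m : ℕ)) * (qPoch (qpow η (2 * x)) (qpow η 2) (r + m) /
        qPoch (qpow η (2 * y)) (qpow η 2) (r + m))) *
      (qpow η (2 - y) ^ m / qPoch (qpow η 2) (qpow η 2) m *
        qPoch ((qpow η 2 ^ (r + m))⁻¹) (qpow η 2) m)) •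
    monomial (t + Finsupp.single i r + Finsupp.single j (b + (k + m))) (1 : ℂ)) a
  refine (sum_congr rfl fun k _ => sum_congr rfl fun m hm => ?_).trans
    (key.trans (sum_congr rfl fun k hk => ?_))
  · rw [HasAntidiagonal.mem_antidiagonal, add_comm] at hm
    rw [hm, add_assoc b]
  · rw [HasAntidiagonal.mem_antidiagonal, add_comm] at hk
    rw [← hk, ← weylConj_coeff hη x hy, sum_smul]
    refine sum_congr rfl fun m hm => ?_
    rw [HasAntidiagonal.mem_antidiagonal] at hm
    rw [hm]

end Operators

/-! ### Traces over the auxiliary space as sums over paths -/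

/-- The operator on `ℂ[z_0]`, identified with `ℕ →₀ ℂ`, that sends `z_0 ^ m` to
`κ b a m z_0 ^ (a + m - b)`. It describes how a site of the chain, whose exponent changes from `a`
to `b`, acts on the auxiliary space; `κ b a m` is the matrix element, and it has to vanish for
`a + m < b`, where the truncated subtraction is meaningless. -/
def hop (κ : ℕ → ℕ → ℕ → ℂ) (b a : ℕ) : Module.End ℂ (ℕ →₀ ℂ) :=
  Finsupp.linearCombination ℂ fun m => Finsupp.single (a + m - b) (κ b a m)

theorem hop_single (κ : ℕ → ℕ → ℕ → ℂ) (b a m : ℕ) :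
    hop κ b a (Finsupp.single m 1) = κ b a m • Finsupp.single (a + m - b) 1 := by
  rw [hop, Finsupp.linearCombination_single, one_smul, Finsupp.smul_single_one]

/-- The weights `κ` conserve the total degree. -/
def Balanced (κ : ℕ → ℕ → ℕ → ℂ) : Prop := ∀ b a m, a + m < b → κ b a m = 0

/-- The product over the sites of the operators `hop κ`, for a transition from the exponents `a` to
the exponents `b`. -/
def pathProd {ι : Type*} (κ : ℕ → ℕ → ℕ → ℂ) (l : List ι) (b a : ι → ℕ) :
    Module.End ℂ (ℕ →₀ ℂ) :=
  (l.map fun k => hop κ (b k) (a k)).prod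

theorem pathProd_snoc {ι : Type*} (κ : ℕ → ℕ → ℕ → ℂ) (l : List ι) (k : ι) (b a : ι → ℕ) (m : ℕ) :
    pathProd κ (l ++ [k]) b a (Finsupp.single m 1) =
      κ (b k) (a k) m • pathProd κ l b a (Finsupp.single (a k + m - b k) 1) := by
  simp only [pathProd, List.map_append, List.map_cons, List.map_nil, List.prod_append,
    List.prod_singleton, Module.End.mul_apply, hop_single, map_smul]

theorem pathProd_balanced {ι : Type*} {κ : ℕ → ℕ → ℕ → ℂ} (hκ : Balanced κ) (l : List ι)
    (b a : ι → ℕ) (m n : ℕ) (h : pathProd κ l b a (Finsupp.single m 1) n ≠ 0) :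
    n + (l.map b).sum = m + (l.map a).sum := by
  induction l using List.reverseRecOn generalizing m with
  | nil =>
    simp only [pathProd, List.map_nil, List.prod_nil, Module.End.one_apply] at h
    rw [Finsupp.single_apply] at h
    simp only [ne_eq, ite_eq_right_iff, one_ne_zero, imp_false, not_not] at h
    simp [h]
  | append_singleton l k ih =>
    rw [pathProd_snoc, Finsupp.smul_apply, smul_eq_mul] at h
    have h1 := ih _ (right_ne_zero_of_mul h)
    have h2 : ¬ a k + m < b k := fun hlt => left_ne_zero_of_mul h (hκ _ _ _ hlt)
    simp only [List.map_append, List.map_cons, List.map_nil, List.sum_append, List.sum_cons,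
      List.sum_nil]
    omega

variable {N : ℕ}

/-- The diagonal matrix element at `z_0 ^ m` of the product over all sites of the chain. -/
def pathTerm (κ : ℕ → ℕ → ℕ → ℂ) (b a : Fin N →₀ ℕ) (m : ℕ) : ℂ :=
  pathProd κ (List.finRange N) b a (Finsupp.single m 1) m

theorem sum_finRange_map (b : Fin N →₀ ℕ) : ((List.finRange N).map b).sum = b.degree := by
  rw [Finsupp.degree_eq_sum, ← List.ofFn_eq_map, List.sum_ofFn]

theorem pathTerm_eq_zero {κ : ℕ → ℕ → ℕ → ℂ} (hκ : Balanced κ) {b a : Fin N →₀ ℕ}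
    (h : b.degree ≠ a.degree) (m : ℕ) : pathTerm κ b a m = 0 := by
  by_contra h1
  have := pathProd_balanced hκ _ _ _ _ _ h1
  rw [sum_finRange_map, sum_finRange_map] at this
  omega

/-- `A` exchanges quanta between the site `k` and the auxiliary space with weights `κ`. -/
def IsHopping (κ : ℕ → ℕ → ℕ → ℂ) (k : Fin N) (A : Module.End ℂ (MvPolynomial (Fin (N + 1)) ℂ)) :
    Prop :=
  ∀ (m : ℕ) (s : Fin N →₀ ℕ), A (monomial (Finsupp.cons m s) 1) =
    ∑ b ∈ range (s k + m + 1),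
      κ b (s k) m • monomial (Finsupp.cons (s k + m - b) (s.update k b)) (1 : ℂ)

theorem coeff_prod_hopping {κ : ℕ → ℕ → ℕ → ℂ} (hκ : Balanced κ)
    {A : Fin N → Module.End ℂ (MvPolynomial (Fin (N + 1)) ℂ)} (hA : ∀ k, IsHopping κ k (A k))
    (l : List (Fin N)) (hl : l.Nodup) (m n : ℕ) (s b : Fin N →₀ ℕ) :
    coeff (Finsupp.cons n b) ((l.map A).prod (monomial (Finsupp.cons m s) 1)) =
      if ∀ k ∉ l, b k = s k then pathProd κ l b s (Finsupp.single m 1) n else 0 := by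
  induction l using List.reverseRecOn generalizing m s with
  | nil =>
    have h1 : Finsupp.cons m s = Finsupp.cons n b ↔ m = n ∧ ∀ k, b k = s k := by
      constructor
      · intro h
        exact ⟨by simpa using DFunLike.congr_fun h 0,
          fun k => by simpa using (DFunLike.congr_fun h k.succ).symm⟩
      · rintro ⟨rfl, h⟩
        rw [Finsupp.ext h]
    simp only [List.map_nil, List.prod_nil, Module.End.one_apply, coeff_monomial, pathProd,
      Finsupp.single_apply, h1]
    by_cases hm : m = n <;> simp [hm]
  | append_singleton l k ih =>
    rw [List.nodup_append_comm] at hl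
    simp only [List.singleton_append, List.nodup_cons] at hl
    obtain ⟨hk, hl⟩ := hl
    rw [List.map_append, List.prod_append, Module.End.mul_apply, List.map_singleton,
      List.prod_singleton, hA k m s, map_sum, coeff_sum, pathProd_snoc]
    simp only [map_smul, coeff_smul, ih hl, smul_eq_mul]
    have h1 : ∀ b' : ℕ, (∀ k' ∉ l, b k' = (s.update k b') k') ↔
        b' = b k ∧ ∀ k' ∉ l ++ [k], b k' = s k' := by
      intro b'
      simp only [Finsupp.coe_update, List.mem_append, List.mem_singleton, not_or]
      constructor
      · intro h
        refine ⟨by simpa using (h k hk).symm, fun k' hk' => ?_⟩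
        simpa [Function.update_of_ne hk'.2] using h k' hk'.1
      · rintro ⟨rfl, h⟩ k' hk'
        by_cases hkk : k' = k
        · subst hkk; simp
        · rw [Function.update_of_ne hkk]; exact h k' ⟨hk', hkk⟩
    have h2 : ∀ b' : ℕ, pathProd κ l b (s.update k b') = pathProd κ l b s := by
      intro b'
      unfold pathProd
      congr 1
      refine List.map_congr_left fun k' hk' => ?_
      rw [Finsupp.coe_update, Function.update_of_ne (fun h : k' = k => hk (h ▸ hk'))]
    simp only [h1, h2]
    by_cases hc : ∀ k' ∉ l ++ [k], b k' = s k'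
    · rw [if_pos hc, Finsupp.smul_apply, smul_eq_mul]
      by_cases hb : b k < s k + m + 1
      · rw [sum_eq_single (b k)]
        · rw [if_pos ⟨rfl, hc⟩]
        · intro b' _ hb'
          rw [if_neg (fun h => hb' h.1), mul_zero]
        · intro h
          exact absurd (mem_range.2 hb) h
      · rw [hκ _ _ _ (by omega), zero_mul]
        refine sum_eq_zero fun b' hb' => ?_
        rw [mem_range] at hb'
        rw [if_neg (fun h : b' = b k ∧ _ => hb (h.1 ▸ hb')), mul_zero]
    · rw [if_neg hc]
      refine sum_eq_zero fun b' _ => ?_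
      rw [if_neg (fun h => hc h.2), mul_zero]

theorem X_pow_mul_rename_monomial (m : ℕ) (a : Fin N →₀ ℕ) :
    (X 0 ^ m * rename Fin.succ (monomial a 1) : MvPolynomial (Fin (N + 1)) ℂ) =
      monomial (Finsupp.cons m a) 1 := by
  rw [rename_monomial, X_pow_eq_monomial, monomial_mul, mul_one]
  have h : Finsupp.single 0 m + a.mapDomain Fin.succ = Finsupp.cons m a := by
    ext i
    refine Fin.cases ?_ (fun i => ?_) i
    · rw [Finsupp.add_apply, Finsupp.mapDomain_of_notMem_range]
      · simp
      · rintro ⟨j, hj⟩; exact Fin.succ_ne_zero j hj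
    · rw [Finsupp.add_apply, Finsupp.mapDomain_apply (Fin.succ_injective N)]
      simp
  rw [h]

/-- A product of hopping operators has a trace over the auxiliary space as soon as the sums over
paths converge, and these sums are the matrix elements of the trace. -/
theorem auxTrace_hopping {κ : ℕ → ℕ → ℕ → ℂ} (hκ : Balanced κ)
    {A : Fin N → Module.End ℂ (MvPolynomial (Fin (N + 1)) ℂ)} (hA : ∀ k, IsHopping κ k (A k))
    (hsum : ∀ b a : Fin N →₀ ℕ, Summable (pathTerm κ b a)) :
    IsAuxTrace (List.ofFn A).prod (auxTrace (List.ofFn A).prod) ∧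
      ∀ b a : Fin N →₀ ℕ, HasSum (pathTerm κ b a)
        (coeff b (auxTrace (List.ofFn A).prod (monomial a 1))) := by
  set T : Module.End ℂ (MvPolynomial (Fin N) ℂ) := (basisMonomials (Fin N) ℂ).constr ℂ fun a =>
    ∑ b ∈ finsuppAntidiag univ a.degree, (∑' m, pathTerm κ b a m) • monomial b (1 : ℂ) with hT
  have hTa : ∀ b a : Fin N →₀ ℕ, coeff b (T (monomial a 1)) = ∑' m, pathTerm κ b a m := by
    intro b a
    have h := (basisMonomials (Fin N) ℂ).constr_basis ℂ (fun a =>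
      ∑ b ∈ finsuppAntidiag univ a.degree, (∑' m, pathTerm κ b a m) • monomial b (1 : ℂ)) a
    rw [coe_basisMonomials] at h
    rw [hT, h, coeff_sum]
    simp only [coeff_smul, coeff_monomial, smul_eq_mul, mul_ite, mul_one, mul_zero, sum_ite_eq']
    split_ifs with hb
    · rfl
    · have hne : b.degree ≠ a.degree := by
        intro hd
        exact hb (by simp [mem_finsuppAntidiag, ← hd, Finsupp.degree_eq_sum])
      simp [pathTerm_eq_zero hκ hne]
  have hTa' : ∀ b a : Fin N →₀ ℕ, HasSum (pathTerm κ b a) (coeff b (T (monomial a 1))) :=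
    fun b a => by rw [hTa]; exact (hsum b a).hasSum
  have htr : IsAuxTrace (List.ofFn A).prod T := by
    intro Ψ b
    induction Ψ using MvPolynomial.induction_on' with
    | monomial a c =>
      have h1 : (monomial a c : MvPolynomial (Fin N) ℂ) = c • monomial a 1 := by
        rw [smul_monomial, smul_eq_mul, mul_one]
      simp only [h1, map_smul, mul_smul_comm, X_pow_mul_rename_monomial, coeff_smul, smul_eq_mul,
        List.ofFn_eq_map, coeff_prod_hopping hκ hA _ (List.nodup_finRange N)]
      simpa [pathTerm] using (hTa' b a).mul_left c
    | add p q hp hq =>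
      simp only [map_add, mul_add, coeff_add]
      exact hp.add hq
  rw [htr.auxTrace_eq]
  exact ⟨htr, hTa'⟩

/-! ### The weights of the two families of operators -/

/-- Weights of `P_{k0} R⁻_{k0}`: the site `k` with exponent `a` gives `b - m` quanta to the
auxiliary space, after which the two are exchanged. -/
def kappaMinus (η x y : ℂ) (b a m : ℕ) : ℂ :=
  if m ≤ b ∧ b ≤ a + m then riseBin η x (a + m - b) * riseBin η (y - x) (b - m) / riseBin η y a
  else 0

/-- Weights of `P_{k0} R⁺_{k0}`: the auxiliary space with exponent `m` gives `m - b` quanta to the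
site `k`, after which the two are exchanged. -/
def kappaPlus (η x y : ℂ) (b _a m : ℕ) : ℂ :=
  if b ≤ m then riseBin η x b * riseBin η (y - x) (m - b) / riseBin η y m else 0

theorem balanced_kappaMinus (η x y : ℂ) : Balanced (kappaMinus η x y) := fun b a m h => by
  rw [kappaMinus, if_neg (by omega)]

theorem balanced_kappaPlus (η x y : ℂ) : Balanced (kappaPlus η x y) := fun b a m h => by
  rw [kappaPlus, if_neg (by omega)]

theorem cons_update (k : Fin N) (s : Fin N →₀ ℕ) (m b : ℕ) :
    Finsupp.cons m (s.update k b) =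
      Finsupp.cons 0 (s.erase k) + Finsupp.single k.succ b + Finsupp.single 0 m := by
  ext i
  refine Fin.cases ?_ (fun i => ?_) i
  · simp
  · rcases eq_or_ne i k with rfl | h
    · simp
    · simp [Function.update_of_ne h, Finsupp.erase_ne h, h.symm]

theorem permOp_monomial {σ : Type*} [DecidableEq σ] (i j : σ) {t : σ →₀ ℕ} (hi : t i = 0)
    (hj : t j = 0) (m n : ℕ) :
    permOp i j (monomial (t + Finsupp.single i m + Finsupp.single j n) 1) =
      monomial (t + Finsupp.single i n + Finsupp.single j m) (1 : ℂ) := by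
  have h : t.mapDomain (Equiv.swap i j) = t := by
    ext a
    rw [← Finsupp.equivMapDomain_eq_mapDomain, Finsupp.equivMapDomain_apply, Equiv.symm_swap,
      Equiv.swap_apply_def]
    split_ifs with h1 h2
    · rw [h1, hi, hj]
    · rw [h2, hi, hj]
    · rfl
  rw [permOp, AlgHom.toLinearMap_apply, rename_monomial, Finsupp.mapDomain_add,
    Finsupp.mapDomain_add, Finsupp.mapDomain_single, Finsupp.mapDomain_single, h,
    Equiv.swap_apply_left, Equiv.swap_apply_right, add_right_comm]

theorem isHopping_minus {η : ℂ} (hη : η.re ≠ 0) (x : ℂ) {y : ℂ}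
    (hy : ∀ n : ℕ, qpow η (2 * (y + n)) ≠ 1) (k : Fin N) :
    IsHopping (kappaMinus η x y) k (permOp k.succ 0 * weylConj η k.succ 0 x y) := by
  intro m s
  have hk : (k.succ : Fin (N + 1)) ≠ 0 := Fin.succ_ne_zero k
  have h1 : (Finsupp.cons 0 (s.erase k) : Fin (N + 1) →₀ ℕ) k.succ = 0 := by simp
  have h2 : (Finsupp.cons 0 (s.erase k) : Fin (N + 1) →₀ ℕ) 0 = 0 := by simp
  have h0 : s = s.update k (s k) := by simp
  rw [Module.End.mul_apply, h0, cons_update, weylConj_monomial hη x hy hk h1, map_sum, ← h0]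
  simp only [map_smul, permOp_monomial k.succ 0 h1 h2, cons_update]
  rw [Finset.Nat.sum_antidiagonal_eq_sum_range_succ_mk]
  refine sum_of_injOn (fun e => m + e) (fun _ _ _ _ h => by simpa using h)
    (fun e he => ?_) (fun b _ hb => ?_) (fun e he => ?_)
  · simp only [coe_range, Set.mem_Iio] at he ⊢
    omega
  · rw [kappaMinus, if_neg, zero_smul]
    rintro ⟨h3, h4⟩
    refine hb ⟨b - m, ?_, ?_⟩
    · simp only [coe_range, Set.mem_Iio]; omega
    · simp only; omega
  · rw [mem_range] at he
    rw [kappaMinus, if_pos (by omega), show s k + m - (m + e) = s k - e by omega,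
      Nat.add_sub_cancel_left]

theorem isHopping_plus {η : ℂ} (hη : η.re ≠ 0) (x : ℂ) {y : ℂ}
    (hy : ∀ n : ℕ, qpow η (2 * (y + n)) ≠ 1) (k : Fin N) :
    IsHopping (kappaPlus η x y) k (permOp k.succ 0 * weylConj η 0 k.succ x y) := by
  intro m s
  have hk : (0 : Fin (N + 1)) ≠ k.succ := (Fin.succ_ne_zero k).symm
  have h1 : (Finsupp.cons 0 (s.erase k) : Fin (N + 1) →₀ ℕ) k.succ = 0 := by simp
  have h2 : (Finsupp.cons 0 (s.erase k) : Fin (N + 1) →₀ ℕ) 0 = 0 := by simp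
  have h0 : s = s.update k (s k) := by simp
  rw [Module.End.mul_apply, h0, cons_update, add_right_comm, weylConj_monomial hη x hy hk h2,
    map_sum, ← h0]
  simp only [map_smul, add_right_comm _ (Finsupp.single (0 : Fin (N + 1)) _),
    permOp_monomial k.succ 0 h1 h2, cons_update]
  rw [← Finset.Nat.sum_antidiagonal_swap, Finset.Nat.sum_antidiagonal_eq_sum_range_succ_mk]
  refine sum_subset_zero_on_sdiff (fun e he => ?_) (fun b hb => ?_) (fun e he => ?_)
  · rw [mem_range] at he ⊢
    omega
  · rw [mem_sdiff, mem_range, mem_range] at hb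
    rw [kappaPlus, if_neg (by omega), zero_smul]
  · rw [mem_range] at he
    simp only [Prod.swap]
    rw [kappaPlus, if_pos (by omega), show s k + m - e = s k + (m - e) by omega]

/-! ### Baxter's triangularisation over the auxiliary space -/

/-- Multiplication by `z_0` on the auxiliary space. -/
def auxZ : Module.End ℂ (ℕ →₀ ℂ) := Finsupp.lmapDomain ℂ ℂ Nat.succ

theorem auxZ_single (m : ℕ) : auxZ (Finsupp.single m 1) = Finsupp.single (m + 1) 1 := by
  simp [auxZ]

theorem auxZ_apply_zero (v : ℕ →₀ ℂ) : auxZ v 0 = 0 := by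
  rw [auxZ, Finsupp.lmapDomain_apply, Finsupp.mapDomain_of_notMem_range]
  rintro ⟨n, hn⟩
  exact Nat.succ_ne_zero n hn

theorem auxZ_apply_succ (v : ℕ →₀ ℂ) (n : ℕ) : auxZ v (n + 1) = v n := by
  rw [auxZ, Finsupp.lmapDomain_apply, ← Nat.succ_eq_add_one,
    Finsupp.mapDomain_apply Nat.succ_injective]

/-- Conjugation of `P` by the unipotent matrix with rows `(1, 0)` and `(z, 1)` is upper triangular
with diagonal entries `α` and `β`; this is expressed by the two invariant subspaces. -/
structure Triangularizes {R : Type*} [Ring R] (z : R) (P : Matrix (Fin 2) (Fin 2) R) (α β : R) :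
    Prop where
  col_zero : P 0 0 + P 0 1 * z = α
  col_one : P 1 0 + P 1 1 * z = z * α
  row_one : P 1 1 - z * P 0 1 = β
  row_zero : P 1 0 - z * P 0 0 = -(β * z)

theorem Triangularizes.one {R : Type*} [Ring R] (z : R) : Triangularizes z 1 1 1 := by
  constructor <;> simp

theorem Triangularizes.mul {R : Type*} [Ring R] {z : R} {P P' : Matrix (Fin 2) (Fin 2) R}
    {α β α' β' : R} (h : Triangularizes z P α β) (h' : Triangularizes z P' α' β') :
    Triangularizes z (P * P') (α * α') (β * β') := by
  have e1 : P' 0 0 = α' - P' 0 1 * z := eq_sub_of_add_eq h'.col_zero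
  have e2 : P' 1 0 = z * α' - P' 1 1 * z := eq_sub_of_add_eq h'.col_one
  have e3 : P 1 1 = β + z * P 0 1 := eq_add_of_sub_eq h.row_one
  have e4 : P 1 0 = -(β * z) + z * P 0 0 := eq_add_of_sub_eq h.row_zero
  have e5 := h'.row_one
  have e6 : P' 1 0 = -(β' * z) + z * P' 0 0 := eq_add_of_sub_eq h'.row_zero
  constructor <;> simp only [Matrix.mul_apply, Fin.sum_univ_two]
  · rw [← h.col_zero, e1, e2]; noncomm_ring
  · rw [← mul_assoc, ← h.col_one, e1, e2]; noncomm_ring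
  · rw [← e5, e3, e4]; noncomm_ring
  · rw [e6, e3, e4, ← e5]
    have : P' 1 1 = β' + z * P' 0 1 := eq_add_of_sub_eq h'.row_one
    rw [this]
    noncomm_ring

theorem Triangularizes.list_prod {R ι : Type*} [Ring R] {z : R}
    {P : ι → Matrix (Fin 2) (Fin 2) R} {α β : ι → R} (l : List ι)
    (h : ∀ k ∈ l, Triangularizes z (P k) (α k) (β k)) :
    Triangularizes z (l.map P).prod (l.map α).prod (l.map β).prod := by
  induction l with
  | nil => exact Triangularizes.one z
  | cons k l ih =>
    simp only [List.map_cons, List.prod_cons]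
    exact (h k (by simp)).mul (ih fun k' hk' => h k' (by simp [hk']))

/-- The trace of a triangularised matrix of operators on the auxiliary space is the sum of the
traces of its diagonal entries. Cyclicity of the trace is needed only for the commutator of `z_0`
with the upper right corner, whose diagonal matrix elements telescope. -/
theorem Triangularizes.trace {P : Matrix (Fin 2) (Fin 2) (Module.End ℂ (ℕ →₀ ℂ))}
    {α β : Module.End ℂ (ℕ →₀ ℂ)} (h : Triangularizes auxZ P α β) {S a b : ℂ}
    (hP0 : Summable fun m => P 0 0 (Finsupp.single m 1) m)
    (hP : HasSum (fun m => P 0 0 (Finsupp.single m 1) m + P 1 1 (Finsupp.single m 1) m) S)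
    (hα : HasSum (fun m => α (Finsupp.single m 1) m) a)
    (hβ : HasSum (fun m => β (Finsupp.single m 1) m) b) : S = a + b := by
  set e : ℕ → ℂ := fun m => P 0 1 (Finsupp.single (m + 1) 1) m with he
  have h1 : ∀ m, e m = α (Finsupp.single m 1) m - P 0 0 (Finsupp.single m 1) m := by
    intro m
    rw [← h.col_zero, LinearMap.add_apply, Finsupp.add_apply, Module.End.mul_apply, auxZ_single,
      add_sub_cancel_left]
  have h0 : Filter.Tendsto e Filter.atTop (nhds 0) := by
    have := hα.summable.tendsto_atTop_zero.sub hP0.tendsto_atTop_zero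
    rw [sub_zero] at this
    exact this.congr fun m => (h1 m).symm
  have h2 : ∀ m, β (Finsupp.single m 1) m =
      P 1 1 (Finsupp.single m 1) m - auxZ (P 0 1 (Finsupp.single m 1)) m := by
    intro m
    rw [← h.row_one, LinearMap.sub_apply, Finsupp.sub_apply, Module.End.mul_apply]
  have hsum : HasSum (fun m => auxZ (P 0 1 (Finsupp.single m 1)) m - e m) (S - (a + b)) := by
    refine (hP.sub (hα.add hβ)).congr_fun fun m => ?_
    rw [h1, h2]
    ring
  have hpart : ∀ M, ∑ m ∈ range (M + 1), (auxZ (P 0 1 (Finsupp.single m 1)) m - e m) = -e M := by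
    intro M
    induction M with
    | zero => simp [auxZ_apply_zero]
    | succ M ih =>
      rw [sum_range_succ, ih, auxZ_apply_succ]
      simp only [he]
      ring
  have hlim := (hsum.tendsto_sum_nat.comp (Filter.tendsto_add_atTop_nat 1))
  have hlim' : Filter.Tendsto (fun M => -e M) Filter.atTop (nhds (S - (a + b))) :=
    hlim.congr fun M => hpart M
  have := tendsto_nhds_unique hlim' h0.neg
  rw [neg_zero] at this
  exact sub_eq_zero.1 this

/-! ### The Lax operators acting on matrix elements -/

/-- The matrix elements of the Lax operator on `z_k ^ n`. -/
def laxCoeff (η u ℓ : ℂ) (n : ℕ) : Matrix (Fin 2) (Fin 2) ℂ :=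
  !![qnum η (u + (n + ℓ)), -qnum η n; qnum η (n + 2 * ℓ), qnum η (u - (n + ℓ))]

/-- The exponents to which the entries of the Lax operator send the exponent `n`. -/
def laxShift (n : ℕ) : Matrix (Fin 2) (Fin 2) ℕ := !![n, n - 1; n + 1, n]

/-- The coefficients of the transposed action of the Lax operator, `n` being the exponent of the
monomial whose coefficient is extracted. -/
def laxCoeff' (η u ℓ : ℂ) (n : ℕ) : Matrix (Fin 2) (Fin 2) ℂ :=
  !![qnum η (u + (n + ℓ)), -qnum η (n + 1);
    if n = 0 then 0 else qnum η ((n - 1 : ℕ) + 2 * ℓ), qnum η (u - (n + ℓ))]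

/-- The exponents from which the entries of the Lax operator reach the exponent `n`. -/
def laxShift' (n : ℕ) : Matrix (Fin 2) (Fin 2) ℕ := !![n, n + 1; n - 1, n]

section

variable {σ : Type*}

theorem update_add_single (s : σ →₀ ℕ) (k : σ) :
    s + Finsupp.single k 1 = s.update k (s k + 1) := by
  classical
  ext i
  rcases eq_or_ne i k with rfl | h
  · simp
  · simp [h]

theorem update_sub_single (s : σ →₀ ℕ) (k : σ) :
    s - Finsupp.single k 1 = s.update k (s k - 1) := by
  classical
  ext i
  rcases eq_or_ne i k with rfl | h
  · simp
  · simp [h]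

theorem lax_monomial (η u ℓ : ℂ) (k : σ) (i j : Fin 2) (s : σ →₀ ℕ) :
    lax η k u ℓ i j (monomial s 1) =
      laxCoeff η u ℓ (s k) i j • monomial (s.update k (laxShift (s k) i j)) (1 : ℂ) := by
  fin_cases i <;> fin_cases j <;>
  simp only [lax, laxCoeff, laxShift, Fin.zero_eta, Fin.mk_one, Matrix.of_apply, Matrix.cons_val',
    Matrix.cons_val_zero, Matrix.cons_val_one, Matrix.cons_val_fin_one, diagOp_monomial,
    LinearMap.neg_apply, Module.End.mul_apply, divVar_monomial, mulVar_monomial, smul_monomial,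
    smul_eq_mul, mul_one, Finsupp.update_self, update_add_single, update_sub_single]
  split_ifs with h
  · simp [h, qnum_zero]
  · rw [map_neg]

theorem coeff_lax (η u ℓ : ℂ) (k : σ) (i j : Fin 2) (b : σ →₀ ℕ) (p : MvPolynomial σ ℂ) :
    coeff b (lax η k u ℓ i j p) =
      laxCoeff' η u ℓ (b k) i j * coeff (b.update k (laxShift' (b k) i j)) p := by
  classical
  induction p using MvPolynomial.induction_on' with
  | add p q hp hq => rw [map_add, coeff_add, hp, hq, coeff_add, mul_add]
  | monomial s c =>
    have h1 : (monomial s c : MvPolynomial σ ℂ) = c • monomial s 1 := by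
      rw [smul_monomial, smul_eq_mul, mul_one]
    rw [h1, map_smul, lax_monomial, coeff_smul, coeff_smul, coeff_smul, coeff_monomial,
      coeff_monomial]
    simp only [smul_eq_mul, mul_ite, mul_one, mul_zero]
    have h2 : ∀ n, s.update k n = b ↔ (∀ i, i ≠ k → s i = b i) ∧ n = b k := by
      intro n
      constructor
      · rintro rfl
        exact ⟨fun i hi => by simp [hi], by simp⟩
      · rintro ⟨h, rfl⟩
        ext i
        rcases eq_or_ne i k with rfl | hi <;> simp [*]
    have h3 : ∀ n, s = b.update k n ↔ (∀ i, i ≠ k → s i = b i) ∧ s k = n := by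
      intro n
      constructor
      · rintro rfl
        exact ⟨fun i hi => by simp [hi], by simp⟩
      · rintro ⟨h, rfl⟩
        ext i
        rcases eq_or_ne i k with rfl | hi <;> simp [*]
    simp only [h2, h3]
    by_cases hoff : ∀ i, i ≠ k → s i = b i
    swap
    · simp [hoff]
    simp only [eq_true hoff, true_and]
    generalize s k = m
    generalize b k = n
    fin_cases i <;> fin_cases j <;>
    simp only [laxCoeff, laxShift, laxCoeff', laxShift', Fin.zero_eta, Fin.mk_one, Matrix.of_apply,
      Matrix.cons_val', Matrix.cons_val_zero, Matrix.cons_val_one, Matrix.cons_val_fin_one]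
    · split_ifs with h
      · rw [h, mul_comm]
      · rfl
    · rcases m with _ | m
      · simp [qnum_zero]
      · simp only [Nat.add_sub_cancel, Nat.add_right_cancel_iff]
        split_ifs with h
        · rw [h, mul_comm, Nat.cast_succ]
        · rfl
    · rcases n with _ | n
      · simp
      · simp only [Nat.add_sub_cancel, Nat.add_right_cancel_iff, Nat.succ_ne_zero, if_false]
        split_ifs with h
        · rw [h, mul_comm]
        · rfl
    · split_ifs with h
      · rw [h, mul_comm]
      · rfl

/-- A linear functional that factorises over the sites `l` of the chain still does so after a
product of Lax operators, with the local factors multiplied by Lax matrices from the right. -/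
theorem functional_comp_lax_prod [DecidableEq σ] {S : Type*} [Ring S] [Algebra ℂ S] (η u ℓ : ℂ)
    (f : MvPolynomial σ ℂ →ₗ[ℂ] ℂ) (A : σ → ℕ → S) (l : List σ) (hl : l.Nodup)
    (μ : (σ →₀ ℕ) → S →ₗ[ℂ] ℂ) (hμ : ∀ a, ∀ k ∈ l, ∀ n, μ (a.update k n) = μ a)
    (hf : ∀ a, f (monomial a 1) = μ a (l.map fun k => A k (a k)).prod) (i j : Fin 2)
    (a : σ →₀ ℕ) :
    f ((l.map fun k => lax η k u ℓ).prod i j (monomial a 1)) =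
      μ a ((l.map fun k => Matrix.of fun i j : Fin 2 =>
        laxCoeff η u ℓ (a k) i j • A k (laxShift (a k) i j)).prod i j) := by
  induction l using List.reverseRecOn generalizing μ i j a with
  | nil =>
    have h := hf a
    simp only [List.map_nil, List.prod_nil] at h ⊢
    rcases eq_or_ne i j with rfl | hij
    · simp [h]
    · simp [Matrix.one_apply_ne hij]
  | append_singleton l k ih =>
    rw [List.nodup_append_comm] at hl
    simp only [List.singleton_append, List.nodup_cons] at hl
    obtain ⟨hk, hl⟩ := hl
    have hne : ∀ k' ∈ l, k' ≠ k := fun k' hk' h => hk (h ▸ hk')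
    have ih' := ih hl (fun a => μ a ∘ₗ LinearMap.mulRight ℂ (A k (a k)))
      (fun a k' hk' n => by
        simp only [hμ a k' (by simp [hk']), Finsupp.coe_update,
          Function.update_of_ne (hne k' hk').symm])
      (fun a => by simp [hf a])
    simp only [List.map_append, List.prod_append, List.map_singleton, List.prod_singleton,
      Matrix.mul_apply, LinearMap.sum_apply, Module.End.mul_apply, map_sum, lax_monomial, map_smul,
      ih', LinearMap.comp_apply, LinearMap.mulRight_apply]
    refine sum_congr rfl fun c _ => ?_
    have h1 : ∀ n, (l.map fun k' => Matrix.of fun i j : Fin 2 =>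
        laxCoeff η u ℓ ((a.update k n) k') i j • A k' (laxShift ((a.update k n) k') i j)) =
        l.map fun k' => Matrix.of fun i j : Fin 2 =>
          laxCoeff η u ℓ (a k') i j • A k' (laxShift (a k') i j) := by
      intro n
      refine List.map_congr_left fun k' hk' => ?_
      rw [Finsupp.coe_update, Function.update_of_ne (hne k' hk')]
    rw [h1, hμ a k (by simp), Matrix.of_apply, mul_smul_comm, map_smul]
    simp

/-- The transposed statement: if the coefficients of a polynomial factorise over the sites `l`,
they still do so after a product of Lax operators, with the local factors multiplied by Lax matrices
from the left. -/
theorem coeff_lax_prod [DecidableEq σ] {S : Type*} [Ring S] [Algebra ℂ S] (η u ℓ : ℂ)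
    (p : MvPolynomial σ ℂ) (A : σ → ℕ → S) (l : List σ) (hl : l.Nodup)
    (μ : (σ →₀ ℕ) → S →ₗ[ℂ] ℂ) (hμ : ∀ b, ∀ k ∈ l, ∀ n, μ (b.update k n) = μ b)
    (hp : ∀ b, coeff b p = μ b (l.map fun k => A k (b k)).prod) (i j : Fin 2)
    (b : σ →₀ ℕ) :
    coeff b ((l.map fun k => lax η k u ℓ).prod i j p) =
      μ b ((l.map fun k => Matrix.of fun i j : Fin 2 =>
        laxCoeff' η u ℓ (b k) i j • A k (laxShift' (b k) i j)).prod i j) := by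
  induction l generalizing μ i j b with
  | nil =>
    have h := hp b
    simp only [List.map_nil, List.prod_nil] at h ⊢
    rcases eq_or_ne i j with rfl | hij
    · simp [h]
    · simp [Matrix.one_apply_ne hij]
  | cons k l ih =>
    simp only [List.nodup_cons] at hl
    obtain ⟨hk, hl⟩ := hl
    have hne : ∀ k' ∈ l, k' ≠ k := fun k' hk' h => hk (h ▸ hk')
    have ih' := ih hl (fun b => μ b ∘ₗ LinearMap.mulLeft ℂ (A k (b k)))
      (fun b k' hk' n => by
        simp only [hμ b k' (by simp [hk']), Finsupp.coe_update,
          Function.update_of_ne (hne k' hk').symm])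
      (fun b => by simp [hp b])
    simp only [List.map_cons, List.prod_cons, Matrix.mul_apply, LinearMap.sum_apply,
      Module.End.mul_apply, map_sum, coeff_sum, coeff_lax, ih', LinearMap.comp_apply,
      LinearMap.mulLeft_apply]
    refine sum_congr rfl fun c _ => ?_
    have h1 : ∀ n, (l.map fun k' => Matrix.of fun i j : Fin 2 =>
        laxCoeff' η u ℓ ((b.update k n) k') i j • A k' (laxShift' ((b.update k n) k') i j)) =
        l.map fun k' => Matrix.of fun i j : Fin 2 =>
          laxCoeff' η u ℓ (b k') i j • A k' (laxShift' (b k') i j) := by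
      intro n
      refine List.map_congr_left fun k' hk' => ?_
      rw [Finsupp.coe_update, Function.update_of_ne (hne k' hk')]
    rw [h1, hμ b k (by simp), Matrix.of_apply, smul_mul_assoc, map_smul]
    simp

end

/-! ### Local exchange relations -/

theorem qnum_mul_riseBin_add_one' {η : ℂ} (hη : η.re ≠ 0) (x : ℂ) (n : ℕ) :
    qnum η x * riseBin η (x + 1) n = riseBin η x (n + 1) * qnum η (n + 1) := by
  rw [qnum_mul_riseBin_add_one, riseBin_succ_mul hη]

theorem riseBin_sub_one_succ {η : ℂ} (hη : η.re ≠ 0) (x : ℂ) (n : ℕ) :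
    riseBin η (x - 1) (n + 1) = riseBin η x n * (qnum η (x - 1) / qnum η (n + 1)) := by
  have h1 := qnum_mul_riseBin_add_one' hη (x - 1) n
  have h2 := qnum_natCast_succ_ne_zero hη n
  rw [sub_add_cancel] at h1
  field_simp
  rw [← h1, mul_comm]

theorem riseBin_succ_of_ne {η : ℂ} (hη : η.re ≠ 0) {y : ℂ}
    (hy : ∀ n : ℕ, qpow η (2 * (y + n)) ≠ 1) (n : ℕ) :
    (riseBin η y n)⁻¹ = (riseBin η y (n + 1))⁻¹ * (qnum η (y + n) / qnum η (n + 1)) := by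
  have h1 := riseBin_ne_zero hη hy
  have h2 := h1 n
  have h3 := h1 (n + 1)
  have h4 := qnum_natCast_succ_ne_zero hη n
  have h5 := riseBin_succ_mul hη y n
  field_simp
  linear_combination h5

/-- The coefficient of `z_j ^ s` in `weylConj` applied to `z_i ^ (r + s)`. -/
def hypCoeff (η x y : ℂ) (r s : ℕ) : ℂ :=
  riseBin η x r * riseBin η (y - x) s / riseBin η y (r + s)

theorem hypCoeff_symm (η x y : ℂ) (r s : ℕ) : hypCoeff η (y - x) y r s = hypCoeff η x y s r := by
  rw [hypCoeff, hypCoeff, sub_sub_cancel, add_comm r s, mul_comm]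

theorem hypCoeff_shift_zero (η x y : ℂ) (r : ℕ) :
    qnum η (x + r) * hypCoeff η x y r 0 = qnum η x * hypCoeff η (x + 1) y r 0 := by
  simp only [hypCoeff, riseBin_zero_right]
  linear_combination (-(riseBin η y (r + 0))⁻¹) * qnum_mul_riseBin_add_one η x r

/-- Contiguous relations for `hypCoeff`: this and the similar lemmas below express every term through
the same products, and what remains is an instance of `qnum_mul_sub`. The variants at the boundary
`r = 0` or `s = 0`, where one of the terms is absent, are stated separately. -/
theorem hypCoeff_shift {η : ℂ} (hη : η.re ≠ 0) {x y : ℂ}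
    (hy : ∀ n : ℕ, qpow η (2 * (y + n)) ≠ 1) (r s : ℕ) :
    qnum η (x + (r + s + 1 : ℕ)) * hypCoeff η x y r (s + 1) -
      qnum η (r + s + 1 : ℕ) * hypCoeff η x y r s =
    qnum η x * hypCoeff η (x + 1) y r (s + 1) := by
  have e1 := qnum_mul_riseBin_add_one η x r
  have e2 := riseBin_succ η (y - x) s
  have e3 := riseBin_sub_one_succ hη (y - x) s
  have e4 := riseBin_succ_of_ne hη hy (r + s)
  have id := qnum_mul_sub η (x + (r + s + 1 : ℕ)) (y - x + s) (1 + x - y)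
  have h1 := mul_inv_cancel₀ (qnum_natCast_succ_ne_zero hη s)
  have h2 := mul_inv_cancel₀ (qnum_natCast_succ_ne_zero hη (r + s))
  rw [show x + (r + s + 1 : ℕ) - (1 + x - y) = y + (r + s : ℕ) by push_cast; ring,
    show y - x + s + (1 + x - y) = s + 1 by ring, show (1 + x - y : ℂ) = -(y - x - 1) by ring,
    show y - x + s - (x + (r + s + 1 : ℕ)) + -(y - x - 1) = -(x + r) by push_cast; ring,
    qnum_neg, qnum_neg] at id
  simp only [hypCoeff, div_eq_mul_inv, ← add_assoc, ← sub_sub] at e2 e3 e4 ⊢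
  rw [e2, e3, e4, Nat.cast_succ (r + s)]
  rw [Nat.cast_succ (r + s)] at id
  linear_combination (riseBin η x r * riseBin η (y - x) s * (riseBin η y (r + s + 1))⁻¹) *
      ((qnum η (s + 1))⁻¹ * id - qnum η (y + (r + s : ℕ)) * h2 + qnum η (y + (r + s : ℕ)) * h1) -
    (riseBin η (y - x) s * (riseBin η y (r + s + 1))⁻¹ * qnum η (y - x - 1) *
      (qnum η (s + 1))⁻¹) * e1

theorem hypCoeff_raise_zero {η : ℂ} (hη : η.re ≠ 0) {x y : ℂ}
    (hy : ∀ n : ℕ, qpow η (2 * (y + n)) ≠ 1) (r : ℕ) :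
    qnum η (y + r) * hypCoeff η x y (r + 1) 0 = qnum η x * hypCoeff η (x + 1) y r 0 := by
  have e1 := qnum_mul_riseBin_add_one' hη x r
  have e4 := riseBin_succ_of_ne hη hy r
  have h2 := qnum_natCast_succ_ne_zero hη r
  simp only [hypCoeff, riseBin_zero_right, div_eq_mul_inv, mul_one, add_zero]
  rw [e4, ← mul_assoc (qnum η x), e1]
  field_simp

theorem hypCoeff_raise_left {η : ℂ} (hη : η.re ≠ 0) {x y : ℂ}
    (hy : ∀ n : ℕ, qpow η (2 * (y + n)) ≠ 1) (s : ℕ) :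
    qnum η (y + s) * hypCoeff η x y 0 (s + 1) = qnum η (y - x + s) * hypCoeff η x y 0 s := by
  have e2 := riseBin_succ η (y - x) s
  have e4 := riseBin_succ_of_ne hη hy s
  have h2 := qnum_natCast_succ_ne_zero hη s
  simp only [hypCoeff, riseBin_zero_right, div_eq_mul_inv, one_mul, zero_add]
  rw [e4, e2]
  field_simp

theorem hypCoeff_raise {η : ℂ} (hη : η.re ≠ 0) {x y : ℂ}
    (hy : ∀ n : ℕ, qpow η (2 * (y + n)) ≠ 1) (r s : ℕ) :
    qnum η (y + (r + s + 1 : ℕ)) * hypCoeff η x y (r + 1) (s + 1) -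
      qnum η (y - x + (r + s + 1 : ℕ)) * hypCoeff η x y (r + 1) s =
    qnum η x * hypCoeff η (x + 1) y r (s + 1) := by
  have e1 := qnum_mul_riseBin_add_one' hη x r
  have e2 := riseBin_succ η (y - x) s
  have e3 := riseBin_sub_one_succ hη (y - x) s
  have e4 := riseBin_succ_of_ne hη hy (r + s + 1)
  have id := qnum_mul_sub η (y - x + s) (r + s + 1 + 1) (y - x - 1)
  have h1 := mul_inv_cancel₀ (qnum_natCast_succ_ne_zero hη s)
  have h2 := mul_inv_cancel₀ (qnum_natCast_succ_ne_zero hη (r + s + 1))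
  rw [show y - x + (s : ℂ) - (y - x - 1) = s + 1 by ring,
    show (r : ℂ) + s + 1 + 1 + (y - x - 1) = y - x + (r + s + 1 : ℕ) by push_cast; ring,
    show (r : ℂ) + s + 1 + 1 - (y - x + s) + (y - x - 1) = r + 1 by ring,
    show (r : ℂ) + s + 1 + 1 = (r + s + 1 : ℕ) + 1 by push_cast; ring] at id
  simp only [hypCoeff, div_eq_mul_inv, ← sub_sub, show r + 1 + (s + 1) = r + s + 1 + 1 by ring,
    show r + 1 + s = r + s + 1 by ring, show r + (s + 1) = r + s + 1 by ring] at e2 e3 e4 ⊢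
  rw [e2, e3, e4]
  set I := (riseBin η y (r + s + 1 + 1))⁻¹
  set a := (qnum η (s + 1))⁻¹
  set b := (qnum η ((r + s + 1 : ℕ) + 1))⁻¹
  set Y := qnum η (y + (r + s + 1 : ℕ))
  linear_combination (riseBin η x (r + 1) * riseBin η (y - x) s * I * Y) *
      (a * b * id - qnum η (y - x + s) * a * h2 + qnum η (y - x + (r + s + 1 : ℕ)) * b * h1) -
    (riseBin η (y - x) s * I * Y * b * qnum η (y - x - 1) * a) * e1

theorem qnum_mul_sub' (η x y c : ℂ) :
    qnum η x * qnum η y - qnum η (x - c) * qnum η (y - c) = qnum η c * qnum η (x + y - c) := by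
  have h := qnum_mul_sub η x (-y) c
  rw [show -y + c = -(y - c) by ring, show -y - x + c = -(x + y - c) by ring, qnum_neg, qnum_neg,
    qnum_neg] at h
  linear_combination -h

theorem riseBin_add_one_inv {η : ℂ} (hη : η.re ≠ 0) {y : ℂ}
    (hy : ∀ n : ℕ, qpow η (2 * (y + n)) ≠ 1) (n : ℕ) :
    (riseBin η (y + 1) n)⁻¹ = qnum η y * (riseBin η y (n + 1))⁻¹ * (qnum η (n + 1))⁻¹ := by
  have h1 := riseBin_ne_zero hη hy (n + 1)
  have h2 := qnum_natCast_succ_ne_zero hη n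
  have h3 := qnum_mul_riseBin_add_one' hη y n
  have h4 : qnum η y * riseBin η (y + 1) n ≠ 0 := by rw [h3]; exact mul_ne_zero h1 h2
  have h5 := left_ne_zero_of_mul h4
  have h6 := right_ne_zero_of_mul h4
  field_simp
  linear_combination -h3

theorem riseBin_sub_one_inv {η : ℂ} (hη : η.re ≠ 0) {y : ℂ}
    (hy : ∀ n : ℕ, qpow η (2 * (y - 1 + n)) ≠ 1) (n : ℕ) :
    qnum η (1 - y) * (riseBin η (y - 1) n)⁻¹ = -(qnum η (y - 1 + n) * (riseBin η y n)⁻¹) := by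
  have h1 := riseBin_ne_zero hη hy n
  have h2 : ∀ n : ℕ, qpow η (2 * (y + n)) ≠ 1 := fun n => by
    have := hy (n + 1)
    rwa [show y - 1 + ((n + 1 : ℕ) : ℂ) = y + n by push_cast; ring] at this
  have h3 := riseBin_ne_zero hη h2 n
  have h4 := qnum_mul_riseBin_add_one η (y - 1) n
  rw [sub_add_cancel] at h4
  rw [show (1 - y : ℂ) = -(y - 1) by ring, qnum_neg]
  field_simp
  linear_combination -h4

theorem hypCoeff_y_succ {η : ℂ} (hη : η.re ≠ 0) {x y : ℂ}
    (hy : ∀ n : ℕ, qpow η (2 * (y + n)) ≠ 1) (b j : ℕ) :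
    qnum η (b + 1 - (y - x)) * hypCoeff η x y b j - qnum η (b + 1) * hypCoeff η x y (b + 1) j =
      qnum η (1 - y) * qnum η (y - x) / qnum η y * hypCoeff η x (y + 1) b j := by
  have e1 := qnum_mul_riseBin_add_one η (y - x) j
  have e2 := riseBin_succ_mul hη x b
  have e3 := riseBin_add_one_inv hη hy (b + j)
  have e4 := riseBin_succ_of_ne hη hy (b + j)
  have id := qnum_mul_sub η (b + 1 - (y - x)) (y + (b + j : ℕ)) (1 - y)
  have hy0 : qnum η y * (qnum η y)⁻¹ = 1 := mul_inv_cancel₀ fun h =>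
    hy 0 (by simpa using (qnum_eq_zero_iff hη).1 h)
  have h2 := mul_inv_cancel₀ (qnum_natCast_succ_ne_zero hη (b + j))
  rw [show (b : ℂ) + 1 - (y - x) - (1 - y) = x + b by ring,
    show y + (b + j : ℕ) + (1 - y) = (b + j : ℕ) + 1 by ring,
    show y + (b + j : ℕ) - (b + 1 - (y - x)) + (1 - y) = y - x + j by push_cast; ring] at id
  simp only [hypCoeff, div_eq_mul_inv, show b + 1 + j = b + j + 1 by ring,
    show y + 1 - x = y - x + 1 by ring] at e4 ⊢
  rw [e3, e4]
  set I := (riseBin η y (b + j + 1))⁻¹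
  set a := (qnum η ((b + j : ℕ) + 1))⁻¹
  linear_combination (riseBin η x b * riseBin η (y - x) j * I) * (a * id + qnum η (x + b) * h2) -
    riseBin η (y - x) j * I * e2 - (qnum η (1 - y) * riseBin η x b * a * I) * e1 -
    (qnum η (1 - y) * qnum η (y - x) * riseBin η (y - x + 1) j * riseBin η x b * I * a) * hy0

theorem hypCoeff_y_succ_left {η : ℂ} (hη : η.re ≠ 0) {x y : ℂ}
    (hy : ∀ n : ℕ, qpow η (2 * (y + n)) ≠ 1) (m : ℕ) :
    -(qnum η (y - 1) * hypCoeff η x y 0 (m + 1)) =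
      qnum η (1 - y) * qnum η (y - x) / qnum η y * hypCoeff η x (y + 1) 0 m := by
  have e1 := qnum_mul_riseBin_add_one' hη (y - x) m
  have e3 := riseBin_add_one_inv hη hy m
  have hy0 : qnum η y * (qnum η y)⁻¹ = 1 := mul_inv_cancel₀ fun h =>
    hy 0 (by simpa using (qnum_eq_zero_iff hη).1 h)
  have h2 := mul_inv_cancel₀ (qnum_natCast_succ_ne_zero hη m)
  simp only [hypCoeff, div_eq_mul_inv, zero_add, riseBin_zero_right, one_mul,
    show y + 1 - x = y - x + 1 by ring]
  rw [e3, show (1 - y : ℂ) = -(y - 1) by ring, qnum_neg]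
  set I := (riseBin η y (m + 1))⁻¹
  set a := (qnum η (m + 1))⁻¹
  linear_combination (qnum η (y - 1) * I * a) * e1 + qnum η (y - 1) * I *
    riseBin η (y - x) (m + 1) * h2 +
    qnum η (y - 1) * qnum η (y - x) * riseBin η (y - x + 1) m * I * a * hy0

theorem hypCoeff_lower_zero {η : ℂ} (hη : η.re ≠ 0) {x y : ℂ}
    (hy : ∀ n : ℕ, qpow η (2 * (y + n)) ≠ 1) (b : ℕ) :
    qnum η (x + b) * hypCoeff η x y b 0 = qnum η (y + b) * hypCoeff η x y (b + 1) 0 := by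
  have e2 := riseBin_succ_mul hη x b
  have e4 := riseBin_succ_of_ne hη hy b
  have h2 := mul_inv_cancel₀ (qnum_natCast_succ_ne_zero hη b)
  simp only [hypCoeff, div_eq_mul_inv, riseBin_zero_right, add_zero, mul_one] at e4 ⊢
  rw [e4]
  set I := (riseBin η y (b + 1))⁻¹
  set a := (qnum η (b + 1))⁻¹
  linear_combination -(I * qnum η (y + b) * a) * e2 + riseBin η x (b + 1) * I * qnum η (y + b) * h2

theorem hypCoeff_y_succ_raise {η : ℂ} (hη : η.re ≠ 0) {x y : ℂ}
    (hy : ∀ n : ℕ, qpow η (2 * (y + n)) ≠ 1) (b j : ℕ) :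
    qnum η (x + b) * hypCoeff η x y b (j + 1) - qnum η (y + b) * hypCoeff η x y (b + 1) (j + 1) =
      qnum η (1 - y) * qnum η (y - x) / qnum η y * hypCoeff η x (y + 1) (b + 1) j := by
  have e1 := qnum_mul_riseBin_add_one' hη (y - x) j
  have e2 := riseBin_succ η x b
  have e3 := riseBin_add_one_inv hη hy (b + j + 1)
  have e4 := riseBin_succ_of_ne hη hy (b + j + 1)
  have id := qnum_mul_sub η (b + 1) (y + (b + j + 1 : ℕ)) (1 - y)
  have hy0 : qnum η y * (qnum η y)⁻¹ = 1 := mul_inv_cancel₀ fun h =>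
    hy 0 (by simpa using (qnum_eq_zero_iff hη).1 h)
  have h1 := mul_inv_cancel₀ (qnum_natCast_succ_ne_zero hη b)
  have h2 := mul_inv_cancel₀ (qnum_natCast_succ_ne_zero hη (b + j + 1))
  rw [show (b : ℂ) + 1 - (1 - y) = y + b by ring,
    show y + (b + j + 1 : ℕ) + (1 - y) = (b + j + 1 : ℕ) + 1 by ring,
    show y + (b + j + 1 : ℕ) - (b + 1) + (1 - y) = j + 1 by push_cast; ring] at id
  simp only [hypCoeff, div_eq_mul_inv, show b + 1 + (j + 1) = b + j + 1 + 1 by ring,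
    show b + 1 + j = b + j + 1 by ring, show b + (j + 1) = b + j + 1 by ring,
    show y + 1 - x = y - x + 1 by ring] at e2 e4 ⊢
  rw [e2, e3, e4]
  set I := (riseBin η y (b + j + 1 + 1))⁻¹
  set a := (qnum η ((b + j + 1 : ℕ) + 1))⁻¹
  set c := (qnum η (b + 1))⁻¹
  set Bx := riseBin η x b
  set Bw := riseBin η (y - x) (j + 1)
  linear_combination (Bx * Bw * I * qnum η (x + b)) *
      (a * c * id - qnum η (y + (b + j + 1 : ℕ)) * a * h1 + qnum η (y + b) * c * h2) -
    (qnum η (1 - y) * Bx * qnum η (x + b) * c * I * a) * e1 -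
    (qnum η (1 - y) * qnum η (y - x) * riseBin η (y - x + 1) j * Bx * qnum η (x + b) * c * I * a) *
      hy0

theorem hypCoeff_y_pred_zero {η : ℂ} (hη : η.re ≠ 0) {x y : ℂ}
    (hy : ∀ n : ℕ, qpow η (2 * (y - 1 + n)) ≠ 1) (b : ℕ) :
    -(qnum η (y - 1 + b) * hypCoeff η x y b 0) =
      qnum η (1 - y) * hypCoeff η x (y - 1) b 0 := by
  have e3 := riseBin_sub_one_inv hη hy b
  simp only [hypCoeff, div_eq_mul_inv, riseBin_zero_right, add_zero, mul_one]
  linear_combination -(riseBin η x b) * e3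

theorem hypCoeff_y_pred {η : ℂ} (hη : η.re ≠ 0) {x y : ℂ}
    (hy : ∀ n : ℕ, qpow η (2 * (y - 1 + n)) ≠ 1) (b j : ℕ) :
    qnum η (b + 1) * hypCoeff η x y (b + 1) j - qnum η (y - 1 + b) * hypCoeff η x y b (j + 1) =
      qnum η (1 - y) * hypCoeff η x (y - 1) b (j + 1) := by
  have e2 := riseBin_succ_mul hη x b
  have e3 := riseBin_sub_one_inv hη hy (b + j + 1)
  have e4 := riseBin_sub_one_succ hη (y - x) j
  have e5 := riseBin_succ η (y - x) j
  have id := qnum_mul_sub' η (y - 1 + b) (y - x + j) (y - x - 1)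
  have h1 := mul_inv_cancel₀ (qnum_natCast_succ_ne_zero hη j)
  rw [show y - 1 + (b : ℂ) - (y - x - 1) = x + b by ring,
    show y - x + (j : ℂ) - (y - x - 1) = j + 1 by ring,
    show y - 1 + (b : ℂ) + (y - x + j) - (y - x - 1) = y - 1 + (b + j + 1 : ℕ) by
      push_cast; ring] at id
  simp only [hypCoeff, div_eq_mul_inv, show b + 1 + j = b + j + 1 by ring,
    show b + (j + 1) = b + j + 1 by ring, show y - 1 - x = y - x - 1 by ring] at e4 e5 ⊢
  rw [e4, e5]
  set I := (riseBin η y (b + j + 1))⁻¹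
  set c := (qnum η (j + 1))⁻¹
  set Bx := riseBin η x b
  set Bw := riseBin η (y - x) j
  linear_combination (Bw * I) * e2 - (Bx * Bw * I * c) * id - (Bx * Bw * I * qnum η (x + b)) * h1 -
    (Bx * Bw * qnum η (y - x - 1) * c) * e3

theorem hypCoeff_y_pred_left {η : ℂ} (hη : η.re ≠ 0) {x y : ℂ}
    (hy : ∀ n : ℕ, qpow η (2 * (y - 1 + n)) ≠ 1) (m : ℕ) :
    qnum η (1 - (y - x)) * hypCoeff η x y 0 m =
      qnum η (1 - y) * hypCoeff η x (y - 1) 0 (m + 1) := by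
  have h2 : ∀ n : ℕ, qpow η (2 * (y + n)) ≠ 1 := fun n => by
    have := hy (n + 1)
    rwa [show y - 1 + ((n + 1 : ℕ) : ℂ) = y + n by push_cast; ring] at this
  have e3 := riseBin_sub_one_inv hη hy (m + 1)
  have e4 := riseBin_sub_one_succ hη (y - x) m
  have e5 := riseBin_succ_of_ne hη h2 m
  rw [show y - 1 + (m + 1 : ℕ) = y + m by push_cast; ring] at e3
  simp only [hypCoeff, div_eq_mul_inv, zero_add, riseBin_zero_right, one_mul,
    show y - 1 - x = y - x - 1 by ring, show (1 - (y - x) : ℂ) = -(y - x - 1) by ring,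
    qnum_neg] at e4 e5 ⊢
  rw [e4, e5]
  linear_combination -(riseBin η (y - x) m * (qnum η (y - x - 1) * (qnum η (m + 1))⁻¹)) * e3

theorem hypCoeff_y_pred_raise_zero {η : ℂ} (hη : η.re ≠ 0) {x y : ℂ}
    (hy : ∀ n : ℕ, qpow η (2 * (y - 1 + n)) ≠ 1) (b : ℕ) :
    qnum η (x + b) * hypCoeff η x y b 0 = -(qnum η (1 - y) * hypCoeff η x (y - 1) (b + 1) 0) := by
  have h2 : ∀ n : ℕ, qpow η (2 * (y + n)) ≠ 1 := fun n => by
    have := hy (n + 1)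
    rwa [show y - 1 + ((n + 1 : ℕ) : ℂ) = y + n by push_cast; ring] at this
  rw [hypCoeff_lower_zero hη h2, ← hypCoeff_y_pred_zero hη hy, neg_neg,
    show y - 1 + (b + 1 : ℕ) = y + b by push_cast; ring]

theorem hypCoeff_y_pred_raise {η : ℂ} (hη : η.re ≠ 0) {x y : ℂ}
    (hy : ∀ n : ℕ, qpow η (2 * (y - 1 + n)) ≠ 1) (b j : ℕ) :
    qnum η (x + b) * hypCoeff η x y b (j + 1) -
        qnum η (b + 2 - (y - x)) * hypCoeff η x y (b + 1) j =
      -(qnum η (1 - y) * hypCoeff η x (y - 1) (b + 1) (j + 1)) := by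
  have hh2 : ∀ n : ℕ, qpow η (2 * (y + n)) ≠ 1 := fun n => by
    have := hy (n + 1)
    rwa [show y - 1 + ((n + 1 : ℕ) : ℂ) = y + n by push_cast; ring] at this
  have e2 := riseBin_succ η x b
  have e3 := riseBin_sub_one_inv hη hy (b + j + 1 + 1)
  have e4 := riseBin_sub_one_succ hη (y - x) j
  have e5 := riseBin_succ η (y - x) j
  have e6 := riseBin_succ_of_ne hη hh2 (b + j + 1)
  have id := qnum_mul_sub' η (y - x + j) (b + 1) (y - x - 1)
  have h1 := mul_inv_cancel₀ (qnum_natCast_succ_ne_zero hη b)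
  have h2 := mul_inv_cancel₀ (qnum_natCast_succ_ne_zero hη j)
  have h3 := mul_inv_cancel₀ (qnum_natCast_succ_ne_zero hη (b + j + 1))
  rw [show y - 1 + (b + j + 1 + 1 : ℕ) = y + (b + j + 1 : ℕ) by push_cast; ring] at e3
  rw [show y - x + (j : ℂ) - (y - x - 1) = j + 1 by ring,
    show (b : ℂ) + 1 - (y - x - 1) = b + 2 - (y - x) by ring,
    show y - x + (j : ℂ) + (b + 1) - (y - x - 1) = (b + j + 1 : ℕ) + 1 by
      push_cast; ring] at id
  simp only [hypCoeff, div_eq_mul_inv, show b + 1 + (j + 1) = b + j + 1 + 1 by ring,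
    show b + 1 + j = b + j + 1 by ring, show b + (j + 1) = b + j + 1 by ring,
    show y - 1 - x = y - x - 1 by ring] at e2 e4 e5 e6 ⊢
  rw [e2, e4, e5, e6]
  set I := (riseBin η y (b + j + 1 + 1))⁻¹
  set a := (qnum η ((b + j + 1 : ℕ) + 1))⁻¹
  set c := (qnum η (b + 1))⁻¹
  set d := (qnum η (j + 1))⁻¹
  set Bx := riseBin η x b
  set Bw := riseBin η (y - x) j
  set Y := qnum η (y + (b + j + 1 : ℕ))
  linear_combination (Bx * Bw * I * qnum η (x + b) * Y) *
      (a * c * d * id - qnum η (y - x + j) * d * a * h1 + qnum η (b + 2 - (y - x)) * c * a * h2 +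
        qnum η (y - x - 1) * c * d * h3) +
    (Bx * qnum η (x + b) * c * Bw * qnum η (y - x - 1) * d) * e3

/-! ### The local exchange relations as triangularisations -/

theorem hop_single_of {κ : ℕ → ℕ → ℕ → ℂ} (hκ : Balanced κ) (b a m n : ℕ)
    (h : b ≤ a + m → a + m = b + n) :
    hop κ b a (Finsupp.single m 1) = κ b a m • Finsupp.single n 1 := by
  rw [hop_single]
  rcases le_or_gt b (a + m) with hle | hlt
  · rw [h hle, Nat.add_sub_cancel_left]
  · rw [hκ _ _ _ hlt, zero_smul, zero_smul]

theorem end_ext_single {f g : Module.End ℂ (ℕ →₀ ℂ)}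
    (h : ∀ m, f (Finsupp.single m 1) = g (Finsupp.single m 1)) : f = g :=
  Finsupp.lhom_ext' fun m => LinearMap.ext_ring (h m)

theorem kappaMinus_of (η x y : ℂ) {b a m r s : ℕ} (hb : b = m + s) (ha : a = r + s) :
    kappaMinus η x y b a m = hypCoeff η x y r s := by
  rw [kappaMinus, if_pos (by omega), show a + m - b = r by omega, show b - m = s by omega, ha,
    hypCoeff]

theorem kappaPlus_of (η x y : ℂ) {b m j : ℕ} (a : ℕ) (hm : m = b + j) :
    kappaPlus η x y b a m = hypCoeff η x y b j := by
  rw [kappaPlus, if_pos (by omega), show m - b = j by omega, hm, hypCoeff]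

theorem kappaMinus_eq_zero (η x y : ℂ) {b a m : ℕ} (h : b < m ∨ a + m < b) :
    kappaMinus η x y b a m = 0 := by
  rw [kappaMinus, if_neg (by omega)]

theorem kappaPlus_eq_zero (η x y : ℂ) {b m : ℕ} (a : ℕ) (h : m < b) :
    kappaPlus η x y b a m = 0 := by
  rw [kappaPlus, if_neg (by omega)]

/-- The four relations `kappaMinus_shift`, `kappaMinus_raise`, `kappaMinus_shift'` and
`kappaMinus_raise'` are the entries of the triangularisation `triangularizes_minus`, in terms of
`x = u + ℓ` and `y = 2 ℓ`. -/
theorem kappaMinus_shift {η : ℂ} (hη : η.re ≠ 0) (x : ℂ) {y : ℂ}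
    (hy : ∀ n : ℕ, qpow η (2 * (y + n)) ≠ 1) (b a m : ℕ) :
    qnum η (x + a) * kappaMinus η x y b a m - qnum η a * kappaMinus η x y b (a - 1) (m + 1) =
      qnum η x * kappaMinus η (x + 1) y b a m := by
  rcases lt_or_ge b m with h | h
  · rw [kappaMinus_eq_zero η x y (Or.inl h), kappaMinus_eq_zero η (x + 1) y (Or.inl h),
      kappaMinus_eq_zero η x y (Or.inl (by omega))]
    ring
  obtain ⟨s, rfl⟩ := Nat.exists_eq_add_of_le h
  rcases lt_or_ge a s with h | h
  · rw [kappaMinus_eq_zero η x y (Or.inr (by omega)),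
      kappaMinus_eq_zero η (x + 1) y (Or.inr (by omega))]
    rcases a with _ | a
    · simp [qnum_zero]
    · rw [kappaMinus_eq_zero η x y (Or.inr (by omega))]
      ring
  obtain ⟨r, rfl⟩ := Nat.exists_eq_add_of_le' h
  rw [kappaMinus_of η x y (b := m + s) (a := r + s) rfl rfl,
    kappaMinus_of η (x + 1) y (b := m + s) (a := r + s) rfl rfl]
  rcases s with _ | s
  · rw [kappaMinus_eq_zero η x y (Or.inl (by omega)), mul_zero, sub_zero]
    exact hypCoeff_shift_zero η x y r
  · rw [kappaMinus_of η x y (s := s) (r := r) (by omega) (by omega)]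
    exact hypCoeff_shift hη hy r s

theorem kappaMinus_raise {η : ℂ} (hη : η.re ≠ 0) (x : ℂ) {y : ℂ}
    (hy : ∀ n : ℕ, qpow η (2 * (y + n)) ≠ 1) (b a m : ℕ) :
    qnum η (y + a) * kappaMinus η x y b (a + 1) m -
        qnum η (y - x + a) * kappaMinus η x y b a (m + 1) =
      qnum η x * kappaMinus η (x + 1) y b a m := by
  rcases lt_or_ge b m with h | h
  · rw [kappaMinus_eq_zero η x y (Or.inl h), kappaMinus_eq_zero η (x + 1) y (Or.inl h),
      kappaMinus_eq_zero η x y (Or.inl (by omega))]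
    ring
  obtain ⟨s, rfl⟩ := Nat.exists_eq_add_of_le h
  rcases lt_trichotomy s (a + 1) with h | rfl | h
  · obtain ⟨r, rfl⟩ := Nat.exists_eq_add_of_le' (Nat.le_of_lt_succ h)
    rw [kappaMinus_of η x y (b := m + s) (a := r + s + 1) (r := r + 1) rfl (by omega),
      kappaMinus_of η (x + 1) y (b := m + s) (a := r + s) rfl rfl]
    rcases s with _ | s
    · rw [kappaMinus_eq_zero η x y (Or.inl (by omega)), mul_zero, sub_zero]
      exact hypCoeff_raise_zero hη hy r
    · rw [kappaMinus_of η x y (s := s) (r := r + 1) (by omega) (by omega)]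
      exact hypCoeff_raise hη hy r s
  · rw [kappaMinus_of η x y (b := m + (a + 1)) (a := a + 1) (r := 0) rfl (by omega),
      kappaMinus_of η x y (s := a) (r := 0) (by omega) (by omega),
      kappaMinus_eq_zero η (x + 1) y (Or.inr (by omega)), hypCoeff_raise_left hη hy]
    ring
  · rw [kappaMinus_eq_zero η x y (Or.inr (by omega)), kappaMinus_eq_zero η x y (Or.inr (by omega)),
      kappaMinus_eq_zero η (x + 1) y (Or.inr (by omega))]
    ring

theorem kappaMinus_shift' {η : ℂ} (hη : η.re ≠ 0) (x : ℂ) {y : ℂ}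
    (hy : ∀ n : ℕ, qpow η (2 * (y + n)) ≠ 1) (b a m : ℕ) :
    qnum η a * kappaMinus η x y b (a - 1) m - qnum η (y - x + a) * kappaMinus η x y b a m =
      -(qnum η (y - x) * kappaMinus η (x - 1) y b a m) := by
  rcases lt_or_ge b m with h | h
  · rw [kappaMinus_eq_zero η x y (Or.inl h), kappaMinus_eq_zero η (x - 1) y (Or.inl h),
      kappaMinus_eq_zero η x y (Or.inl h)]
    ring
  obtain ⟨s, rfl⟩ := Nat.exists_eq_add_of_le h
  have e : y - x + 1 = y - (x - 1) := by ring
  rcases lt_or_ge a s with h | h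
  · rw [kappaMinus_eq_zero η x y (Or.inr (by omega)), kappaMinus_eq_zero η x y (Or.inr (by omega)),
      kappaMinus_eq_zero η (x - 1) y (Or.inr (by omega))]
    ring
  obtain ⟨r, rfl⟩ := Nat.exists_eq_add_of_le' h
  rw [kappaMinus_of η x y (b := m + s) (a := r + s) rfl rfl,
    kappaMinus_of η (x - 1) y (b := m + s) (a := r + s) rfl rfl, ← hypCoeff_symm η x,
    ← hypCoeff_symm η (x - 1), ← e]
  rcases r with _ | r
  · have h1 := hypCoeff_shift_zero η (y - x) y s
    rw [zero_add]
    rcases s with _ | s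
    · rw [Nat.cast_zero, qnum_zero, ← h1]
      simp
    · rw [kappaMinus_eq_zero η x y (Or.inr (by omega)), ← h1]
      ring
  · rw [kappaMinus_of η x y (s := s) (r := r) (by omega) (by omega), ← hypCoeff_symm η x]
    have h1 := hypCoeff_shift hη (x := y - x) hy s r
    rw [show r + 1 + s = s + r + 1 by ring, ← h1]
    ring

theorem kappaMinus_raise' {η : ℂ} (hη : η.re ≠ 0) (x : ℂ) {y : ℂ}
    (hy : ∀ n : ℕ, qpow η (2 * (y + n)) ≠ 1) (b a m : ℕ) :
    qnum η (y + a) * kappaMinus η x y b (a + 1) m - qnum η (x + a) * kappaMinus η x y b a m =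
      qnum η (y - x) * kappaMinus η (x - 1) y b a (m + 1) := by
  rcases lt_or_ge b m with h | h
  · rw [kappaMinus_eq_zero η x y (Or.inl h), kappaMinus_eq_zero η (x - 1) y (Or.inl (by omega)),
      kappaMinus_eq_zero η x y (Or.inl h)]
    ring
  obtain ⟨s, rfl⟩ := Nat.exists_eq_add_of_le h
  have e : y - x + 1 = y - (x - 1) := by ring
  have e' : y - (y - x) = x := by ring
  rcases lt_trichotomy s (a + 1) with h | rfl | h
  · obtain ⟨r, rfl⟩ := Nat.exists_eq_add_of_le' (Nat.le_of_lt_succ h)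
    rw [kappaMinus_of η x y (b := m + s) (a := r + s + 1) (r := r + 1) rfl (by omega),
      kappaMinus_of η x y (b := m + s) (a := r + s) rfl rfl, ← hypCoeff_symm η x,
      ← hypCoeff_symm η x]
    rcases s with _ | s
    · rw [kappaMinus_eq_zero η (x - 1) y (Or.inl (by omega)), mul_zero]
      have h1 := hypCoeff_raise_left hη (x := y - x) hy r
      rw [e'] at h1
      rw [add_zero, h1, sub_self]
    · rw [kappaMinus_of η (x - 1) y (s := s) (r := r + 1) (by omega) (by omega),
        ← hypCoeff_symm η (x - 1), ← e]
      have h1 := hypCoeff_raise hη (x := y - x) hy s r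
      rw [e'] at h1
      rw [← h1, show r + (s + 1) = s + r + 1 by ring]
  · rw [kappaMinus_of η x y (b := m + (a + 1)) (a := a + 1) (r := 0) rfl (by omega),
      kappaMinus_of η (x - 1) y (s := a) (r := 0) (by omega) (by omega),
      kappaMinus_eq_zero η x y (Or.inr (by omega)), ← hypCoeff_symm η x,
      ← hypCoeff_symm η (x - 1), ← e, hypCoeff_raise_zero hη hy]
    ring
  · rw [kappaMinus_eq_zero η x y (Or.inr (by omega)), kappaMinus_eq_zero η x y (Or.inr (by omega)),
      kappaMinus_eq_zero η (x - 1) y (Or.inr (by omega))]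
    ring

/-- The Lax matrix combined with the action of a site on the auxiliary space, the Lax operator
acting first. -/
def laxRight (η u ℓ : ℂ) (κ : ℕ → ℕ → ℕ → ℂ) (b a : ℕ) :
    Matrix (Fin 2) (Fin 2) (Module.End ℂ (ℕ →₀ ℂ)) :=
  Matrix.of fun i j => laxCoeff η u ℓ a i j • hop κ b (laxShift a i j)

/-- The Lax matrix combined with the action of a site on the auxiliary space, the Lax operator
acting last. -/
def laxLeft (η u ℓ : ℂ) (κ : ℕ → ℕ → ℕ → ℂ) (b a : ℕ) :
    Matrix (Fin 2) (Fin 2) (Module.End ℂ (ℕ →₀ ℂ)) :=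
  Matrix.of fun i j => laxCoeff' η u ℓ b i j • hop κ (laxShift' b i j) a

/-- The local form of the Baxter equation for `Q₋`: the diagonal entries are the weights at `u + 1`
and at `u - 1`. -/
theorem triangularizes_minus {η : ℂ} (hη : η.re ≠ 0) (u : ℂ) {ℓ : ℂ}
    (hℓ : ∀ n : ℕ, qpow η (2 * (2 * ℓ + n)) ≠ 1) (b a : ℕ) :
    Triangularizes auxZ (laxRight η u ℓ (kappaMinus η (u + ℓ) (2 * ℓ)) b a)
      (qnum η (u + ℓ) • hop (kappaMinus η (u + 1 + ℓ) (2 * ℓ)) b a)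
      (qnum η (u - ℓ) • hop (kappaMinus η (u - 1 + ℓ) (2 * ℓ)) b a) := by
  have hb := fun x => balanced_kappaMinus η x (2 * ℓ)
  have c1 : u + ((a : ℂ) + ℓ) = u + ℓ + a := by ring
  have c2 : (a : ℂ) + 2 * ℓ = 2 * ℓ + a := by ring
  have c3 : u - ((a : ℂ) + ℓ) = -(2 * ℓ - (u + ℓ) + a) := by ring
  have c4 : u - ℓ = -(2 * ℓ - (u + ℓ)) := by ring
  have c5 : u - 1 + ℓ = u + ℓ - 1 := by ring
  have c6 : u + 1 + ℓ = u + ℓ + 1 := by ring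
  constructor <;> refine end_ext_single fun m => ?_ <;>
  simp only [laxRight, laxCoeff, laxShift, Matrix.of_apply, Matrix.cons_val', Matrix.cons_val_zero,
    Matrix.cons_val_one, Matrix.cons_val_fin_one, LinearMap.add_apply, LinearMap.sub_apply,
    LinearMap.neg_apply, LinearMap.smul_apply, Module.End.mul_apply, auxZ_single, map_smul,
    c1, c2, c3, c4, c5, c6, qnum_neg]
  · have key := kappaMinus_shift hη (u + ℓ) hℓ b a m
    rw [hop_single_of (hb (u + ℓ)) b a m (a + m - b) (by omega),
      hop_single_of (hb (u + ℓ + 1)) b a m (a + m - b) (by omega), smul_smul, smul_smul, ← key]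
    rcases a with _ | a
    · simp [qnum_zero]
    · rw [hop_single_of (hb (u + ℓ)) b (a + 1 - 1) (m + 1) (a + 1 + m - b) (by omega)]
      module
  · have key := kappaMinus_raise hη (u + ℓ) hℓ b a m
    rw [hop_single_of (hb (u + ℓ)) b (a + 1) m (a + m + 1 - b) (by omega),
      hop_single_of (hb (u + ℓ)) b a (m + 1) (a + m + 1 - b) (by omega)]
    rcases le_or_gt b (a + m) with h | h
    · rw [hop_single_of (hb (u + ℓ + 1)) b a m (a + m - b) (by omega), map_smul, auxZ_single,
        show a + m - b + 1 = a + m + 1 - b by omega, smul_smul _ _ (Finsupp.single _ _), smul_smul,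
        smul_smul, ← key]
      module
    · rw [hb (u + ℓ + 1) _ _ _ h, mul_zero] at key
      rw [hop_single, hb (u + ℓ + 1) _ _ _ h, zero_smul, map_zero, smul_zero, smul_smul, smul_smul,
        neg_mul, neg_smul, ← sub_eq_add_neg, ← sub_smul, key, zero_smul]
  · have key := kappaMinus_shift' hη (u + ℓ) hℓ b a m
    rw [hop_single_of (hb (u + ℓ)) b a m (a + m - b) (by omega),
      hop_single_of (hb (u + ℓ - 1)) b a m (a + m - b) (by omega), smul_smul _ _ (Finsupp.single _ _),
      smul_smul (-_) _ (Finsupp.single _ _), neg_mul (qnum η _) (kappaMinus η (u + ℓ - 1) _ _ _ _),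
      ← key]
    rcases a with _ | a
    · simp [qnum_zero]
    · rcases le_or_gt b (a + m) with h | h
      · rw [hop_single_of (hb (u + ℓ)) b (a + 1 - 1) m (a + m - b) (by omega), map_smul, auxZ_single,
          show a + m - b + 1 = a + 1 + m - b by omega]
        simp only [Nat.add_sub_cancel]
        module
      · rw [hop_single, Nat.add_sub_cancel, hb (u + ℓ) b a m h, zero_smul, map_zero]
        module
  · have key := kappaMinus_raise' hη (u + ℓ) hℓ b a m
    rw [hop_single_of (hb (u + ℓ)) b (a + 1) m (a + m + 1 - b) (by omega),
      hop_single_of (hb (u + ℓ - 1)) b a (m + 1) (a + m + 1 - b) (by omega)]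
    rcases le_or_gt b (a + m) with h | h
    · rw [hop_single_of (hb (u + ℓ)) b a m (a + m - b) (by omega), map_smul, auxZ_single,
        show a + m - b + 1 = a + m + 1 - b by omega, smul_smul (-_) _ (Finsupp.single _ _), neg_mul,
        ← key]
      module
    · rw [hb (u + ℓ) b a m h, mul_zero, sub_zero] at key
      rw [hop_single, hb (u + ℓ) b a m h, zero_smul, map_zero, smul_zero, smul_smul, smul_smul,
        neg_mul, neg_smul, neg_neg, sub_zero, key]

/-- This relation, `kappaPlus_raise`, `kappaPlus_shift'`, `kappaPlus_raise'` and their variants at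
`b = 0` are the entries of the triangularisation `triangularizes_plus`, in terms of `x = 2 ℓ` and
`y = 1 + ℓ - u`. -/
theorem kappaPlus_shift {η : ℂ} (hη : η.re ≠ 0) {x y : ℂ}
    (hy : ∀ n : ℕ, qpow η (2 * (y + n)) ≠ 1) (b a m : ℕ) :
    qnum η (b + 1 - (y - x)) * kappaPlus η x y b a m -
        qnum η (b + 1) * kappaPlus η x y (b + 1) a (m + 1) =
      qnum η (1 - y) * qnum η (y - x) / qnum η y * kappaPlus η x (y + 1) b a m := by
  rcases lt_or_ge m b with h | h
  · rw [kappaPlus_eq_zero η x y a h, kappaPlus_eq_zero η x (y + 1) a h,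
      kappaPlus_eq_zero η x y a (by omega)]
    ring
  obtain ⟨j, rfl⟩ := Nat.exists_eq_add_of_le h
  rw [kappaPlus_of η x y a (m := b + j) rfl, kappaPlus_of η x (y + 1) a (m := b + j) rfl,
    kappaPlus_of η x y (j := j) a (by omega)]
  exact hypCoeff_y_succ hη hy b j

theorem kappaPlus_raise_zero {η : ℂ} (hη : η.re ≠ 0) {x y : ℂ}
    (hy : ∀ n : ℕ, qpow η (2 * (y + n)) ≠ 1) (a m : ℕ) :
    -(qnum η (y - 1) * kappaPlus η x y 0 a (m + 1)) =
      qnum η (1 - y) * qnum η (y - x) / qnum η y * kappaPlus η x (y + 1) 0 a m := by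
  rw [kappaPlus_of η x y (j := m + 1) a (by omega), kappaPlus_of η x (y + 1) (j := m) a (by omega)]
  exact hypCoeff_y_succ_left hη hy m

theorem kappaPlus_raise {η : ℂ} (hη : η.re ≠ 0) {x y : ℂ}
    (hy : ∀ n : ℕ, qpow η (2 * (y + n)) ≠ 1) (b a m : ℕ) :
    qnum η (x + b) * kappaPlus η x y b a m -
        qnum η (y + b) * kappaPlus η x y (b + 1) a (m + 1) =
      qnum η (1 - y) * qnum η (y - x) / qnum η y * kappaPlus η x (y + 1) (b + 1) a m := by
  rcases lt_or_ge m b with h | h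
  · rw [kappaPlus_eq_zero η x y a h, kappaPlus_eq_zero η x (y + 1) a (by omega),
      kappaPlus_eq_zero η x y a (by omega)]
    ring
  obtain ⟨j, rfl⟩ := Nat.exists_eq_add_of_le h
  rw [kappaPlus_of η x y a (m := b + j) rfl, kappaPlus_of η x y (j := j) a (by omega)]
  rcases j with _ | j
  · rw [kappaPlus_eq_zero η x (y + 1) a (by omega), hypCoeff_lower_zero hη hy]
    ring
  · rw [kappaPlus_of η x (y + 1) (j := j) a (by omega)]
    exact hypCoeff_y_succ_raise hη hy b j

theorem kappaPlus_shift' {η : ℂ} (hη : η.re ≠ 0) {x y : ℂ}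
    (hy : ∀ n : ℕ, qpow η (2 * (y - 1 + n)) ≠ 1) (b a m : ℕ) :
    qnum η (b + 1) * kappaPlus η x y (b + 1) a m -
        qnum η (y - 1 + b) * kappaPlus η x y b a m =
      qnum η (1 - y) * kappaPlus η x (y - 1) b a m := by
  rcases lt_or_ge m b with h | h
  · rw [kappaPlus_eq_zero η x y a h, kappaPlus_eq_zero η x (y - 1) a h,
      kappaPlus_eq_zero η x y a (by omega)]
    ring
  obtain ⟨j, rfl⟩ := Nat.exists_eq_add_of_le h
  rw [kappaPlus_of η x y a (m := b + j) rfl, kappaPlus_of η x (y - 1) a (m := b + j) rfl]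
  rcases j with _ | j
  · rw [kappaPlus_eq_zero η x y a (by omega), ← hypCoeff_y_pred_zero hη hy]
    ring
  · rw [kappaPlus_of η x y (j := j) a (by omega)]
    exact hypCoeff_y_pred hη hy b j

theorem kappaPlus_raise_zero' {η : ℂ} (hη : η.re ≠ 0) {x y : ℂ}
    (hy : ∀ n : ℕ, qpow η (2 * (y - 1 + n)) ≠ 1) (a m : ℕ) :
    qnum η (1 - (y - x)) * kappaPlus η x y 0 a m =
      qnum η (1 - y) * kappaPlus η x (y - 1) 0 a (m + 1) := by
  rw [kappaPlus_of η x y (j := m) a (by omega),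
    kappaPlus_of η x (y - 1) (j := m + 1) a (by omega)]
  exact hypCoeff_y_pred_left hη hy m

theorem kappaPlus_raise' {η : ℂ} (hη : η.re ≠ 0) {x y : ℂ}
    (hy : ∀ n : ℕ, qpow η (2 * (y - 1 + n)) ≠ 1) (b a m : ℕ) :
    qnum η (x + b) * kappaPlus η x y b a m -
        qnum η (b + 2 - (y - x)) * kappaPlus η x y (b + 1) a m =
      -(qnum η (1 - y) * kappaPlus η x (y - 1) (b + 1) a (m + 1)) := by
  rcases lt_or_ge m b with h | h
  · rw [kappaPlus_eq_zero η x y a h, kappaPlus_eq_zero η x (y - 1) a (by omega),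
      kappaPlus_eq_zero η x y a (by omega)]
    ring
  obtain ⟨j, rfl⟩ := Nat.exists_eq_add_of_le h
  rw [kappaPlus_of η x y a (m := b + j) rfl, kappaPlus_of η x (y - 1) (j := j) a (by omega)]
  rcases j with _ | j
  · rw [kappaPlus_eq_zero η x y a (by omega), ← hypCoeff_y_pred_raise_zero hη hy]
    ring
  · rw [kappaPlus_of η x y (j := j) a (by omega)]
    exact hypCoeff_y_pred_raise hη hy b j

/-- The local form of the Baxter equation for `Q₊`: the diagonal entries are the weights at `u - 1`
and at `u + 1`. -/
theorem triangularizes_plus {η : ℂ} (hη : η.re ≠ 0) (ℓ : ℂ) {u : ℂ}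
    (hu : ∀ n : ℕ, qpow η (2 * (ℓ - u + n)) ≠ 1) (b a : ℕ) :
    Triangularizes auxZ (laxLeft η u ℓ (kappaPlus η (2 * ℓ) (1 + ℓ - u)) b a)
      ((qnum η (u - 1 + ℓ) * qnum η (u - ℓ) / qnum η (u - 1 - ℓ)) •
        hop (kappaPlus η (2 * ℓ) (1 + ℓ - (u - 1))) b a)
      (qnum η (u - ℓ) • hop (kappaPlus η (2 * ℓ) (1 + ℓ - (u + 1))) b a) := by
  set x := 2 * ℓ with hx
  set y := 1 + ℓ - u with hy
  have hb := fun y => balanced_kappaPlus η x y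
  have hy1 : ∀ n : ℕ, qpow η (2 * (y - 1 + n)) ≠ 1 := fun n => by
    rw [show y - 1 + (n : ℂ) = ℓ - u + n by rw [hy]; ring]
    exact hu n
  have hy2 : ∀ n : ℕ, qpow η (2 * (y + n)) ≠ 1 := fun n => by
    have := hy1 (n + 1)
    rwa [show y - 1 + ((n + 1 : ℕ) : ℂ) = y + n by push_cast; ring] at this
  have c1 : ∀ b : ℂ, u + (b + ℓ) = b + 1 - (y - x) := fun b => by rw [hx, hy]; ring
  have c2 : ∀ b : ℂ, b + 2 * ℓ = x + b := fun b => by rw [hx]; ring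
  have c3 : ∀ b : ℂ, u - (b + ℓ) = -(y - 1 + b) := fun b => by rw [hy]; ring
  have c4 : u - ℓ = 1 - y := by rw [hy]; ring
  have c5 : u - 1 + ℓ = -(y - x) := by rw [hx, hy]; ring
  have c6 : u - 1 - ℓ = -y := by rw [hy]; ring
  have c7 : 1 + ℓ - (u - 1) = y + 1 := by rw [hy]; ring
  have c8 : 1 + ℓ - (u + 1) = y - 1 := by rw [hy]; ring
  have c9 : qnum η (-(y - x)) * qnum η (1 - y) / qnum η (-y) =
      qnum η (1 - y) * qnum η (y - x) / qnum η y := by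
    rw [qnum_neg, qnum_neg, neg_mul, neg_div_neg_eq, mul_comm]
  rw [c4, c5, c6, c7, c8, c9]
  constructor <;> refine end_ext_single fun m => ?_ <;>
  simp only [laxLeft, laxCoeff', laxShift', Matrix.of_apply, Matrix.cons_val', Matrix.cons_val_zero,
    Matrix.cons_val_one, Matrix.cons_val_fin_one, LinearMap.add_apply, LinearMap.sub_apply,
    LinearMap.neg_apply, LinearMap.smul_apply, Module.End.mul_apply, auxZ_single, map_smul,
    c1, c2, c3]
  · have key := kappaPlus_shift hη (x := x) hy2 b a m
    rw [hop_single_of (hb y) b a m (a + m - b) (by omega),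
      hop_single_of (hb y) (b + 1) a (m + 1) (a + m - b) (by omega),
      hop_single_of (hb (y + 1)) b a m (a + m - b) (by omega), smul_smul _ _ (Finsupp.single _ _),
      smul_smul _ _ (Finsupp.single _ _), smul_smul _ _ (Finsupp.single _ _), ← key]
    module
  · rcases b with _ | b
    · have key := kappaPlus_raise_zero hη (x := x) hy2 a m
      rw [if_pos rfl, hop_single_of (hb y) 0 a (m + 1) (a + m + 1) (by omega),
        hop_single_of (hb (y + 1)) 0 a m (a + m) (by omega), map_smul, auxZ_single,
        smul_smul _ _ (Finsupp.single _ _), smul_smul _ _ (Finsupp.single _ _), ← key, Nat.cast_zero,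
        add_zero, qnum_neg]
      module
    · have key := kappaPlus_raise hη (x := x) hy2 b a m
      rw [if_neg (Nat.succ_ne_zero b), Nat.add_sub_cancel,
        hop_single_of (hb y) b a m (a + m - b) (by omega),
        hop_single_of (hb y) (b + 1) a (m + 1) (a + m - b) (by omega),
        show y - 1 + ((b + 1 : ℕ) : ℂ) = y + b by push_cast; ring, qnum_neg]
      rcases le_or_gt (b + 1) (a + m) with h | h
      · rw [hop_single_of (hb (y + 1)) (b + 1) a m (a + m - (b + 1)) (by omega), map_smul,
          auxZ_single, show a + m - (b + 1) + 1 = a + m - b by omega, smul_smul (_ / _),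
          ← key]
        module
      · rw [hb (y + 1) _ _ _ h, mul_zero] at key
        rw [hop_single, hb (y + 1) _ _ _ h, zero_smul, map_zero, smul_zero, smul_smul, smul_smul,
          ← add_smul, neg_mul, ← sub_eq_add_neg, key, zero_smul]
  · have key := kappaPlus_shift' hη (x := x) hy1 b a m
    rw [hop_single_of (hb y) b a m (a + m - b) (by omega),
      hop_single_of (hb (y - 1)) b a m (a + m - b) (by omega),
      smul_smul (qnum η (1 - y)) _ (Finsupp.single _ _), ← key, qnum_neg]
    rcases le_or_gt (b + 1) (a + m) with h | h
    · rw [hop_single_of (hb y) (b + 1) a m (a + m - (b + 1)) (by omega), map_smul, auxZ_single,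
        show a + m - (b + 1) + 1 = a + m - b by omega]
      module
    · rw [hop_single, hb y (b + 1) a m h, zero_smul, map_zero]
      module
  · rcases b with _ | b
    · have key := kappaPlus_raise_zero' hη (x := x) hy1 a m
      rw [if_pos rfl, hop_single_of (hb y) 0 a m (a + m) (by omega),
        hop_single_of (hb (y - 1)) 0 a (m + 1) (a + m + 1) (by omega), map_smul, auxZ_single,
        smul_smul (qnum η (1 - y)) _ (Finsupp.single _ _), ← key, Nat.cast_zero, zero_add]
      module
    · have key := kappaPlus_raise' hη (x := x) hy1 b a m
      rw [if_neg (Nat.succ_ne_zero b), Nat.add_sub_cancel,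
        hop_single_of (hb y) b a m (a + m - b) (by omega),
        hop_single_of (hb (y - 1)) (b + 1) a (m + 1) (a + m - b) (by omega),
        show ((b + 1 : ℕ) : ℂ) + 1 - (y - x) = b + 2 - (y - x) by push_cast; ring,
        smul_smul (qnum η (1 - y)) _ (Finsupp.single _ _), ← neg_smul, ← key]
      rcases le_or_gt (b + 1) (a + m) with h | h
      · rw [hop_single_of (hb y) (b + 1) a m (a + m - (b + 1)) (by omega), map_smul,
          auxZ_single, show a + m - (b + 1) + 1 = a + m - b by omega]
        module
      · rw [hop_single, hb y (b + 1) a m h, zero_smul, map_zero]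
        module

/-! ### The two Baxter equations -/

/-- `T` is an operator on the quantum space whose matrix elements are the sums over paths with
weights `κ`. -/
def HasPathSum (κ : ℕ → ℕ → ℕ → ℂ) (T : Module.End ℂ (MvPolynomial (Fin N) ℂ)) : Prop :=
  ∀ b a : Fin N →₀ ℕ, HasSum (pathTerm κ b a) (coeff b (T (monomial a 1)))

theorem tHom_eq (N : ℕ) (η ℓ u : ℂ) : tHom N η ℓ u =
    ((List.finRange N).map fun k => lax η k u ℓ).prod 0 0 +
      ((List.finRange N).map fun k => lax η k u ℓ).prod 1 1 := by
  simp only [tHom, transferMatrix, add_zero, List.ofFn_eq_map, Matrix.trace_fin_two]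

theorem list_prod_smul {ι R : Type*} [Ring R] [Algebra ℂ R] (c : ℂ) (f : ι → R) (l : List ι) :
    (l.map fun k => c • f k).prod = c ^ l.length • (l.map f).prod := by
  induction l with
  | nil => simp
  | cons k l ih =>
    simp only [List.map_cons, List.prod_cons, List.length_cons, ih, smul_mul_smul_comm, pow_succ']

/-- A matrix element of a product over all sites, as a linear functional. -/
def auxEntry (m n : ℕ) : Module.End ℂ (ℕ →₀ ℂ) →ₗ[ℂ] ℂ :=
  (Finsupp.lapply n) ∘ₗ LinearMap.applyₗ (Finsupp.single m 1)

theorem ext_coeff_monomial {S T : Module.End ℂ (MvPolynomial (Fin N) ℂ)}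
    (h : ∀ b a, coeff b (S (monomial a 1)) = coeff b (T (monomial a 1))) : S = T :=
  (basisMonomials (Fin N) ℂ).ext fun a => by
    rw [coe_basisMonomials]
    exact MvPolynomial.ext _ _ fun b => h b a

/-- A local triangularisation with the Lax operators acting first gives a Baxter equation with the
transfer matrix on the right. -/
theorem baxter_right {η u ℓ cα cβ : ℂ} {κ κα κβ : ℕ → ℕ → ℕ → ℂ}
    {T Tα Tβ : Module.End ℂ (MvPolynomial (Fin N) ℂ)}
    (hT : HasPathSum κ T) (hα : HasPathSum κα Tα) (hβ : HasPathSum κβ Tβ)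
    (h : ∀ b a, Triangularizes auxZ (laxRight η u ℓ κ b a) (cα • hop κα b a)
      (cβ • hop κβ b a)) :
    T * tHom N η ℓ u = cα ^ N • Tα + cβ ^ N • Tβ := by
  refine ext_coeff_monomial fun b a => ?_
  set f : ℕ → MvPolynomial (Fin N) ℂ →ₗ[ℂ] ℂ := fun m =>
    (basisMonomials (Fin N) ℂ).constr ℂ fun a => pathTerm κ b a m with hf
  have hfa : ∀ m a, f m (monomial a 1) = pathTerm κ b a m := by
    intro m a
    have := (basisMonomials (Fin N) ℂ).constr_basis ℂ (fun a => pathTerm κ b a m) a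
    rwa [coe_basisMonomials] at this
  have hfsum : ∀ p, HasSum (fun m => f m p) (coeff b (T p)) := by
    intro p
    induction p using MvPolynomial.induction_on' with
    | monomial a c =>
      have h1 : (monomial a c : MvPolynomial (Fin N) ℂ) = c • monomial a 1 := by
        rw [smul_monomial, smul_eq_mul, mul_one]
      simp only [h1, map_smul, coeff_smul, hfa, smul_eq_mul]
      exact (hT b a).mul_left c
    | add p q hp hq =>
      simp only [map_add, coeff_add]
      exact hp.add hq
  set P := ((List.finRange N).map fun k => laxRight η u ℓ κ (b k) (a k)).prod with hP
  have hfP : ∀ i j m, f m (((List.finRange N).map fun k => lax η k u ℓ).prod i j (monomial a 1)) =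
      P i j (Finsupp.single m 1) m := by
    intro i j m
    exact functional_comp_lax_prod η u ℓ (f m) (fun k n => hop κ (b k) n) (List.finRange N)
      (List.nodup_finRange N) (fun _ => auxEntry m m) (fun _ _ _ _ => rfl) (fun a => hfa m a) i j a
  have htri := Triangularizes.list_prod (List.finRange N) fun k _ => h (b k) (a k)
  rw [list_prod_smul cα fun k => hop κα (b k) (a k), list_prod_smul cβ fun k => hop κβ (b k) (a k),
    List.length_finRange] at htri
  rw [LinearMap.add_apply, LinearMap.smul_apply, LinearMap.smul_apply, coeff_add, coeff_smul,
    coeff_smul, smul_eq_mul, smul_eq_mul]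
  refine htri.trace ?_ ?_ ((hα b a).mul_left _) ((hβ b a).mul_left _)
  · have := (hfsum (((List.finRange N).map fun k => lax η k u ℓ).prod 0 0 (monomial a 1))).summable
    simpa only [hfP] using this
  · have := hfsum (tHom N η ℓ u (monomial a 1))
    simpa only [tHom_eq, Module.End.mul_apply, LinearMap.add_apply, map_add, coeff_add, hfP, hP] using this

/-- A local triangularisation with the Lax operators acting last gives a Baxter equation with the
transfer matrix on the left. -/
theorem baxter_left {η u ℓ cα cβ : ℂ} {κ κα κβ : ℕ → ℕ → ℕ → ℂ} (hκ : Balanced κ)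
    {T Tα Tβ : Module.End ℂ (MvPolynomial (Fin N) ℂ)}
    (hT : HasPathSum κ T) (hα : HasPathSum κα Tα) (hβ : HasPathSum κβ Tβ)
    (h : ∀ b a, Triangularizes auxZ (laxLeft η u ℓ κ b a) (cα • hop κα b a)
      (cβ • hop κβ b a)) :
    tHom N η ℓ u * T = cα ^ N • Tα + cβ ^ N • Tβ := by
  refine ext_coeff_monomial fun b a => ?_
  set D : Finset (Fin N →₀ ℕ) := finsuppAntidiag univ a.degree with hD
  have hDout : ∀ b, b ∉ D → ∀ m, pathTerm κ b a m = 0 := by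
    intro b hb m
    refine pathTerm_eq_zero hκ (fun hd => hb ?_) m
    simp [hD, mem_finsuppAntidiag, ← hd, Finsupp.degree_eq_sum]
  set p : ℕ → MvPolynomial (Fin N) ℂ := fun m => ∑ b ∈ D, pathTerm κ b a m • monomial b 1 with hp
  have hpc : ∀ m b, coeff b (p m) = pathTerm κ b a m := by
    intro m b
    simp only [hp, coeff_sum, coeff_smul, coeff_monomial, smul_eq_mul, mul_ite, mul_one, mul_zero,
      sum_ite_eq']
    split_ifs with hb
    · rfl
    · rw [hDout b hb]
  have hTa : T (monomial a 1) = ∑ b ∈ D, coeff b (T (monomial a 1)) • monomial b 1 := by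
    ext b
    simp only [coeff_sum, coeff_smul, coeff_monomial, smul_eq_mul, mul_ite, mul_one, mul_zero,
      sum_ite_eq']
    split_ifs with hb
    · rfl
    · refine (hT b a).unique ?_
      simp only [funext (hDout b hb)]
      exact hasSum_zero
  have hsum : ∀ g : MvPolynomial (Fin N) ℂ →ₗ[ℂ] ℂ,
      HasSum (fun m => g (p m)) (g (T (monomial a 1))) := by
    intro g
    rw [hTa]
    simp only [hp, map_sum, map_smul, smul_eq_mul]
    exact hasSum_sum fun b _ => (hT b a).mul_right _
  set P := ((List.finRange N).map fun k => laxLeft η u ℓ κ (b k) (a k)).prod with hP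
  have hpP : ∀ i j m, coeff b (((List.finRange N).map fun k => lax η k u ℓ).prod i j (p m)) =
      P i j (Finsupp.single m 1) m := by
    intro i j m
    exact coeff_lax_prod η u ℓ (p m) (fun k n => hop κ n (a k)) (List.finRange N)
      (List.nodup_finRange N) (fun _ => auxEntry m m) (fun _ _ _ _ => rfl) (fun b => hpc m b) i j b
  have htri := Triangularizes.list_prod (List.finRange N) fun k _ => h (b k) (a k)
  rw [list_prod_smul cα fun k => hop κα (b k) (a k), list_prod_smul cβ fun k => hop κβ (b k) (a k),
    List.length_finRange] at htri
  rw [LinearMap.add_apply, LinearMap.smul_apply, LinearMap.smul_apply, coeff_add, coeff_smul,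
    coeff_smul, smul_eq_mul, smul_eq_mul]
  refine htri.trace ?_ ?_ ((hα b a).mul_left _) ((hβ b a).mul_left _)
  · have := (hsum (lcoeff ℂ b ∘ₗ
      ((List.finRange N).map fun k => lax η k u ℓ).prod 0 0)).summable
    simpa only [LinearMap.comp_apply, lcoeff_apply, hpP] using this
  · have := hsum (lcoeff ℂ b ∘ₗ tHom N η ℓ u)
    simpa only [tHom_eq, LinearMap.comp_apply, lcoeff_apply, Module.End.mul_apply,
      LinearMap.add_apply, map_add, coeff_add, hpP, hP] using this

/-! ### The operators `Q` as sums over paths -/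

/-- With equal parameters the transfer of `k` quanta from `z_i` to `z_j` carries the factor `[0]_q` for
`k ≠ 0`. -/
theorem weylConj_self {σ : Type*} [DecidableEq σ] {η : ℂ} (hη : η.re ≠ 0) {x : ℂ}
    (hx : ∀ n : ℕ, qpow η (2 * (x + n)) ≠ 1) {i j : σ} (hij : i ≠ j) : weylConj η i j x x = 1 := by
  refine (basisMonomials σ ℂ).ext fun s => ?_
  have hs : s = s.erase i + Finsupp.single i (s i) + Finsupp.single j 0 := by
    rw [Finsupp.single_zero, add_zero, Finsupp.erase_add_single]
  rw [coe_basisMonomials, Module.End.one_apply]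
  conv_lhs => rw [hs, weylConj_monomial hη x hx hij (by simp)]
  rw [sum_eq_single (0, s i)]
  · simp only [sub_self, riseBin_zero_right, mul_one, add_zero]
    rw [div_self (riseBin_ne_zero hη hx _), one_smul, ← hs]
  · rintro ⟨k, r⟩ hk hne
    rw [HasAntidiagonal.mem_antidiagonal] at hk
    have hk0 : k ≠ 0 := by
      rintro rfl
      exact hne (by simpa using hk)
    simp only [sub_self, riseBin_zero_left, if_neg hk0, mul_zero, zero_div, zero_smul]
  · intro h
    exact absurd (by simp) h

theorem monodromyMinus_eq (N : ℕ) (η ℓ u : ℂ) : monodromyMinus N η ℓ u =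
    (List.ofFn fun k : Fin N => permOp k.succ 0 * weylConj η k.succ 0 (u + ℓ) (2 * ℓ)).prod := by
  simp only [monodromyMinus, Rminus_eq_weylConj, sub_zero,
    show u + ℓ - (u - ℓ) = 2 * ℓ by ring]

theorem monodromyPlus_eq (N : ℕ) (η ℓ u : ℂ) : monodromyPlus N η ℓ u =
    (List.ofFn fun k : Fin N =>
      permOp k.succ 0 * weylConj η 0 k.succ (2 * ℓ) (1 + ℓ - u)).prod := by
  simp only [monodromyPlus, Rplus_eq_weylConj, show u + ℓ - (u - ℓ) = 2 * ℓ by ring,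
    show 1 - (u - ℓ) = 1 + ℓ - u by ring]

/-- At `u₁ = 1 - ℓ` the factor `R⁺` of the Yang–Baxter operator is trivial. -/
theorem monodromy₂_eq_minus {η : ℂ} (hη : η.re ≠ 0) {ℓ : ℂ}
    (hℓ : ∀ n : ℕ, qpow η (2 * (2 * ℓ + n)) ≠ 1) (u : ℂ) :
    monodromy₂ η (fun _ : Fin N => ℓ) (fun _ => 0) (1 - ℓ) u = monodromyMinus N η ℓ u := by
  rw [monodromyMinus_eq, monodromy₂, monodromy]
  refine congrArg (fun f => (List.ofFn f).prod) (funext fun k => ?_)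
  rw [yangBaxterR, Rplus_eq_weylConj, Rminus_eq_weylConj,
    show (1 - ℓ + u - 1) / 2 + 0 + ℓ - ((1 - ℓ + u - 1) / 2 + 0 - ℓ) = 2 * ℓ by ring,
    show (u - (1 - ℓ) + 1) / 2 - ((1 - ℓ + u - 1) / 2 + 0 - ℓ) = 2 * ℓ by ring,
    show (1 - ℓ + u - 1) / 2 + 0 + ℓ - -((u - (1 - ℓ) + 1) / 2) = u + ℓ by ring,
    weylConj_self hη hℓ (Fin.succ_ne_zero k).symm, mul_one]

/-- At `u₂ = ℓ` the factor `R⁻` of the Yang–Baxter operator is trivial. -/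
theorem monodromy₂_eq_plus {η : ℂ} (hη : η.re ≠ 0) {ℓ : ℂ}
    (hℓ : ∀ n : ℕ, qpow η (2 * (2 * ℓ + n)) ≠ 1) (u : ℂ) :
    monodromy₂ η (fun _ : Fin N => ℓ) (fun _ => 0) u ℓ = monodromyPlus N η ℓ u := by
  rw [monodromyPlus_eq, monodromy₂, monodromy]
  refine congrArg (fun f => (List.ofFn f).prod) (funext fun k => ?_)
  rw [yangBaxterR, Rplus_eq_weylConj, Rminus_eq_weylConj,
    show (u + ℓ - 1) / 2 + 0 + ℓ - ((u + ℓ - 1) / 2 + 0 - ℓ) = 2 * ℓ by ring,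
    show (ℓ - u + 1) / 2 - ((u + ℓ - 1) / 2 + 0 - ℓ) = 1 + ℓ - u by ring,
    show (u + ℓ - 1) / 2 + 0 + ℓ - -((ℓ - u + 1) / 2) = 2 * ℓ by ring,
    weylConj_self hη hℓ (Fin.succ_ne_zero k), mul_one]

theorem pathTerm_succ (κ : ℕ → ℕ → ℕ → ℂ) (b a : Fin (N + 1) →₀ ℕ) (m : ℕ) :
    pathTerm κ b a m = κ (b (Fin.last N)) (a (Fin.last N)) m *
      pathProd κ ((List.finRange N).map Fin.castSucc) b a
        (Finsupp.single (a (Fin.last N) + m - b (Fin.last N)) 1) m := by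
  rw [pathTerm, List.finRange_succ_last, pathProd_snoc, Finsupp.smul_apply, smul_eq_mul]

/-- The weight of the last site vanishes once the auxiliary exponent exceeds that of the site, so the
sums over paths for `Q₋` are finite. -/
theorem pathTerm_kappaMinus_eq_zero (η x y : ℂ) (b a : Fin (N + 1) →₀ ℕ) {m : ℕ}
    (hm : b (Fin.last N) < m) : pathTerm (kappaMinus η x y) b a m = 0 := by
  rw [pathTerm_succ, kappaMinus_eq_zero η x y (Or.inl hm), zero_mul]

theorem isAuxTrace_Qminus (hN : 0 < N) {η : ℂ} (hη : η.re ≠ 0) {ℓ : ℂ}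
    (hℓ : ∀ n : ℕ, qpow η (2 * (2 * ℓ + n)) ≠ 1) (u : ℂ) :
    IsAuxTrace (monodromyMinus N η ℓ u) (Qminus N η ℓ u) ∧
      HasPathSum (kappaMinus η (u + ℓ) (2 * ℓ)) (Qminus N η ℓ u) := by
  obtain ⟨N, rfl⟩ := Nat.exists_eq_succ_of_ne_zero hN.ne'
  rw [Qminus, QHom, Qop, monodromy₂_eq_minus hη hℓ, monodromyMinus_eq]
  refine auxTrace_hopping (balanced_kappaMinus _ _ _) (isHopping_minus hη _ hℓ) fun b a => ?_
  refine summable_of_ne_finset_zero (s := range (b (Fin.last N) + 1)) fun m hm => ?_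
  exact pathTerm_kappaMinus_eq_zero _ _ _ b a (by rw [mem_range] at hm; omega)

/-- The Baxter equation for `Q₋`. -/
theorem Qminus_mul_tHom (hN : 0 < N) {η : ℂ} (hη : η.re ≠ 0) {ℓ : ℂ}
    (hℓ : ∀ n : ℕ, qpow η (2 * (2 * ℓ + n)) ≠ 1) (u : ℂ) :
    Qminus N η ℓ u * tHom N η ℓ u =
      qnum η (u + ℓ) ^ N • Qminus N η ℓ (u + 1) + qnum η (u - ℓ) ^ N • Qminus N η ℓ (u - 1) :=
  baxter_right (isAuxTrace_Qminus hN hη hℓ u).2 (isAuxTrace_Qminus hN hη hℓ (u + 1)).2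
    (isAuxTrace_Qminus hN hη hℓ (u - 1)).2 (triangularizes_minus hη u hℓ)

/-! ### Convergence of the sums over paths for `Q₊` -/

theorem multipliable_qPoch {p : ℂ} (hp : ‖p‖ < 1) (x : ℂ) :
    Multipliable fun k : ℕ => (1 - p ^ k * x) := by
  have hs : Summable fun k : ℕ => ‖-(p ^ k * x)‖ := by
    simp only [norm_neg, norm_mul, norm_pow]
    exact (summable_geometric_of_lt_one (norm_nonneg p) hp).mul_right _
  simpa [sub_eq_add_neg] using multipliable_one_add_of_summable hs

theorem exists_norm_qPoch_le {p : ℂ} (hp : ‖p‖ < 1) (x : ℂ) : ∃ C, ∀ n, ‖qPoch x p n‖ ≤ C := by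
  obtain ⟨C, hC⟩ := (multipliable_qPoch hp x).tendsto_prod_tprod_nat.norm.bddAbove_range
  exact ⟨C, fun n => hC ⟨n, rfl⟩⟩

theorem exists_norm_qPoch_inv_le {p : ℂ} (hp : ‖p‖ < 1) {x : ℂ} (hx : ∀ k : ℕ, p ^ k * x ≠ 1) :
    ∃ C, ∀ n, ‖(qPoch x p n)⁻¹‖ ≤ C := by
  have hs : Summable fun k : ℕ => ‖-(p ^ k * x)‖ := by
    simp only [norm_neg, norm_mul, norm_pow]
    exact (summable_geometric_of_lt_one (norm_nonneg p) hp).mul_right _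
  have h0 : ∏' k : ℕ, (1 - p ^ k * x) ≠ 0 := by
    have := tprod_one_add_ne_zero_of_summable (f := fun k : ℕ => -(p ^ k * x))
      (fun k => by rw [← sub_eq_add_neg, sub_ne_zero]; exact (hx k).symm) hs
    simpa only [← sub_eq_add_neg] using this
  obtain ⟨C, hC⟩ :=
    ((multipliable_qPoch hp x).tendsto_prod_tprod_nat.inv₀ h0).norm.bddAbove_range
  exact ⟨C, fun n => hC ⟨n, rfl⟩⟩

theorem norm_qPoch_le {p x : ℂ} {s : ℝ} (hx : ‖x‖ ≤ s) (n : ℕ) :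
    ‖qPoch x p n‖ ≤ ‖qPoch ((-s : ℝ) : ℂ) ((‖p‖ : ℝ) : ℂ) n‖ := by
  rw [qPoch, qPoch, norm_prod, norm_prod]
  refine prod_le_prod (fun _ _ => norm_nonneg _) fun k _ => ?_
  have h0 : 0 ≤ s := (norm_nonneg x).trans hx
  have h1 : (1 : ℂ) - ((‖p‖ : ℝ) : ℂ) ^ k * ((-s : ℝ) : ℂ) = ((1 + ‖p‖ ^ k * s : ℝ) : ℂ) := by
    push_cast
    ring
  rw [h1, Complex.norm_real, Real.norm_of_nonneg (by positivity)]
  refine (norm_sub_le _ _).trans ?_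
  rw [norm_one, norm_mul, norm_pow]
  gcongr

/-- The bound by the product at `‖p‖` and `s`, which is uniform in `x` on the disc of radius `s`. -/
theorem norm_qPoch_inv_le {p x : ℂ} (hp : ‖p‖ ≤ 1) {s : ℝ} (hs : s < 1) (hx : ‖x‖ ≤ s) (n : ℕ) :
    ‖(qPoch x p n)⁻¹‖ ≤ ‖(qPoch (s : ℂ) ((‖p‖ : ℝ) : ℂ) n)⁻¹‖ := by
  rw [norm_inv, norm_inv, qPoch, qPoch, norm_prod, norm_prod]
  have h0 : 0 ≤ s := (norm_nonneg x).trans hx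
  have h2 : ∀ k : ℕ, ‖p‖ ^ k * s < 1 := fun k =>
    (mul_le_of_le_one_left h0 (pow_le_one₀ (norm_nonneg p) hp)).trans_lt hs
  have h1 : ∀ k : ℕ, ‖(1 : ℂ) - ((‖p‖ : ℝ) : ℂ) ^ k * (s : ℂ)‖ = 1 - ‖p‖ ^ k * s := by
    intro k
    rw [show (1 : ℂ) - ((‖p‖ : ℝ) : ℂ) ^ k * (s : ℂ) = ((1 - ‖p‖ ^ k * s : ℝ) : ℂ) by push_cast; ring,
      Complex.norm_real, Real.norm_of_nonneg (sub_nonneg.2 (h2 k).le)]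
  refine inv_anti₀ (prod_pos fun k _ => ?_) (prod_le_prod (fun _ _ => norm_nonneg _) fun k _ => ?_)
  · rw [h1]
    exact sub_pos.2 (h2 k)
  · rw [h1]
    refine le_trans ?_ (norm_sub_norm_le _ _)
    rw [norm_one, norm_mul, norm_pow]
    gcongr

/-- The weights of `Q₊(u)` as functions of `Y = q ^ (-u)`, up to a factor `Y ^ b`. They are
analytic at `Y = 0`. -/
def kappaDisc (η ℓ Y : ℂ) (b _a m : ℕ) : ℂ :=
  if b ≤ m then
    riseBin η (2 * ℓ) b * qpow η ℓ ^ b * qpow η (2 * ℓ) ^ (m - b) *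
      (qPoch (qpow η (2 - 2 * ℓ) * Y ^ 2) (qpow η 2) (m - b) * qPoch (qpow η 2) (qpow η 2) m *
        (qPoch (qpow η 2) (qpow η 2) (m - b))⁻¹ *
          (qPoch (qpow η (2 + 2 * ℓ) * Y ^ 2) (qpow η 2) m)⁻¹)
  else 0

theorem riseBin_eq_qPoch {η : ℂ} (hη : η.re ≠ 0) (x : ℂ) (n : ℕ) :
    riseBin η x n = qPoch (qpow η (2 * x)) (qpow η 2) n /
      (qPoch (qpow η 2) (qpow η 2) n * qpow η (x - 1) ^ n) := by
  rw [qPoch_eq_riseBin hη, mul_div_cancel_left₀]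
  exact mul_ne_zero (qPoch_self_ne_zero hη n) (pow_ne_zero _ (qpow_ne_zero _ _))

theorem kappaPlus_eq_kappaDisc {η : ℂ} (hη : η.re ≠ 0) (ℓ u : ℂ) (b a m : ℕ) :
    kappaPlus η (2 * ℓ) (1 + ℓ - u) b a m =
      qpow η (-u) ^ b * kappaDisc η ℓ (qpow η (-u)) b a m := by
  rw [kappaPlus, kappaDisc]
  split_ifs with h
  · obtain ⟨j, rfl⟩ := Nat.exists_eq_add_of_le h
    rw [Nat.add_sub_cancel_left, riseBin_eq_qPoch hη (1 + ℓ - u - 2 * ℓ),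
      riseBin_eq_qPoch hη (1 + ℓ - u),
      show 2 * (1 + ℓ - u - 2 * ℓ) = 2 - 2 * ℓ + 2 * (-u) by ring,
      show 2 * (1 + ℓ - u) = 2 + 2 * ℓ + 2 * (-u) by ring, qpow_add η _ (2 * (-u)),
      qpow_add η _ (2 * (-u)), qpow_two_mul η (-u),
      show 1 + ℓ - u - 2 * ℓ - 1 = -u - ℓ by ring, show 1 + ℓ - u - 1 = ℓ + -u by ring,
      qpow_sub η (-u) ℓ, qpow_add η ℓ, qpow_two_mul η ℓ]
    have hA := qpow_ne_zero η ℓ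
    have hY := qpow_ne_zero η (-u)
    have hp := qPoch_self_ne_zero hη
    generalize qPoch (qpow η (2 - 2 * ℓ) * qpow η (-u) ^ 2) (qpow η 2) j = P1
    generalize qPoch (qpow η (2 + 2 * ℓ) * qpow η (-u) ^ 2) (qpow η 2) (b + j) = P2
    generalize qpow η ℓ = A at *
    generalize qpow η (-u) = Y at *
    have h1 := hp j
    have h2 := hp (b + j)
    rw [div_pow, mul_pow, pow_add, pow_add, ← pow_mul]
    rcases eq_or_ne P2 0 with rfl | h3
    · simp
    · field_simp
      ring
  · rw [mul_zero]

/-- Geometric decay of the weights, uniformly on a bounded set of `Y` on which the denominators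
stay away from zero. -/
theorem exists_norm_kappaDisc_le {η : ℂ} (hη : η.re < 0) (ℓ : ℂ) {S : Set ℂ} {R C₀ : ℝ}
    (hR : ∀ Y ∈ S, ‖Y‖ ≤ R)
    (hC₀ : ∀ Y ∈ S, ∀ n, ‖(qPoch (qpow η (2 + 2 * ℓ) * Y ^ 2) (qpow η 2) n)⁻¹‖ ≤ C₀) (b : ℕ) :
    ∃ C, ∀ Y ∈ S, ∀ a m, ‖kappaDisc η ℓ Y b a m‖ ≤ C * ‖qpow η (2 * ℓ)‖ ^ m := by
  have hp : ‖qpow η 2‖ < 1 := by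
    rw [norm_qpow, Real.exp_lt_one_iff]
    simp
    linarith
  have hp' : ‖((‖qpow η 2‖ : ℝ) : ℂ)‖ < 1 := by simpa using hp
  obtain ⟨C₁, hC₁⟩ := exists_norm_qPoch_le hp'
    ((-(‖qpow η (2 - 2 * ℓ)‖ * R ^ 2) : ℝ) : ℂ)
  obtain ⟨C₂, hC₂⟩ := exists_norm_qPoch_le hp (qpow η 2)
  obtain ⟨C₃, hC₃⟩ := exists_norm_qPoch_inv_le hp (x := qpow η 2) fun k h =>
    qpow_two_pow_ne_one hη.ne k (by rw [pow_succ, h, sub_self])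
  set ρ := ‖qpow η (2 * ℓ)‖ with hρ
  have hρ0 : 0 < ρ := norm_pos_iff.2 (qpow_ne_zero _ _)
  refine ⟨‖riseBin η (2 * ℓ) b * qpow η ℓ ^ b‖ * (C₁ * C₂ * C₃ * C₀) * (ρ ^ b)⁻¹, ?_⟩
  intro Y hY a m
  have hC₁0 : 0 ≤ C₁ := (norm_nonneg _).trans (hC₁ 0)
  have hC₂0 : 0 ≤ C₂ := (norm_nonneg _).trans (hC₂ 0)
  have hC₃0 : 0 ≤ C₃ := (norm_nonneg _).trans (hC₃ 0)
  have hC₀0 : 0 ≤ C₀ := (norm_nonneg _).trans (hC₀ Y hY 0)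
  rw [kappaDisc]
  split_ifs with h
  · have e : ρ ^ m = ρ ^ b * ρ ^ (m - b) := by rw [← pow_add, Nat.add_sub_cancel' h]
    have h1 : ‖qPoch (qpow η (2 - 2 * ℓ) * Y ^ 2) (qpow η 2) (m - b)‖ ≤ C₁ := by
      refine (norm_qPoch_le ?_ _).trans (hC₁ _)
      rw [norm_mul, norm_pow]
      have := hR Y hY
      gcongr
    have h2 := hC₂ m
    have h3 := hC₃ (m - b)
    have h4 := hC₀ Y hY m
    rw [norm_mul, norm_mul _ (qpow η (2 * ℓ) ^ (m - b)), norm_pow, norm_mul (_ * _ * _),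
      norm_mul (_ * _), norm_mul (qPoch _ _ _), e]
    set c := ‖riseBin η (2 * ℓ) b * qpow η ℓ ^ b‖ with hc
    refine (mul_le_mul_of_nonneg_left (mul_le_mul (mul_le_mul (mul_le_mul h1 h2 (norm_nonneg _) hC₁0)
      h3 (norm_nonneg _) (by positivity)) h4 (norm_nonneg _) (by positivity))
      (by positivity)).trans_eq ?_
    rw [← hρ]
    field_simp
  · rw [norm_zero]
    positivity

theorem norm_pathProd_le {ι : Type*} {κ : ℕ → ℕ → ℕ → ℂ} {C : ℝ} (hC : 0 ≤ C) (l : List ι)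
    (b a : ι → ℕ) (h : ∀ k ∈ l, ∀ m, ‖κ (b k) (a k) m‖ ≤ C) (m n : ℕ) :
    ‖pathProd κ l b a (Finsupp.single m 1) n‖ ≤ C ^ l.length := by
  induction l using List.reverseRecOn generalizing m with
  | nil =>
    simp only [pathProd, List.map_nil, List.prod_nil, Module.End.one_apply, List.length_nil,
      pow_zero, Finsupp.single_apply]
    split_ifs <;> simp
  | append_singleton l k ih =>
    rw [pathProd_snoc, Finsupp.smul_apply, smul_eq_mul, norm_mul, List.length_append,
      List.length_singleton, pow_succ']
    exact mul_le_mul (h k (by simp) m) (ih (fun k' hk' => h k' (by simp [hk'])) _) (norm_nonneg _) hC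

theorem norm_pathTerm_le {κ : ℕ → ℕ → ℕ → ℂ} {C ρ : ℝ} (hC : 0 ≤ C) (hρ : 0 ≤ ρ) (hρ1 : ρ ≤ 1)
    (b a : Fin (N + 1) →₀ ℕ) (h : ∀ k, ∀ m, ‖κ (b k) (a k) m‖ ≤ C * ρ ^ m) (m : ℕ) :
    ‖pathTerm κ b a m‖ ≤ C ^ (N + 1) * ρ ^ m := by
  rw [pathTerm_succ, norm_mul]
  have h1 := norm_pathProd_le hC ((List.finRange N).map Fin.castSucc) b a (κ := κ)
    (fun k _ m' => (h k m').trans (mul_le_of_le_one_right hC (pow_le_one₀ hρ hρ1)))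
    (a (Fin.last N) + m - b (Fin.last N)) m
  rw [List.length_map, List.length_finRange] at h1
  refine (mul_le_mul (h _ m) h1 (norm_nonneg _) (by positivity)).trans_eq ?_
  ring

/-- Uniform geometric decay of the terms of the sums over paths. -/
theorem exists_norm_pathTerm_kappaDisc_le {η : ℂ} (hη : η.re < 0) {ℓ : ℂ} (hℓ : (η * ℓ).re < 0)
    {S : Set ℂ} {R C₀ : ℝ} (hR : ∀ Y ∈ S, ‖Y‖ ≤ R)
    (hC₀ : ∀ Y ∈ S, ∀ n, ‖(qPoch (qpow η (2 + 2 * ℓ) * Y ^ 2) (qpow η 2) n)⁻¹‖ ≤ C₀)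
    (b a : Fin (N + 1) →₀ ℕ) :
    ∃ f : ℕ → ℝ, Summable f ∧ ∀ Y ∈ S, ∀ m, ‖pathTerm (kappaDisc η ℓ Y) b a m‖ ≤ f m := by
  choose C hC using fun k => exists_norm_kappaDisc_le hη ℓ hR hC₀ (b k)
  set ρ := ‖qpow η (2 * ℓ)‖ with hρ
  have hρ1 : ρ < 1 := by
    rw [hρ, norm_qpow, Real.exp_lt_one_iff, show η * (2 * ℓ) = (2 : ℝ) * (η * ℓ) by push_cast; ring,
      Complex.re_ofReal_mul]
    linarith
  have hρ0 : 0 ≤ ρ := norm_nonneg _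
  refine ⟨fun m => (∑ k, |C k|) ^ (N + 1) * ρ ^ m,
    (summable_geometric_of_lt_one hρ0 hρ1).mul_left _, fun Y hY m => ?_⟩
  refine norm_pathTerm_le (sum_nonneg fun k _ => abs_nonneg _) hρ0 hρ1.le b a (fun k m => ?_) m
  refine (hC k Y hY _ m).trans ?_
  gcongr
  exact (le_abs_self _).trans (single_le_sum (f := fun k => |C k|) (fun k _ => abs_nonneg _)
    (mem_univ k))

theorem pathProd_mul {ι : Type*} (κ κ' : ℕ → ℕ → ℕ → ℂ) (c : ℕ → ℂ)
    (h : ∀ b a m, κ b a m = c b * κ' b a m) (l : List ι) (b a : ι → ℕ) :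
    pathProd κ l b a = (l.map fun k => c (b k)).prod • pathProd κ' l b a := by
  have h1 : ∀ b a, hop κ b a = c b • hop κ' b a := fun b a => end_ext_single fun m => by
    rw [hop_single, LinearMap.smul_apply, hop_single, smul_smul, h]
  induction l with
  | nil => simp [pathProd]
  | cons k l ih =>
    simp only [pathProd, List.map_cons, List.prod_cons, h1] at ih ⊢
    rw [ih, smul_mul_smul_comm]

theorem pathTerm_mul_pow {κ κ' : ℕ → ℕ → ℕ → ℂ} {Y : ℂ}
    (h : ∀ b a m, κ b a m = Y ^ b * κ' b a m) (b a : Fin N →₀ ℕ) (m : ℕ) :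
    pathTerm κ b a m = Y ^ b.degree * pathTerm κ' b a m := by
  rw [pathTerm, pathProd_mul κ κ' (fun b => Y ^ b) h, LinearMap.smul_apply, Finsupp.smul_apply,
    smul_eq_mul, pathTerm]
  congr 1
  rw [← List.ofFn_eq_map, List.prod_ofFn, prod_pow_eq_pow_sum, Finsupp.degree_eq_sum]

theorem pathTerm_kappaPlus {η : ℂ} (hη : η.re ≠ 0) (ℓ u : ℂ) (b a : Fin N →₀ ℕ) (m : ℕ) :
    pathTerm (kappaPlus η (2 * ℓ) (1 + ℓ - u)) b a m =
      qpow η (-u) ^ b.degree * pathTerm (kappaDisc η ℓ (qpow η (-u))) b a m :=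
  pathTerm_mul_pow (kappaPlus_eq_kappaDisc hη ℓ u) b a m

theorem kappaPlus_neg_eta (η x y : ℂ) : kappaPlus (-η) x y = kappaPlus η x y := by
  funext b a m
  simp only [kappaPlus, riseBin, qnum_neg_eta]

theorem regularPlus_iff {η ℓ u : ℂ} :
    RegularPlus η ℓ u ↔ ∀ n : ℕ, qpow η (2 * (1 + ℓ - u + n)) ≠ 1 := by
  have e : ∀ n : ℕ, 2 + 2 * ℓ - 2 * u + 2 * n = 2 * (1 + ℓ - u + n) := fun n => by ring
  simp only [RegularPlus, e]

theorem qpow_neg_eta_eq_one_iff {η x : ℂ} : qpow (-η) x = 1 ↔ qpow η x = 1 := by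
  have h : qpow (-η) x = qpow η (-x) := by simp [qpow]
  rw [h, qpow_neg, inv_eq_one]

theorem summable_pathTerm_kappaPlus {η : ℂ} (hη : η.re ≠ 0) {ℓ : ℂ}
    (hℓ : 0 < η.re * (η * ℓ).re) {u : ℂ} (hu : RegularPlus η ℓ u) (b a : Fin (N + 1) →₀ ℕ) :
    Summable (pathTerm (kappaPlus η (2 * ℓ) (1 + ℓ - u)) b a) := by
  wlog hneg : η.re < 0 generalizing η
  · have hpos : 0 < η.re := lt_of_le_of_ne (not_lt.1 hneg) hη.symm
    rw [← kappaPlus_neg_eta]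
    refine this (by simpa using hη) ?_ (fun n => ?_) (by simpa using hpos)
    · rwa [neg_mul, Complex.neg_re, Complex.neg_re, neg_mul_neg]
    · rw [Ne, qpow_neg_eta_eq_one_iff]
      exact hu n
  have hℓ' : (η * ℓ).re < 0 := (neg_iff_neg_of_mul_pos hℓ).1 hneg
  have hp : ‖qpow η 2‖ < 1 := by
    rw [norm_qpow, Real.exp_lt_one_iff]
    simp
    linarith
  obtain ⟨C₀, hC₀⟩ := exists_norm_qPoch_inv_le hp
    (x := qpow η (2 + 2 * ℓ) * qpow η (-u) ^ 2) fun k h => hu k <| by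
      rw [← h, ← qpow_two_mul, ← qpow_add, ← qpow_nat_mul, ← qpow_add]
      congr 1
      ring
  obtain ⟨f, hf, hb⟩ := exists_norm_pathTerm_kappaDisc_le hneg hℓ' (S := {qpow η (-u)})
    (R := ‖qpow η (-u)‖) (C₀ := C₀) (by simp) (by simpa using hC₀) b a
  rw [funext (pathTerm_kappaPlus hη ℓ u b a)]
  exact (Summable.of_norm_bounded hf (hb _ rfl)).mul_left _

theorem isAuxTrace_Qplus (hN : 0 < N) {η : ℂ} (hη : η.re ≠ 0) {ℓ : ℂ}
    (hℓ : ∀ n : ℕ, qpow η (2 * (2 * ℓ + n)) ≠ 1) (hconv : 0 < η.re * (η * ℓ).re) {u : ℂ}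
    (hu : RegularPlus η ℓ u) :
    IsAuxTrace (monodromyPlus N η ℓ u) (Qplus N η ℓ u) ∧
      HasPathSum (kappaPlus η (2 * ℓ) (1 + ℓ - u)) (Qplus N η ℓ u) := by
  obtain ⟨N, rfl⟩ := Nat.exists_eq_succ_of_ne_zero hN.ne'
  rw [Qplus, QHom, Qop, monodromy₂_eq_plus hη hℓ, monodromyPlus_eq]
  exact auxTrace_hopping (balanced_kappaPlus _ _ _) (isHopping_plus hη _ (regularPlus_iff.1 hu))
    (summable_pathTerm_kappaPlus hη hconv hu)

theorem RegularPlus.sub_one {η ℓ u : ℂ} (h : RegularPlus η ℓ (u + 1)) : RegularPlus η ℓ u := by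
  intro n
  have := h (n + 1)
  rwa [show 2 + 2 * ℓ - 2 * (u + 1) + 2 * ((n + 1 : ℕ) : ℂ) = 2 + 2 * ℓ - 2 * u + 2 * n by
    push_cast; ring] at this

/-- The Baxter equation for `Q₊`. -/
theorem tHom_mul_Qplus (hN : 0 < N) {η : ℂ} (hη : η.re ≠ 0) {ℓ : ℂ}
    (hℓ : ∀ n : ℕ, qpow η (2 * (2 * ℓ + n)) ≠ 1) (hconv : 0 < η.re * (η * ℓ).re) {u : ℂ}
    (hu : RegularPlus η ℓ (u + 1)) :
    tHom N η ℓ u * Qplus N η ℓ u =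
      (qnum η (u - 1 + ℓ) ^ N * qnum η (u - ℓ) ^ N / qnum η (u - 1 - ℓ) ^ N) •
        Qplus N η ℓ (u - 1) + qnum η (u - ℓ) ^ N • Qplus N η ℓ (u + 1) := by
  have hu0 := hu.sub_one
  have hu1 : RegularPlus η ℓ (u - 1) := RegularPlus.sub_one (by rwa [sub_add_cancel])
  rw [← mul_pow, ← div_pow]
  refine baxter_left (balanced_kappaPlus _ _ _) (isAuxTrace_Qplus hN hη hℓ hconv hu0).2
    (isAuxTrace_Qplus hN hη hℓ hconv hu1).2 (isAuxTrace_Qplus hN hη hℓ hconv hu).2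
    (triangularizes_plus hη ℓ fun n => ?_)
  have := regularPlus_iff.1 hu n
  rwa [show 1 + ℓ - (u + 1) + (n : ℂ) = ℓ - u + n by ring] at this

/-! ### Commuting transfer matrices -/

section Local

variable {σ : Type*}

theorem lax_commute (η u v ℓ ℓ' : ℂ) {k k' : σ} (h : k ≠ k') (i j i' j' : Fin 2) :
    Commute (lax η k u ℓ i j) (lax η k' v ℓ' i' j') := by
  classical
  refine (basisMonomials σ ℂ).ext fun s => ?_
  rw [coe_basisMonomials, Module.End.mul_apply, Module.End.mul_apply, lax_monomial, lax_monomial,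
    map_smul, map_smul, lax_monomial, lax_monomial, smul_smul, smul_smul, mul_comm]
  simp only [Finsupp.coe_update, Function.update_of_ne h, Function.update_of_ne h.symm]
  have e : ∀ m n, (s.update k m).update k' n = (s.update k' n).update k m := fun m n =>
    Finsupp.ext fun i => by
      simp only [Finsupp.coe_update]
      rw [Function.update_comm h]
  rw [e]

theorem lax_commute_prod (η u v ℓ : ℂ) {k : σ} {l : List σ} (h : k ∉ l) (i j i' j' : Fin 2) :
    Commute (lax η k u ℓ i j) ((l.map fun k => lax η k v ℓ).prod i' j') := by
  induction l generalizing i' j' with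
  | nil =>
    rcases eq_or_ne i' j' with rfl | hij
    · simp
    · simp [Matrix.one_apply_ne hij]
  | cons k' l ih =>
    rw [List.mem_cons, not_or] at h
    rw [List.map_cons, List.prod_cons, Matrix.mul_apply]
    exact Commute.sum_right _ _ _ fun m _ => (lax_commute η u v ℓ ℓ h.1 _ _ _ _).mul_right (ih h.2 _ _)

end Local

/-- The matrix with the shape of the six-vertex `R`-matrix. -/
def sixVertex (a b c : ℂ) : Matrix (Fin 2 × Fin 2) (Fin 2 × Fin 2) ℂ :=
  Matrix.of fun i j =>
    if i = j then if i.1 = i.2 then a else b else if i = j.swap then c else 0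

theorem sixVertex_mul (a b c a' b' c' : ℂ) : sixVertex a b c * sixVertex a' b' c' =
    sixVertex (a * a') (b * b' + c * c') (b * c' + c * b') := by
  ext ⟨i, i'⟩ ⟨j, j'⟩
  fin_cases i <;> fin_cases i' <;> fin_cases j <;> fin_cases j' <;>
    simp [sixVertex, Matrix.mul_apply, Fintype.sum_prod_type]
  all_goals ring

theorem sixVertex_one : sixVertex 1 1 0 = 1 := by
  ext i j
  rcases eq_or_ne i j with rfl | h
  · simp [sixVertex]
  · simp [sixVertex, h]

/-- The tensor product of two matrices over a ring. -/
def kronL {R : Type*} [Ring R] (A B : Matrix (Fin 2) (Fin 2) R) :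
    Matrix (Fin 2 × Fin 2) (Fin 2 × Fin 2) R :=
  Matrix.of fun i j => A i.1 j.1 * B i.2 j.2

/-- The tensor product of two matrices over a ring, with the entries multiplied in the opposite
order. -/
def kronR {R : Type*} [Ring R] (A B : Matrix (Fin 2) (Fin 2) R) :
    Matrix (Fin 2 × Fin 2) (Fin 2 × Fin 2) R :=
  Matrix.of fun i j => B i.2 j.2 * A i.1 j.1

theorem kronL_mul {R : Type*} [Ring R] {A A' B B' : Matrix (Fin 2) (Fin 2) R}
    (h : ∀ i j i' j', Commute (B i j) (A' i' j')) :
    kronL A B * kronL A' B' = kronL (A * A') (B * B') := by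
  ext i j
  simp only [kronL, Matrix.mul_apply, Matrix.of_apply, Fintype.sum_prod_type, sum_mul_sum]
  refine sum_congr rfl fun m _ => sum_congr rfl fun n _ => ?_
  rw [mul_assoc, ← mul_assoc (B _ _), (h _ _ _ _).eq]
  noncomm_ring

theorem kronR_mul {R : Type*} [Ring R] {A A' B B' : Matrix (Fin 2) (Fin 2) R}
    (h : ∀ i j i' j', Commute (A i j) (B' i' j')) :
    kronR A B * kronR A' B' = kronR (A * A') (B * B') := by
  ext i j
  simp only [kronR, Matrix.mul_apply, Matrix.of_apply, Fintype.sum_prod_type, sum_mul_sum]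
  rw [sum_comm]
  refine sum_congr rfl fun m _ => sum_congr rfl fun n _ => ?_
  rw [mul_assoc, ← mul_assoc (A _ _), (h _ _ _ _).eq]
  noncomm_ring

theorem trace_scalar_mul_comm {R ι : Type*} [Ring R] [Algebra ℂ R] [Fintype ι]
    (S : Matrix ι ι ℂ) (M : Matrix ι ι R) :
    Matrix.trace (S.map (algebraMap ℂ R) * M) = Matrix.trace (M * S.map (algebraMap ℂ R)) := by
  simp only [Matrix.trace, Matrix.diag, Matrix.mul_apply, Matrix.map_apply]
  rw [sum_comm]
  exact sum_congr rfl fun i _ => sum_congr rfl fun j _ => Algebra.commutes _ _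

theorem lax_mul_monomial {σ : Type*} (η u v ℓ : ℂ) (k : σ) (i j i' j' : Fin 2) (s : σ →₀ ℕ) :
    (lax η k u ℓ i j * lax η k v ℓ i' j') (monomial s 1) =
      (laxCoeff η u ℓ (laxShift (s k) i' j') i j * laxCoeff η v ℓ (s k) i' j') •
        monomial (s.update k (laxShift (laxShift (s k) i' j') i j)) (1 : ℂ) := by
  classical
  rw [Module.End.mul_apply, lax_monomial, map_smul, lax_monomial, smul_smul, mul_comm]
  have h : ∀ m n, (s.update k m).update k n = s.update k n := by
    intro m n
    ext i
    simp
  simp [h]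

/-- The local exchange relation of the Lax operators with the six-vertex `R`-matrix. -/
theorem sixVertex_mul_lax {σ : Type*} {η : ℂ} (hη : η.re ≠ 0) (u v ℓ : ℂ) (k : σ) :
    (sixVertex (qnum η (u - v + 1)) (qnum η (u - v)) 1).map (algebraMap ℂ _) *
        kronL (lax η k u ℓ) (lax η k v ℓ) =
      kronR (lax η k u ℓ) (lax η k v ℓ) *
        (sixVertex (qnum η (u - v + 1)) (qnum η (u - v)) 1).map (algebraMap ℂ _) := by
  have hc := q_sub_q_inv_ne_zero hη
  set R := sixVertex (qnum η (u - v + 1)) (qnum η (u - v)) 1 with hR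
  have key : ∀ i j s, ∑ m, R i m • (lax η k u ℓ m.1 j.1 * lax η k v ℓ m.2 j.2) (monomial s 1) =
      ∑ m, R m j • (lax η k v ℓ i.2 m.2 * lax η k u ℓ i.1 m.1) (monomial s 1) := by
    intro i j s
    simp only [lax_mul_monomial, Fintype.sum_prod_type, Fin.sum_univ_two]
    obtain ⟨i, i'⟩ := i
    obtain ⟨j, j'⟩ := j
    generalize s k = n
    fin_cases i <;> fin_cases i' <;> fin_cases j <;> fin_cases j' <;>
      simp only [hR, sixVertex, laxCoeff, laxShift, Matrix.of_apply, Matrix.cons_val',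
        Matrix.cons_val_zero, Matrix.cons_val_one, Matrix.cons_val_fin_one, Fin.zero_eta,
        Fin.mk_one, Prod.mk.injEq, Prod.swap_prod_mk, zero_ne_one, one_ne_zero, and_self, and_false,
        false_and, if_true, if_false, zero_smul, add_zero, zero_add, one_smul] <;>
      rcases n with _ | n
    all_goals
      simp only [Nat.cast_zero, qnum_zero, neg_zero, zero_mul, mul_zero, zero_smul, smul_zero,
        Nat.add_sub_cancel, Nat.cast_add, Nat.cast_one, zero_add, Nat.zero_sub]
    all_goals match_scalars
    all_goals
      simp only [qnum, qpow_neg, qpow_add, qpow_sub, qpow_two_mul] at hc ⊢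
      have h1 := qpow_ne_zero η 1
      have h2 := qpow_ne_zero η u
      have h3 := qpow_ne_zero η v
      have h4 := qpow_ne_zero η ℓ
      try have h5 := qpow_ne_zero η n
      field_simp
      try ring
  ext1 i j
  refine (basisMonomials σ ℂ).ext fun s => ?_
  rw [coe_basisMonomials]
  have := key i j s
  simp only [Matrix.mul_apply, Matrix.map_apply, kronL, kronR, Matrix.of_apply, LinearMap.sum_apply]
  refine (sum_congr rfl fun m _ => ?_).trans (this.trans (sum_congr rfl fun m _ => ?_))
  · rw [← Algebra.smul_def, LinearMap.smul_apply]
  · rw [← Algebra.commutes, ← Algebra.smul_def, LinearMap.smul_apply]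

theorem sixVertex_mul_lax_prod {σ : Type*} {η : ℂ} (hη : η.re ≠ 0) (u v ℓ : ℂ) (l : List σ)
    (hl : l.Nodup) :
    (sixVertex (qnum η (u - v + 1)) (qnum η (u - v)) 1).map (algebraMap ℂ _) *
        kronL (l.map fun k => lax η k u ℓ).prod (l.map fun k => lax η k v ℓ).prod =
      kronR (l.map fun k => lax η k u ℓ).prod (l.map fun k => lax η k v ℓ).prod *
        (sixVertex (qnum η (u - v + 1)) (qnum η (u - v)) 1).map (algebraMap ℂ _) := by
  induction l with
  | nil =>
    have h1 : kronL (1 : Matrix (Fin 2) (Fin 2) (Module.End ℂ (MvPolynomial σ ℂ))) 1 = 1 := by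
      ext1 i j
      simp only [kronL, Matrix.of_apply, Matrix.one_apply, Prod.ext_iff]
      split_ifs <;> simp_all
    have h2 : kronR (1 : Matrix (Fin 2) (Fin 2) (Module.End ℂ (MvPolynomial σ ℂ))) 1 = 1 := by
      ext1 i j
      simp only [kronR, Matrix.of_apply, Matrix.one_apply, Prod.ext_iff]
      split_ifs <;> simp_all
    rw [List.map_nil, List.map_nil, List.prod_nil, h1, h2, mul_one, one_mul]
  | cons k l ih =>
    rw [List.nodup_cons] at hl
    simp only [List.map_cons, List.prod_cons]
    rw [← kronL_mul fun i j i' j' => lax_commute_prod η v u ℓ hl.1 i j i' j',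
      ← kronR_mul fun i j i' j' => lax_commute_prod η u v ℓ hl.1 i j i' j', ← mul_assoc,
      sixVertex_mul_lax hη, mul_assoc, ih hl.2, mul_assoc]

/-- Where the six-vertex matrix is invertible, conjugation by it exchanges the two factors under the
trace. -/
theorem tHom_commute_of_generic (N : ℕ) {η : ℂ} (hη : η.re ≠ 0) (ℓ : ℂ) {u v : ℂ}
    (h1 : qnum η (u - v + 1) ≠ 0) (h2 : qnum η (u - v - 1) ≠ 0) :
    tHom N η ℓ u * tHom N η ℓ v = tHom N η ℓ v * tHom N η ℓ u := by
  have key := sixVertex_mul_lax_prod hη u v ℓ (List.finRange N) (List.nodup_finRange N)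
  rw [tHom_eq, tHom_eq]
  set A := ((List.finRange N).map fun k => lax η k u ℓ).prod
  set B := ((List.finRange N).map fun k => lax η k v ℓ).prod
  have hA : Matrix.trace (kronL A B) = (A 0 0 + A 1 1) * (B 0 0 + B 1 1) := by
    simp only [Matrix.trace, Matrix.diag, kronL, Matrix.of_apply, Fintype.sum_prod_type,
      Fin.sum_univ_two]
    noncomm_ring
  have hB : Matrix.trace (kronR A B) = (B 0 0 + B 1 1) * (A 0 0 + A 1 1) := by
    simp only [Matrix.trace, Matrix.diag, kronR, Matrix.of_apply, Fintype.sum_prod_type,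
      Fin.sum_univ_two]
    noncomm_ring
  set a := qnum η (u - v + 1)
  set b := qnum η (u - v)
  -- the determinant of the inner block is `[u - v + 1] [u - v - 1]`
  have hdet : b * b - 1 ≠ 0 := by
    have := qnum_mul_sub η (u - v) (u - v) 1
    rw [sub_self, zero_add, qnum_one hη, mul_one] at this
    have e : b * b - 1 = a * qnum η (u - v - 1) := by linear_combination this
    rw [e]
    exact mul_ne_zero h1 h2
  set S := sixVertex a⁻¹ (b * (b * b - 1)⁻¹) (-(b * b - 1)⁻¹)
  have hSR : S * sixVertex a b 1 = 1 := by
    rw [sixVertex_mul, ← sixVertex_one]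
    congr 1
    · exact inv_mul_cancel₀ h1
    · linear_combination mul_inv_cancel₀ hdet
    · ring
  have hmap : S.map (algebraMap ℂ (Module.End ℂ (MvPolynomial (Fin N) ℂ))) *
      (sixVertex a b 1).map (algebraMap ℂ _) = 1 := by
    rw [← Matrix.map_mul, hSR, Matrix.map_one _ (map_zero _) (map_one _)]
  have hmap' : (sixVertex a b 1).map (algebraMap ℂ (Module.End ℂ (MvPolynomial (Fin N) ℂ))) *
      S.map (algebraMap ℂ _) = 1 := by
    rw [← Matrix.map_mul, mul_eq_one_comm.1 hSR, Matrix.map_one _ (map_zero _) (map_one _)]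
  rw [← hA, ← hB, ← one_mul (kronL A B), ← hmap, mul_assoc, key, trace_scalar_mul_comm, mul_assoc,
    hmap', mul_one]

/-! ### Dependence of the matrix elements on the spectral parameter -/

theorem exists_polynomial_lax {η : ℂ} (hη : η.re ≠ 0) (ℓ : ℂ) (n : ℕ) (i j : Fin 2) :
    ∃ P : Polynomial ℂ, (∀ u, (qpow η 1 - qpow η (-1)) * qpow η (-u) * laxCoeff' η u ℓ n i j =
        P.eval (qpow η (-u))) ∧
      P.coeff 0 = if i = j then qpow η ((if i = 0 then 1 else -1) * (n + ℓ)) else 0 := by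
  have hc := q_sub_q_inv_ne_zero hη
  have hd : ∀ x u, (qpow η 1 - qpow η (-1)) * qpow η (-u) * qnum η (u + x) =
      (Polynomial.C (qpow η x) - Polynomial.C (qpow η (-x)) * Polynomial.X ^ 2).eval
        (qpow η (-u)) := by
    intro x u
    simp only [Polynomial.eval_sub, Polynomial.eval_mul, Polynomial.eval_C, Polynomial.eval_pow,
      Polynomial.eval_X, qnum]
    rw [mul_right_comm, mul_div_cancel₀ _ hc, sub_mul, ← qpow_add, ← qpow_add, ← qpow_two_mul,
      ← qpow_add]
    congr 2 <;> ring
  have ho : ∀ x u, (qpow η 1 - qpow η (-1)) * qpow η (-u) * x =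
      (Polynomial.C ((qpow η 1 - qpow η (-1)) * x) * Polynomial.X).eval (qpow η (-u)) := by
    intro x u
    simp only [Polynomial.eval_mul, Polynomial.eval_C, Polynomial.eval_X]
    ring
  fin_cases i <;> fin_cases j <;>
  simp only [laxCoeff', Fin.zero_eta, Fin.mk_one, Matrix.of_apply, Matrix.cons_val',
    Matrix.cons_val_zero, Matrix.cons_val_one, Matrix.cons_val_fin_one, if_true, one_ne_zero,
    zero_ne_one, if_false, one_mul, neg_one_mul]
  · exact ⟨_, fun u => hd _ u, by simp⟩
  · exact ⟨_, fun u => ho _ u, by simp⟩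
  · exact ⟨_, fun u => ho _ u, by simp⟩
  · have h := hd (-(n + ℓ))
    simp only [← sub_eq_add_neg] at h
    exact ⟨_, h, by simp⟩

/-- The matrix elements of products of Lax operators are, up to a power of `Y = q ^ (-u)`,
polynomials in `Y`; only the diagonal entries have a constant term. -/
theorem exists_polynomial_lax_prod {σ : Type*} {η : ℂ} (hη : η.re ≠ 0) (ℓ : ℂ) (l : List σ)
    (p : MvPolynomial σ ℂ) (b : σ →₀ ℕ) (i j : Fin 2) :
    ∃ P : Polynomial ℂ, (∀ u, ((qpow η 1 - qpow η (-1)) * qpow η (-u)) ^ l.length *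
        coeff b ((l.map fun k => lax η k u ℓ).prod i j p) = P.eval (qpow η (-u))) ∧
      P.coeff 0 = if i = j then
        qpow η ((if i = 0 then 1 else -1) * (l.map fun k => (b k + ℓ : ℂ)).sum) * coeff b p
        else 0 := by
  induction l generalizing b i j with
  | nil =>
    rcases eq_or_ne i j with rfl | hij
    · exact ⟨Polynomial.C (coeff b p), fun u => by simp, by simp [qpow_zero]⟩
    · exact ⟨0, fun u => by simp [Matrix.one_apply_ne hij], by simp [hij]⟩
  | cons k l ih =>
    choose A hA hA0 using fun m => exists_polynomial_lax hη ℓ (b k) i m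
    choose B hB hB0 using fun m => ih (b.update k (laxShift' (b k) i m)) m j
    refine ⟨∑ m, A m * B m, fun u => ?_, ?_⟩
    · simp only [List.map_cons, List.prod_cons, Matrix.mul_apply, LinearMap.sum_apply,
        Module.End.mul_apply, coeff_sum, coeff_lax, Polynomial.eval_finsetSum,
        Polynomial.eval_mul, ← hA, ← hB, List.length_cons, pow_succ, mul_sum]
      exact sum_congr rfl fun m _ => by ring
    · have h1 : b.update k (laxShift' (b k) i i) = b := by
        have : laxShift' (b k) i i = b k := by fin_cases i <;> rfl
        rw [this, Finsupp.update_self]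
      rw [Polynomial.finsetSum_coeff, sum_eq_single i]
      · rw [Polynomial.mul_coeff_zero, hA0, if_pos rfl, hB0, h1, List.map_cons, List.sum_cons,
          mul_add _ (b k + ℓ : ℂ), qpow_add, mul_ite, mul_zero]
        simp only [mul_assoc]
      · intro m _ hm
        rw [Polynomial.mul_coeff_zero, hA0, if_neg hm.symm, zero_mul]
      · intro h
        exact absurd (mem_univ i) h

/-- At `Y = 0` the rescaled transfer matrix acts on polynomials of degree `M` as the scalar `S + S⁻¹`
with `S = q ^ (N ℓ + M)`. -/
theorem exists_polynomial_tHom (N : ℕ) {η : ℂ} (hη : η.re ≠ 0) (ℓ : ℂ)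
    (p : MvPolynomial (Fin N) ℂ) (b : Fin N →₀ ℕ) :
    ∃ P : Polynomial ℂ, (∀ u, ((qpow η 1 - qpow η (-1)) * qpow η (-u)) ^ N *
        coeff b (tHom N η ℓ u p) = P.eval (qpow η (-u))) ∧
      P.coeff 0 = (qpow η (N * ℓ + b.degree) + qpow η (-(N * ℓ + b.degree))) * coeff b p := by
  obtain ⟨A, hA, hA0⟩ := exists_polynomial_lax_prod hη ℓ (List.finRange N) p b 0 0
  obtain ⟨B, hB, hB0⟩ := exists_polynomial_lax_prod hη ℓ (List.finRange N) p b 1 1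
  have hs : ((List.finRange N).map fun k => (b k + ℓ : ℂ)).sum = N * ℓ + b.degree := by
    rw [← List.ofFn_eq_map, List.sum_ofFn, sum_add_distrib, sum_const, card_univ, Fintype.card_fin,
      nsmul_eq_mul, Finsupp.degree_eq_sum, Nat.cast_sum, add_comm]
  rw [List.length_finRange] at hA hB
  refine ⟨A + B, fun u => ?_, ?_⟩
  · rw [tHom_eq, LinearMap.add_apply, coeff_add, mul_add, hA, hB, Polynomial.eval_add]
  · rw [Polynomial.coeff_add, hA0, hB0, hs]
    simp only [if_true, one_ne_zero, if_false, one_mul, neg_one_mul]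
    ring

/-- `g` is a Laurent polynomial in `Y = q ^ (-u)`. -/
def IsLaurent (η : ℂ) (g : ℂ → ℂ) : Prop :=
  ∃ (K : ℕ) (P : Polynomial ℂ), ∀ u, qpow η (-u) ^ K * g u = P.eval (qpow η (-u))

theorem IsLaurent.const (η c : ℂ) : IsLaurent η fun _ => c :=
  ⟨0, Polynomial.C c, fun u => by simp⟩

theorem IsLaurent.mul {η : ℂ} {f g : ℂ → ℂ} (hf : IsLaurent η f) (hg : IsLaurent η g) :
    IsLaurent η fun u => f u * g u := by
  obtain ⟨K, P, hP⟩ := hf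
  obtain ⟨L, Q, hQ⟩ := hg
  refine ⟨K + L, P * Q, fun u => ?_⟩
  rw [Polynomial.eval_mul, ← hP, ← hQ]
  ring

theorem IsLaurent.add {η : ℂ} {f g : ℂ → ℂ} (hf : IsLaurent η f) (hg : IsLaurent η g) :
    IsLaurent η fun u => f u + g u := by
  obtain ⟨K, P, hP⟩ := hf
  obtain ⟨L, Q, hQ⟩ := hg
  refine ⟨K + L, Polynomial.X ^ L * P + Polynomial.X ^ K * Q, fun u => ?_⟩
  simp only [Polynomial.eval_add, Polynomial.eval_mul, Polynomial.eval_pow, Polynomial.eval_X,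
    ← hP, ← hQ]
  ring

theorem IsLaurent.sum {ι : Type*} {η : ℂ} {f : ι → ℂ → ℂ} {s : Finset ι}
    (h : ∀ i ∈ s, IsLaurent η (f i)) : IsLaurent η fun u => ∑ i ∈ s, f i u := by
  classical
  induction s using Finset.induction_on with
  | empty => simpa using IsLaurent.const η 0
  | insert i s hi ih =>
    simp only [sum_insert hi]
    exact (h i (mem_insert_self i s)).add (ih fun j hj => h j (mem_insert_of_mem hj))

theorem IsLaurent.prod {ι : Type*} {η : ℂ} {f : ι → ℂ → ℂ} {s : Finset ι}
    (h : ∀ i ∈ s, IsLaurent η (f i)) : IsLaurent η fun u => ∏ i ∈ s, f i u := by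
  classical
  induction s using Finset.induction_on with
  | empty => simpa using IsLaurent.const η 1
  | insert i s hi ih =>
    simp only [prod_insert hi]
    exact (h i (mem_insert_self i s)).mul (ih fun j hj => h j (mem_insert_of_mem hj))

theorem IsLaurent.eq_zero {η : ℂ} {g : ℂ → ℂ} (hg : IsLaurent η g) {S : Set ℂ}
    (hS : ((fun u => qpow η (-u)) '' S).Infinite) (h : ∀ u ∈ S, g u = 0) (u : ℂ) : g u = 0 := by
  obtain ⟨K, P, hP⟩ := hg
  have hP0 : P = 0 := by
    refine Polynomial.eq_zero_of_infinite_isRoot P (hS.mono ?_)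
    rintro _ ⟨v, hv, rfl⟩
    rw [Set.mem_ofPred_eq, Polynomial.IsRoot, ← hP, h v hv, mul_zero]
  have := hP u
  rw [hP0, Polynomial.eval_zero] at this
  exact (mul_eq_zero.1 this).resolve_left (pow_ne_zero _ (qpow_ne_zero _ _))

theorem isLaurent_qnum {η : ℂ} (x s : ℂ) (hs : s = 1 ∨ s = -1) :
    IsLaurent η fun u => qnum η (s * u + x) := by
  have h : ∀ x u, qpow η (-u) ^ 1 * qnum η (u + x) =
      (Polynomial.C (qpow η x / (qpow η 1 - qpow η (-1))) -
        Polynomial.C (qpow η (-x) / (qpow η 1 - qpow η (-1))) * Polynomial.X ^ 2).eval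
        (qpow η (-u)) := by
    intro x u
    simp only [Polynomial.eval_sub, Polynomial.eval_mul, Polynomial.eval_C, Polynomial.eval_pow,
      Polynomial.eval_X, qnum, pow_one]
    rw [mul_div_assoc', div_mul_eq_mul_div, ← sub_div, mul_sub, ← qpow_add, ← qpow_add,
      ← qpow_two_mul, ← qpow_add]
    congr 3 <;> ring
  rcases hs with rfl | rfl
  · simp only [one_mul]
    exact ⟨1, _, fun u => h x u⟩
  · have e : ∀ u, qnum η (-1 * u + x) = (-1) * qnum η (u + -x) := fun u => by
      rw [neg_one_mul, neg_one_mul, ← qnum_neg]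
      congr 1
      ring
    simp only [e]
    exact (IsLaurent.const η (-1)).mul ⟨1, _, fun u => h (-x) u⟩

theorem isLaurent_tHom (N : ℕ) {η : ℂ} (hη : η.re ≠ 0) (ℓ : ℂ) (p : MvPolynomial (Fin N) ℂ)
    (b : Fin N →₀ ℕ) : IsLaurent η fun u => coeff b (tHom N η ℓ u p) := by
  obtain ⟨P, hP, -⟩ := exists_polynomial_tHom N hη ℓ p b
  refine ⟨N, Polynomial.C (((qpow η 1 - qpow η (-1)) ^ N)⁻¹) * P, fun u => ?_⟩
  have := pow_ne_zero N (q_sub_q_inv_ne_zero hη)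
  rw [Polynomial.eval_mul, Polynomial.eval_C, ← hP, mul_pow]
  field_simp

/-! ### Degree conservation and polynomial dependence on the spectral parameter -/

/-- `T` maps monomials to homogeneous polynomials of the same degree. -/
def PreservesDegree (T : Module.End ℂ (MvPolynomial (Fin N) ℂ)) : Prop :=
  ∀ b a : Fin N →₀ ℕ, coeff b (T (monomial a 1)) ≠ 0 → b.degree = a.degree

theorem mem_finsuppAntidiag_iff_degree {b : Fin N →₀ ℕ} {n : ℕ} :
    b ∈ finsuppAntidiag univ n ↔ b.degree = n := by
  simp [mem_finsuppAntidiag, Finsupp.degree_eq_sum]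

theorem PreservesDegree.eq_sum {T : Module.End ℂ (MvPolynomial (Fin N) ℂ)}
    (hT : PreservesDegree T) (a : Fin N →₀ ℕ) : T (monomial a 1) =
      ∑ b ∈ finsuppAntidiag univ a.degree, coeff b (T (monomial a 1)) • monomial b 1 := by
  ext b
  simp only [coeff_sum, coeff_smul, coeff_monomial, smul_eq_mul, mul_ite, mul_one, mul_zero,
    sum_ite_eq']
  split_ifs with hb
  · rfl
  · by_contra h
    exact hb (mem_finsuppAntidiag_iff_degree.2 (hT b a h))

theorem HasPathSum.preservesDegree {κ : ℕ → ℕ → ℕ → ℂ} (hκ : Balanced κ)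
    {T : Module.End ℂ (MvPolynomial (Fin N) ℂ)} (h : HasPathSum κ T) : PreservesDegree T := by
  intro b a hne
  by_contra hd
  refine hne ((h b a).unique ?_)
  simp only [funext (pathTerm_eq_zero hκ hd)]
  exact hasSum_zero

theorem HasPathSum.unique {κ : ℕ → ℕ → ℕ → ℂ} {S T : Module.End ℂ (MvPolynomial (Fin N) ℂ)}
    (hS : HasPathSum κ S) (hT : HasPathSum κ T) : S = T :=
  ext_coeff_monomial fun b a => (hS b a).unique (hT b a)

theorem degree_update (b : Fin N →₀ ℕ) (k : Fin N) (n : ℕ) :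
    (b.update k n).degree + b k = b.degree + n := by
  have h : ∀ n, (b.update k n).degree = (b.erase k).degree + n := fun n => by
    rw [Finsupp.update_eq_erase_add_single, map_add, Finsupp.degree_single]
  have h' := h (b k)
  rw [Finsupp.update_self] at h'
  rw [h, h']
  ring

/-- The entries of the monodromy matrix change the degree by the difference of their indices. -/
theorem degree_of_coeff_lax_prod (η u ℓ : ℂ) (l : List (Fin N)) (b a : Fin N →₀ ℕ) (i j : Fin 2)
    (h : coeff b ((l.map fun k => lax η k u ℓ).prod i j (monomial a 1)) ≠ 0) :
    b.degree + (j : ℕ) = a.degree + (i : ℕ) := by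
  induction l generalizing b i with
  | nil =>
    rcases eq_or_ne i j with rfl | hij
    · rw [List.map_nil, List.prod_nil, Matrix.one_apply_eq, Module.End.one_apply,
        coeff_monomial] at h
      split_ifs at h with hab
      · rw [hab]
      · exact absurd rfl h
    · simp [Matrix.one_apply_ne hij] at h
  | cons k l ih =>
    simp only [List.map_cons, List.prod_cons, Matrix.mul_apply, LinearMap.sum_apply,
      Module.End.mul_apply, coeff_sum, coeff_lax] at h
    obtain ⟨m, -, hm⟩ := exists_ne_zero_of_sum_ne_zero h
    have h1 := ih _ _ (right_ne_zero_of_mul hm)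
    have h2 := left_ne_zero_of_mul hm
    have h3 := degree_update b k (laxShift' (b k) i m)
    fin_cases i <;> fin_cases m <;>
    simp only [laxShift', laxCoeff', Fin.zero_eta, Fin.mk_one, Matrix.of_apply, Matrix.cons_val',
      Matrix.cons_val_zero, Matrix.cons_val_one, Matrix.cons_val_fin_one] at h1 h2 h3 ⊢
    · omega
    · omega
    · have : b k ≠ 0 := fun h0 => h2 (if_pos h0)
      omega
    · omega

theorem preservesDegree_tHom (N : ℕ) (η ℓ u : ℂ) : PreservesDegree (tHom N η ℓ u) := by
  intro b a h
  rw [tHom_eq, LinearMap.add_apply, coeff_add] at h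
  by_cases h0 : coeff b (((List.finRange N).map fun k => lax η k u ℓ).prod 0 0 (monomial a 1)) = 0
  · rw [h0, zero_add] at h
    have := degree_of_coeff_lax_prod η u ℓ _ b a 1 1 h
    omega
  · have := degree_of_coeff_lax_prod η u ℓ _ b a 0 0 h0
    omega

/-- A family of operators that is Laurent polynomial in `q ^ (-u)` commutes with `B` for all `u` as
soon as it does so for infinitely many values of `q ^ (-u)`. -/
theorem commute_of_isLaurent {η : ℂ} {T : ℂ → Module.End ℂ (MvPolynomial (Fin N) ℂ)}
    (hT : ∀ u, PreservesDegree (T u))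
    (hL : ∀ b a, IsLaurent η fun u => coeff b (T u (monomial a 1)))
    {B : Module.End ℂ (MvPolynomial (Fin N) ℂ)} {S : Set ℂ}
    (hS : ((fun u => qpow η (-u)) '' S).Infinite) (h : ∀ u ∈ S, Commute (T u) B) (u : ℂ) :
    Commute (T u) B := by
  refine ext_coeff_monomial fun b a => ?_
  have h1 : ∀ p, IsLaurent η fun u => coeff b (T u p) := by
    intro p
    rw [p.as_sum]
    simp only [map_sum, coeff_sum]
    refine IsLaurent.sum fun c _ => ?_
    have e : ∀ u, coeff b (T u (monomial c (coeff c p))) =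
        coeff c p * coeff b (T u (monomial c 1)) := fun u => by
      rw [← mul_one (coeff c p), ← smul_eq_mul, ← smul_monomial, map_smul, coeff_smul, smul_eq_mul,
        smul_eq_mul, mul_one]
    simp only [e]
    exact (IsLaurent.const η _).mul (hL b c)
  have h2 : IsLaurent η fun u => coeff b (B (T u (monomial a 1))) := by
    have e : ∀ u, coeff b (B (T u (monomial a 1))) =
        ∑ c ∈ finsuppAntidiag univ a.degree,
          coeff c (T u (monomial a 1)) * coeff b (B (monomial c 1)) := fun u => by
      conv_lhs => rw [(hT u).eq_sum a]
      simp only [map_sum, map_smul, coeff_sum, coeff_smul, smul_eq_mul]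
    simp only [e]
    exact IsLaurent.sum fun c _ => (hL c a).mul (IsLaurent.const η _)
  have h3 := ((h1 (B (monomial a 1))).add ((IsLaurent.const η (-1)).mul h2)).eq_zero hS
    (fun v hv => by
      have := congrArg (coeff b) (LinearMap.congr_fun (h v hv).eq (monomial a 1))
      rw [Module.End.mul_apply, Module.End.mul_apply] at this
      simp only [this]
      ring) u
  rw [Module.End.mul_apply, Module.End.mul_apply]
  linear_combination h3

theorem infinite_qpow_image {η : ℂ} (hη : η.re ≠ 0) (c : ℂ) :
    ((fun u => qpow η (-u)) '' Set.range fun n : ℕ => c + n).Infinite := by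
  rw [← Set.range_comp]
  refine Set.infinite_range_of_injective fun m n h => ?_
  have h1 := congrArg norm h
  simp only [Function.comp_apply, norm_qpow] at h1
  have h2 := Real.exp_injective h1
  simp only [mul_neg, Complex.neg_re, mul_add, Complex.add_re, neg_inj, add_right_inj,
    Complex.mul_re, Complex.natCast_re, Complex.natCast_im, mul_zero, sub_zero] at h2
  exact_mod_cast mul_left_cancel₀ hη h2

/-- The transfer matrices commute. -/
theorem tHom_commute (N : ℕ) {η : ℂ} (hη : η.re ≠ 0) (ℓ u v : ℂ) :
    Commute (tHom N η ℓ u) (tHom N η ℓ v) := by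
  refine commute_of_isLaurent (preservesDegree_tHom N η ℓ)
    (fun b a => isLaurent_tHom N hη ℓ (monomial a 1) b) (infinite_qpow_image hη (v + 2)) ?_ u
  rintro _ ⟨n, rfl⟩
  refine tHom_commute_of_generic N hη ℓ ?_ ?_
  · rw [show v + 2 + (n : ℂ) - v + 1 = ((n + 2 : ℕ) : ℂ) + 1 by push_cast; ring]
    exact qnum_natCast_succ_ne_zero hη _
  · rw [show v + 2 + (n : ℂ) - v - 1 = (n : ℂ) + 1 by ring]
    exact qnum_natCast_succ_ne_zero hη _

/-! ### The cyclic shift -/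

/-- The cyclic shift of the chain: the exponent of `z_{k + 1}` becomes that of `z_k`. -/
def rotOp (N : ℕ) : Module.End ℂ (MvPolynomial (Fin N) ℂ) :=
  (rename (finRotate N).symm : MvPolynomial (Fin N) ℂ →ₐ[ℂ] MvPolynomial (Fin N) ℂ).toLinearMap

theorem mapDomain_update {σ τ : Type*} (e : σ ≃ τ) (s : σ →₀ ℕ) (k : σ) (n : ℕ) :
    (s.update k n).mapDomain e = (s.mapDomain e).update (e k) n := by
  classical
  ext i
  rw [← Finsupp.equivMapDomain_eq_mapDomain, ← Finsupp.equivMapDomain_eq_mapDomain,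
    Finsupp.equivMapDomain_apply, Finsupp.coe_update, Finsupp.coe_update, Function.update_apply,
    Function.update_apply, Finsupp.equivMapDomain_apply]
  simp only [Equiv.symm_apply_eq]

theorem rename_mul_lax {σ τ : Type*} (η u ℓ : ℂ) (e : σ ≃ τ) (k : σ) (i j : Fin 2)
    (p : MvPolynomial σ ℂ) :
    rename e (lax η k u ℓ i j p) = lax η (e k) u ℓ i j (rename e p) := by
  refine LinearMap.congr_fun (f := (rename e : _ →ₐ[ℂ] _).toLinearMap ∘ₗ lax η k u ℓ i j)
    (g := lax η (e k) u ℓ i j ∘ₗ (rename e : _ →ₐ[ℂ] _).toLinearMap)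
    ((basisMonomials σ ℂ).ext fun s => ?_) p
  have h : s.mapDomain e (e k) = s k := Finsupp.mapDomain_apply e.injective _ _
  rw [coe_basisMonomials, LinearMap.comp_apply, LinearMap.comp_apply, AlgHom.toLinearMap_apply,
    AlgHom.toLinearMap_apply, rename_monomial, lax_monomial, lax_monomial, map_smul,
    rename_monomial, mapDomain_update, h]

theorem rename_mul_lax_prod {σ τ : Type*} (η u ℓ : ℂ) (e : σ ≃ τ) (l : List σ) (i j : Fin 2)
    (p : MvPolynomial σ ℂ) :
    rename e ((l.map fun k => lax η k u ℓ).prod i j p) =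
      ((l.map e).map fun k => lax η k u ℓ).prod i j (rename e p) := by
  induction l generalizing i j with
  | nil =>
    rcases eq_or_ne i j with rfl | hij
    · simp
    · simp [Matrix.one_apply_ne hij]
  | cons k l ih =>
    simp only [List.map_cons, List.prod_cons, Matrix.mul_apply, LinearMap.sum_apply,
      Module.End.mul_apply, map_sum, rename_mul_lax, ih]

/-- The transfer matrix of the homogeneous chain is invariant under the cyclic shift. -/
theorem tHom_commute_rotOp (hN : 0 < N) (η ℓ u : ℂ) :
    Commute (tHom N η ℓ u) (rotOp N) := by
  obtain ⟨N, rfl⟩ := Nat.exists_eq_succ_of_ne_zero hN.ne'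
  refine LinearMap.ext fun p => ?_
  have h1 : (List.finRange (N + 1)).map (finRotate (N + 1)).symm =
      Fin.last N :: (List.finRange N).map Fin.castSucc := by
    rw [List.finRange_succ, List.map_cons, List.map_map]
    congr 1
    refine List.map_congr_left fun k _ => ?_
    rw [Function.comp_apply, Equiv.symm_apply_eq, finRotate_apply, Fin.coeSucc_eq_succ]
  have hlast : Fin.last N ∉ (List.finRange N).map Fin.castSucc := by
    simp
  rw [Module.End.mul_apply, Module.End.mul_apply, rotOp, AlgHom.toLinearMap_apply,
    AlgHom.toLinearMap_apply, tHom_eq, LinearMap.add_apply, LinearMap.add_apply, map_add,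
    rename_mul_lax_prod, rename_mul_lax_prod, h1, List.finRange_succ_last]
  simp only [List.map_append, List.prod_append, List.map_cons, List.prod_cons, List.map_nil,
    List.prod_nil, mul_one, Matrix.mul_apply, Fin.sum_univ_two]
  have hcomm := fun i j i' j' => lax_commute_prod η u u ℓ hlast i j i' j'
  rw [(hcomm 0 0 0 0).eq, (hcomm 0 1 1 0).eq, (hcomm 1 0 0 1).eq, (hcomm 1 1 1 1).eq]
  simp only [LinearMap.add_apply]
  abel

theorem pathProd_shift {ι : Type*} {κ : ℕ → ℕ → ℕ → ℂ}
    (hκ : ∀ b a m, κ b a m = if b = m then 1 else 0) (l : List ι) (b a : ι → ℕ) (m : ℕ) {c : ℕ}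
    {t : List ℕ} (h : l.map a ++ [m] = c :: t) :
    pathProd κ l b a (Finsupp.single m 1) = if t = l.map b then Finsupp.single c 1 else 0 := by
  induction l generalizing c t with
  | nil =>
    obtain ⟨rfl, rfl⟩ : m = c ∧ [] = t := by simpa using h
    simp [pathProd]
  | cons k l ih =>
    have h1 : pathProd κ (k :: l) b a = hop κ (b k) (a k) * pathProd κ l b a := rfl
    obtain ⟨rfl, rfl⟩ : a k = c ∧ l.map a ++ [m] = t := by simpa using h
    obtain ⟨c, t, h2⟩ : ∃ c t, l.map a ++ [m] = c :: t := by cases l <;> simp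
    rw [h1, Module.End.mul_apply, ih h2, List.map_cons, h2]
    simp only [List.cons.injEq]
    by_cases ht : t = l.map b
    · rw [if_pos ht, hop_single, hκ]
      by_cases hc : b k = c
      · rw [if_pos hc, if_pos ⟨hc.symm, ht⟩, one_smul, hc, Nat.add_sub_cancel]
      · rw [if_neg hc, if_neg (fun h => hc h.1.symm), zero_smul]
    · rw [if_neg ht, if_neg (fun h => ht h.2), map_zero]

/-- Weights that exchange the site with the auxiliary space give the cyclic shift. -/
theorem hasPathSum_rotOp (hN : 0 < N) {κ : ℕ → ℕ → ℕ → ℂ}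
    (hκ : ∀ b a m, κ b a m = if b = m then 1 else 0) : HasPathSum κ (rotOp N) := by
  obtain ⟨N, rfl⟩ := Nat.exists_eq_succ_of_ne_zero hN.ne'
  intro b a
  have hrot : (a.mapDomain (finRotate (N + 1)).symm = b) ↔
      ∀ k, b k = a (finRotate (N + 1) k) := by
    rw [← Finsupp.equivMapDomain_eq_mapDomain, Finsupp.ext_iff]
    simp only [Finsupp.equivMapDomain_apply, Equiv.symm_symm]
    exact forall_congr' fun k => eq_comm
  have hterm : ∀ m, pathTerm κ b a m =
      if m = a 0 then coeff b (rotOp (N + 1) (monomial a 1)) else 0 := by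
    intro m
    have h1 : (List.finRange (N + 1)).map a ++ [m] =
        a 0 :: ((List.finRange N).map (fun k => a k.succ) ++ [m]) := by
      rw [List.finRange_succ, List.map_cons, List.map_map]
      rfl
    have h2 : (List.finRange (N + 1)).map b =
        ((List.finRange N).map fun k => b k.castSucc) ++ [b (Fin.last N)] := by
      rw [List.finRange_succ_last, List.map_append, List.map_map]
      rfl
    have h3 : ((List.finRange N).map (fun k => a k.succ) ++ [m] =
        (List.finRange N).map (fun k => b k.castSucc) ++ [b (Fin.last N)]) ↔
        (∀ k : Fin N, b k.castSucc = a k.succ) ∧ b (Fin.last N) = m := by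
      constructor
      · intro h
        obtain ⟨h4, h5⟩ := List.append_inj h (by simp)
        exact ⟨fun k => (List.map_inj_left.1 h4 k (List.mem_finRange k)).symm,
          (List.singleton_inj.1 h5).symm⟩
      · rintro ⟨h4, h5⟩
        rw [h5]
        congr 1
        exact List.map_congr_left fun k _ => (h4 k).symm
    have h4 : (∀ k, b k = a (finRotate (N + 1) k)) ↔
        (∀ k : Fin N, b k.castSucc = a k.succ) ∧ b (Fin.last N) = a 0 := by
      rw [Fin.forall_fin_succ']
      simp only [finRotate_apply, Fin.coeSucc_eq_succ, Fin.last_add_one]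
    rw [pathTerm, pathProd_shift hκ _ _ _ _ h1, rotOp, AlgHom.toLinearMap_apply, rename_monomial,
      coeff_monomial, h2]
    simp only [h3, hrot, h4]
    by_cases hm : m = a 0
    · subst hm
      simp only [if_true]
      split_ifs <;> simp
    · rw [if_neg hm]
      split_ifs
      · rw [Finsupp.single_apply, if_neg (Ne.symm hm)]
      · rfl
  have := hasSum_single (f := pathTerm κ b a) (a 0) fun m hm => by rw [hterm, if_neg hm]
  rwa [hterm, if_pos rfl] at this

/-! ### Operators commuting with `Q₋` -/

theorem kappaMinus_self {η : ℂ} (hη : η.re ≠ 0) {x : ℂ} (hx : ∀ n : ℕ, qpow η (2 * (x + n)) ≠ 1)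
    (b a m : ℕ) : kappaMinus η x x b a m = if b = m then 1 else 0 := by
  rw [kappaMinus, sub_self, riseBin_zero_left]
  by_cases h : b = m
  · subst h
    rw [if_pos ⟨le_rfl, by omega⟩, Nat.sub_self, if_pos rfl, if_pos rfl, mul_one,
      Nat.add_sub_cancel, div_self (riseBin_ne_zero hη hx a)]
  · rw [if_neg h]
    split_ifs
    · omega
    · simp
    · rfl

theorem kappaPlus_self {η : ℂ} (hη : η.re ≠ 0) {x : ℂ} (hx : ∀ n : ℕ, qpow η (2 * (x + n)) ≠ 1)
    (b a m : ℕ) : kappaPlus η x x b a m = if b = m then 1 else 0 := by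
  rw [kappaPlus, sub_self, riseBin_zero_left]
  by_cases h : b = m
  · subst h
    rw [if_pos le_rfl, Nat.sub_self, if_pos rfl, if_pos rfl, mul_one,
      div_self (riseBin_ne_zero hη hx b)]
  · rw [if_neg h]
    split_ifs
    · omega
    · simp
    · rfl

theorem isLaurent_riseBin (η x s : ℂ) (hs : s = 1 ∨ s = -1) (n : ℕ) :
    IsLaurent η fun u => riseBin η (s * u + x) n := by
  simp only [riseBin, div_eq_mul_inv, add_assoc]
  exact IsLaurent.prod fun i _ => (isLaurent_qnum _ s hs).mul (IsLaurent.const η _)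

theorem isLaurent_kappaMinus (η ℓ : ℂ) (b a m : ℕ) :
    IsLaurent η fun u => kappaMinus η (u + ℓ) (2 * ℓ) b a m := by
  simp only [kappaMinus]
  split_ifs
  · have e : ∀ u, 2 * ℓ - (u + ℓ) = -1 * u + ℓ := fun u => by ring
    simp only [e, div_eq_mul_inv]
    have := isLaurent_riseBin η ℓ 1 (Or.inl rfl) (a + m - b)
    simp only [one_mul] at this
    exact (this.mul (isLaurent_riseBin η ℓ (-1) (Or.inr rfl) _)).mul (IsLaurent.const η _)
  · exact IsLaurent.const η 0

theorem isLaurent_pathProd {ι : Type*} {η : ℂ} {κ : ℂ → ℕ → ℕ → ℕ → ℂ}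
    (hκ : ∀ b a m, IsLaurent η fun u => κ u b a m) (l : List ι) (b a : ι → ℕ) (m n : ℕ) :
    IsLaurent η fun u => pathProd (κ u) l b a (Finsupp.single m 1) n := by
  induction l using List.reverseRecOn generalizing m with
  | nil => exact IsLaurent.const η _
  | append_singleton l k ih =>
    simp only [pathProd_snoc, Finsupp.smul_apply, smul_eq_mul]
    exact (hκ _ _ _).mul (ih _)

theorem isLaurent_Qminus (hN : 0 < N) {η : ℂ} (hη : η.re ≠ 0) {ℓ : ℂ}
    (hℓ : ∀ n : ℕ, qpow η (2 * (2 * ℓ + n)) ≠ 1) (b a : Fin N →₀ ℕ) :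
    IsLaurent η fun u => coeff b (Qminus N η ℓ u (monomial a 1)) := by
  obtain ⟨N, rfl⟩ := Nat.exists_eq_succ_of_ne_zero hN.ne'
  have e : ∀ u, coeff b (Qminus (N + 1) η ℓ u (monomial a 1)) =
      ∑ m ∈ range (b (Fin.last N) + 1), pathTerm (kappaMinus η (u + ℓ) (2 * ℓ)) b a m := fun u =>
    ((isAuxTrace_Qminus hN hη hℓ u).2 b a).unique <| hasSum_sum_of_ne_finset_zero fun m hm =>
      pathTerm_kappaMinus_eq_zero _ _ _ b a (by rw [mem_range] at hm; omega)
  simp only [e]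
  exact IsLaurent.sum fun m _ => isLaurent_pathProd (isLaurent_kappaMinus η ℓ) _ _ _ _ _

theorem preservesDegree_Qminus (hN : 0 < N) {η : ℂ} (hη : η.re ≠ 0) {ℓ : ℂ}
    (hℓ : ∀ n : ℕ, qpow η (2 * (2 * ℓ + n)) ≠ 1) (u : ℂ) : PreservesDegree (Qminus N η ℓ u) :=
  (isAuxTrace_Qminus hN hη hℓ u).2.preservesDegree (balanced_kappaMinus _ _ _)

/-- At `u = ℓ` the two parameters of the weights agree, and every site exchanges its exponent with the
auxiliary space. -/
theorem Qminus_eq_rotOp (hN : 0 < N) {η : ℂ} (hη : η.re ≠ 0) {ℓ : ℂ}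
    (hℓ : ∀ n : ℕ, qpow η (2 * (2 * ℓ + n)) ≠ 1) : Qminus N η ℓ ℓ = rotOp N := by
  refine (isAuxTrace_Qminus hN hη hℓ ℓ).2.unique (hasPathSum_rotOp hN ?_)
  rw [← two_mul]
  exact kappaMinus_self hη hℓ

/-- The Baxter equation determines `Q₋(ℓ + n)` from `Q₋(ℓ)`, which is the cyclic shift, because the
coefficient `Δ₋(ℓ)` vanishes. -/
theorem Qminus_commute (hN : 0 < N) {η : ℂ} (hη : η.re ≠ 0) {ℓ : ℂ}
    (hℓ : ∀ n : ℕ, qpow η (2 * (2 * ℓ + n)) ≠ 1) {B : Module.End ℂ (MvPolynomial (Fin N) ℂ)}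
    (ht : ∀ v, Commute (tHom N η ℓ v) B) (hU : Commute (rotOp N) B) (u : ℂ) :
    Commute (Qminus N η ℓ u) B := by
  refine commute_of_isLaurent (preservesDegree_Qminus hN hη hℓ) (isLaurent_Qminus hN hη hℓ)
    (infinite_qpow_image hη ℓ) ?_ u
  rintro _ ⟨n, rfl⟩
  have hstep : ∀ n : ℕ, Commute (Qminus N η ℓ (ℓ + n)) B →
      Commute (qnum η n ^ N • Qminus N η ℓ (ℓ + n - 1)) B →
      Commute (Qminus N η ℓ (ℓ + n + 1)) B := by
    intro n h1 h2
    have hTQ := Qminus_mul_tHom hN hη hℓ (ℓ + n)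
    rw [add_sub_cancel_left] at hTQ
    have h3 := ((h1.mul_left (ht (ℓ + n))).sub_left h2)
    rw [hTQ, add_sub_cancel_right] at h3
    have hne : qnum η (ℓ + n + ℓ) ^ N ≠ 0 := pow_ne_zero _ fun h0 => hℓ n <| by
      rw [qnum_eq_zero_iff hη] at h0
      rw [← h0]
      congr 1
      ring
    have h4 := h3.smul_left (qnum η (ℓ + n + ℓ) ^ N)⁻¹
    rwa [smul_smul, inv_mul_cancel₀ hne, one_smul] at h4
  have key : ∀ n : ℕ, Commute (Qminus N η ℓ (ℓ + n)) B ∧ Commute (Qminus N η ℓ (ℓ + n + 1)) B := by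
    intro n
    induction n with
    | zero =>
      have h0 : Commute (Qminus N η ℓ (ℓ + (0 : ℕ))) B := by
        rw [Nat.cast_zero, add_zero, Qminus_eq_rotOp hN hη hℓ]
        exact hU
      refine ⟨h0, hstep 0 h0 ?_⟩
      rw [Nat.cast_zero, qnum_zero, zero_pow hN.ne', zero_smul]
      exact Commute.zero_left _
    | succ n ih =>
      have h1 : Commute (Qminus N η ℓ (ℓ + (n + 1 : ℕ))) B := by
        rw [Nat.cast_succ, ← add_assoc]
        exact ih.2
      refine ⟨h1, hstep _ h1 (Commute.smul_left ?_ _)⟩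
      rw [Nat.cast_succ, ← add_assoc, add_sub_cancel_right]
      exact ih.1
  exact (key n).1

/-! ### Analyticity of `Q₊` in `Y = q ^ (-u)` -/

/-- The radius of the disc of `Y = q ^ (-u)` on which the weights of `Q₊` have no poles, for
`|q| < 1`. -/
def discRadius (η ℓ : ℂ) : ℝ := ‖qpow η (-1 - ℓ)‖

theorem discRadius_pos (η ℓ : ℂ) : 0 < discRadius η ℓ := norm_pos_iff.2 (qpow_ne_zero _ _)

theorem norm_mul_discRadius_sq (η ℓ : ℂ) : ‖qpow η (2 + 2 * ℓ)‖ * discRadius η ℓ ^ 2 = 1 := by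
  rw [discRadius, ← norm_pow, ← norm_mul, ← qpow_two_mul, ← qpow_add,
    show 2 + 2 * ℓ + 2 * (-1 - ℓ) = 0 by ring, qpow_zero, norm_one]

theorem norm_qpow_two_lt_one {η : ℂ} (hη : η.re < 0) : ‖qpow η 2‖ < 1 := by
  rw [norm_qpow, Real.exp_lt_one_iff]
  simp
  linarith

theorem norm_mul_sq_lt_one (η ℓ : ℂ) {Y : ℂ} {R : ℝ} (hR : R < discRadius η ℓ) (hY : ‖Y‖ ≤ R) :
    ‖qpow η (2 + 2 * ℓ)‖ * R ^ 2 < 1 := by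
  rw [← norm_mul_discRadius_sq η ℓ]
  have h0 : 0 ≤ R := (norm_nonneg Y).trans hY
  have := norm_pos_iff.2 (qpow_ne_zero η (2 + 2 * ℓ))
  gcongr

theorem pow_mul_ne_one {p x : ℂ} (hp : ‖p‖ ≤ 1) (hx : ‖x‖ < 1) (k : ℕ) : p ^ k * x ≠ 1 := by
  intro h
  have h1 : ‖p ^ k * x‖ < 1 := by
    rw [norm_mul, norm_pow]
    exact (mul_le_of_le_one_left (norm_nonneg x) (pow_le_one₀ (norm_nonneg p) hp)).trans_lt hx
  rw [h, norm_one] at h1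
  exact lt_irrefl _ h1

theorem differentiable_qPoch (c p : ℂ) (n : ℕ) :
    Differentiable ℂ fun Y : ℂ => qPoch (c * Y ^ 2) p n := by
  unfold qPoch
  fun_prop

theorem differentiableOn_kappaDisc {η : ℂ} (hη : η.re < 0) (ℓ : ℂ) (b a m : ℕ) :
    DifferentiableOn ℂ (fun Y => kappaDisc η ℓ Y b a m) (Metric.ball 0 (discRadius η ℓ)) := by
  unfold kappaDisc
  split_ifs
  · refine (DifferentiableOn.mul ?_ ?_).const_mul _
    · exact (((differentiable_qPoch _ _ _).mul_const _).mul_const _).differentiableOn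
    · refine (differentiable_qPoch _ _ _).differentiableOn.inv fun Y hY => ?_
      rw [mem_ball_zero_iff] at hY
      refine prod_ne_zero_iff.2 fun k _ => sub_ne_zero.2 (pow_mul_ne_one
        (norm_qpow_two_lt_one hη).le ?_ k).symm
      rw [norm_mul, norm_pow]
      exact norm_mul_sq_lt_one η ℓ hY le_rfl
  · exact differentiableOn_const _

theorem differentiableOn_pathProd {ι : Type*} {κ : ℂ → ℕ → ℕ → ℕ → ℂ} {S : Set ℂ}
    (hκ : ∀ b a m, DifferentiableOn ℂ (fun Y => κ Y b a m) S) (l : List ι) (b a : ι → ℕ) (m n : ℕ) :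
    DifferentiableOn ℂ (fun Y => pathProd (κ Y) l b a (Finsupp.single m 1) n) S := by
  induction l using List.reverseRecOn generalizing m with
  | nil => exact differentiableOn_const _
  | append_singleton l k ih =>
    simp only [pathProd_snoc, Finsupp.smul_apply, smul_eq_mul]
    exact (hκ _ _ _).mul (ih _)

/-- The matrix elements of `Q₊(u)` as functions of `Y = q ^ (-u)`, up to a power of `Y`. -/
def discEntry (η ℓ : ℂ) (b a : Fin N →₀ ℕ) (Y : ℂ) : ℂ := ∑' m, pathTerm (kappaDisc η ℓ Y) b a m

theorem differentiableOn_discEntry (hN : 0 < N) {η : ℂ} (hη : η.re < 0) {ℓ : ℂ}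
    (hℓ : (η * ℓ).re < 0) (b a : Fin N →₀ ℕ) :
    DifferentiableOn ℂ (discEntry η ℓ b a) (Metric.ball 0 (discRadius η ℓ)) := by
  obtain ⟨N, rfl⟩ := Nat.exists_eq_succ_of_ne_zero hN.ne'
  intro Y₀ hY₀
  rw [mem_ball_zero_iff] at hY₀
  obtain ⟨R, hR₀, hR⟩ := exists_between hY₀
  have hp := norm_qpow_two_lt_one hη
  set s := ‖qpow η (2 + 2 * ℓ)‖ * R ^ 2 with hs
  have hs1 : s < 1 := norm_mul_sq_lt_one η ℓ hR hR₀.le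
  have hs0 : 0 ≤ s := by positivity
  obtain ⟨C₀, hC₀⟩ := exists_norm_qPoch_inv_le (p := ((‖qpow η 2‖ : ℝ) : ℂ)) (x := (s : ℂ))
    (by simpa using hp) fun k => pow_mul_ne_one (by simpa using hp.le)
      (by rwa [Complex.norm_real, Real.norm_of_nonneg hs0]) k
  obtain ⟨f, hf, hb⟩ := exists_norm_pathTerm_kappaDisc_le hη hℓ (S := Metric.ball 0 R)
    (R := R) (C₀ := C₀) (fun Y hY => (mem_ball_zero_iff.1 hY).le) (fun Y hY n => by
      refine (norm_qPoch_inv_le hp.le hs1 ?_ n).trans (hC₀ n)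
      rw [norm_mul, norm_pow, hs]
      have := (mem_ball_zero_iff.1 hY).le
      gcongr) b a
  have h := Complex.differentiableOn_tsum_of_summable_norm (F := fun m Y =>
    pathTerm (kappaDisc η ℓ Y) b a m) hf
    (fun m => (differentiableOn_pathProd (fun b a m => (differentiableOn_kappaDisc hη ℓ b a m).mono
      (Metric.ball_subset_ball hR.le)) _ _ _ _ _)) Metric.isOpen_ball fun m Y hY => hb Y hY m
  exact (h.differentiableAt (Metric.isOpen_ball.mem_nhds
    (mem_ball_zero_iff.2 hR₀))).differentiableWithinAt

theorem regularPlus_of_norm_lt {η : ℂ} (hη : η.re < 0) {ℓ u : ℂ}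
    (hu : ‖qpow η (-u)‖ < discRadius η ℓ) : RegularPlus η ℓ u := by
  intro n h
  refine pow_mul_ne_one (x := qpow η (2 + 2 * ℓ) * qpow η (-u) ^ 2)
    (norm_qpow_two_lt_one hη).le ?_ n ?_
  · rw [norm_mul, norm_pow]
    exact norm_mul_sq_lt_one η ℓ hu le_rfl
  · rw [← h, ← qpow_two_mul, ← qpow_add, ← qpow_nat_mul, ← qpow_add]
    congr 1
    ring

/-! ### Solutions of the Baxter equation that are regular at `Y = 0` -/

/-- `w` is a solution of the Baxter equation for `Q₊` with values in the homogeneous polynomials of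
degree `M`, which up to the factor `Y ^ M` is analytic in `Y = q ^ (-u)` on the disc. -/
structure IsBaxterSolution (η ℓ : ℂ) (M : ℕ) (w : ℂ → MvPolynomial (Fin N) ℂ)
    (g : (Fin N →₀ ℕ) → ℂ → ℂ) : Prop where
  differentiableOn : ∀ b, DifferentiableOn ℂ (g b) (Metric.ball 0 (discRadius η ℓ))
  coeff_eq : ∀ u b, ‖qpow η (-u)‖ < discRadius η ℓ → b.degree = M →
    coeff b (w u) = qpow η (-u) ^ M * g b (qpow η (-u))
  coeff_eq_zero : ∀ u b, ‖qpow η (-u)‖ < discRadius η ℓ → b.degree ≠ M → coeff b (w u) = 0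
  baxter : ∀ u, ‖qpow η (-(u + 1))‖ < discRadius η ℓ → tHom N η ℓ u (w u) =
    (qnum η (u - 1 + ℓ) ^ N * qnum η (u - ℓ) ^ N / qnum η (u - 1 - ℓ) ^ N) • w (u - 1) +
      qnum η (u - ℓ) ^ N • w (u + 1)

theorem IsBaxterSolution.sub {η ℓ : ℂ} {M : ℕ} {w w' : ℂ → MvPolynomial (Fin N) ℂ}
    {g g' : (Fin N →₀ ℕ) → ℂ → ℂ} (h : IsBaxterSolution η ℓ M w g)
    (h' : IsBaxterSolution η ℓ M w' g') :
    IsBaxterSolution η ℓ M (fun u => w u - w' u) fun b Y => g b Y - g' b Y where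
  differentiableOn b := (h.differentiableOn b).sub (h'.differentiableOn b)
  coeff_eq u b hu hb := by rw [coeff_sub, h.coeff_eq u b hu hb, h'.coeff_eq u b hu hb, mul_sub]
  coeff_eq_zero u b hu hb := by
    rw [coeff_sub, h.coeff_eq_zero u b hu hb, h'.coeff_eq_zero u b hu hb, sub_zero]
  baxter u hu := by
    rw [map_sub, h.baxter u hu, h'.baxter u hu]
    module

theorem norm_qpow_neg_add_one {η : ℂ} (u : ℂ) :
    ‖qpow η (-u)‖ = ‖qpow η 1‖ * ‖qpow η (-(u + 1))‖ := by
  rw [← norm_mul, ← qpow_add]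
  congr 2
  ring

theorem norm_qpow_one_lt_one {η : ℂ} (hη : η.re < 0) : ‖qpow η 1‖ < 1 := by
  rw [norm_qpow, Real.exp_lt_one_iff, mul_one]
  exact hη

theorem norm_lt_of_norm_add_one_lt {η : ℂ} (hη : η.re < 0) {u : ℂ} {r : ℝ}
    (hu : ‖qpow η (-(u + 1))‖ < r) : ‖qpow η (-u)‖ < r := by
  rw [norm_qpow_neg_add_one]
  exact (mul_le_of_le_one_left (norm_nonneg _) (norm_qpow_one_lt_one hη).le).trans_lt hu

theorem coeff_eq_sum_of_degree {p : MvPolynomial (Fin N) ℂ} {M : ℕ}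
    (hp : ∀ b, b.degree ≠ M → coeff b p = 0) :
    p = ∑ c ∈ finsuppAntidiag univ M, coeff c p • monomial c 1 := by
  ext b
  simp only [coeff_sum, coeff_smul, coeff_monomial, smul_eq_mul, mul_ite, mul_one, mul_zero,
    sum_ite_eq']
  split_ifs with hb
  · rfl
  · exact hp b fun h => hb (mem_finsuppAntidiag_iff_degree.2 h)

/-- An operator that commutes with the transfer matrices maps solutions to solutions. -/
theorem IsBaxterSolution.map {η ℓ : ℂ} {M : ℕ}
    {w : ℂ → MvPolynomial (Fin N) ℂ}
    {g : (Fin N →₀ ℕ) → ℂ → ℂ} (h : IsBaxterSolution η ℓ M w g)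
    {B : Module.End ℂ (MvPolynomial (Fin N) ℂ)} (hB : PreservesDegree B)
    (ht : ∀ v, Commute (tHom N η ℓ v) B) :
    IsBaxterSolution η ℓ M (fun u => B (w u)) fun b Y =>
      ∑ c ∈ finsuppAntidiag univ M, g c Y * coeff b (B (monomial c 1)) := by
  have hc : ∀ u b, ‖qpow η (-u)‖ < discRadius η ℓ → coeff b (B (w u)) =
      ∑ c ∈ finsuppAntidiag univ M, coeff c (w u) * coeff b (B (monomial c 1)) := by
    intro u b hu
    conv_lhs => rw [coeff_eq_sum_of_degree (h.coeff_eq_zero u · hu)]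
    simp only [map_sum, map_smul, coeff_sum, coeff_smul, smul_eq_mul]
  refine ⟨fun b => ?_, fun u b hu hb => ?_, fun u b hu hb => ?_, fun u hu => ?_⟩
  · exact DifferentiableOn.fun_sum fun c _ => (h.differentiableOn c).mul_const _
  · rw [hc u b hu, mul_sum]
    refine sum_congr rfl fun c hc => ?_
    rw [h.coeff_eq u c hu (mem_finsuppAntidiag_iff_degree.1 hc), mul_assoc]
  · rw [hc u b hu]
    refine sum_eq_zero fun c hc => ?_
    have h0 : coeff b (B (monomial c 1)) = 0 := by
      by_contra hne
      exact hb ((hB b c hne).trans (mem_finsuppAntidiag_iff_degree.1 hc))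
    rw [h0, mul_zero]
  · have := LinearMap.congr_fun (ht u).eq (w u)
    rw [Module.End.mul_apply, Module.End.mul_apply] at this
    rw [this, h.baxter u hu, map_add, map_smul, map_smul]

theorem exists_qpow_neg_eq {η : ℂ} (hη : η.re ≠ 0) {Y : ℂ} (hY : Y ≠ 0) :
    ∃ u, qpow η (-u) = Y := by
  have h0 : η ≠ 0 := fun h => hη (by rw [h, Complex.zero_re])
  refine ⟨-(Complex.log Y / η), ?_⟩
  rw [qpow, neg_neg, mul_div_cancel₀ _ h0, Complex.exp_log hY]

/-- `Y [u + x]` up to normalisation, as a function of `Y = q ^ (-u)`. -/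
def qnumDisc (η x Y : ℂ) : ℂ := qpow η x - Y ^ 2 * qpow η (-x)

theorem mul_qnum_eq_qnumDisc {η : ℂ} (hη : η.re ≠ 0) (u x : ℂ) :
    (qpow η 1 - qpow η (-1)) * qpow η (-u) * qnum η (u + x) = qnumDisc η x (qpow η (-u)) := by
  have hc := q_sub_q_inv_ne_zero hη
  rw [qnum, qnumDisc, mul_right_comm, mul_div_cancel₀ _ hc, sub_mul, ← qpow_add, ← qpow_add,
    ← qpow_two_mul, ← qpow_add]
  congr 2 <;> ring

/-- The Baxter equation in the variable `Y`. -/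
theorem IsBaxterSolution.disc {η : ℂ} (hη : η.re < 0) {ℓ : ℂ} {M : ℕ}
    {w : ℂ → MvPolynomial (Fin N) ℂ} {g : (Fin N →₀ ℕ) → ℂ → ℂ}
    (h : IsBaxterSolution η ℓ M w g) {P : (Fin N →₀ ℕ) → (Fin N →₀ ℕ) → Polynomial ℂ}
    (hP : ∀ b c u, ((qpow η 1 - qpow η (-1)) * qpow η (-u)) ^ N *
      coeff b (tHom N η ℓ u (monomial c 1)) = (P b c).eval (qpow η (-u)))
    {b : Fin N →₀ ℕ} (hb : b.degree = M) {Y : ℂ} (hY0 : Y ≠ 0)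
    (hY : ‖Y‖ < ‖qpow η 1‖ * discRadius η ℓ) :
    ∑ c ∈ finsuppAntidiag univ M, (P b c).eval Y * g c Y =
      qnumDisc η (ℓ - 1) Y ^ N * qnumDisc η (-ℓ) Y ^ N / qnumDisc η (-1 - ℓ) Y ^ N *
          (qpow η 1 ^ M * g b (qpow η 1 * Y)) +
        qnumDisc η (-ℓ) Y ^ N * ((qpow η 1)⁻¹ ^ M * g b ((qpow η 1)⁻¹ * Y)) := by
  obtain ⟨u, rfl⟩ := exists_qpow_neg_eq hη.ne hY0
  have hq := qpow_ne_zero η 1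
  have hu1 : ‖qpow η (-(u + 1))‖ < discRadius η ℓ := by
    rw [norm_qpow_neg_add_one] at hY
    exact lt_of_mul_lt_mul_left hY (norm_nonneg _)
  have hu0 := norm_lt_of_norm_add_one_lt hη hu1
  have hum : ‖qpow η (-(u - 1))‖ < discRadius η ℓ :=
    norm_lt_of_norm_add_one_lt hη (by rwa [sub_add_cancel])
  have e1 : qpow η (-(u + 1)) = (qpow η 1)⁻¹ * qpow η (-u) := by
    rw [← qpow_neg, ← qpow_add]
    congr 1
    ring
  have e2 : qpow η (-(u - 1)) = qpow η 1 * qpow η (-u) := by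
    rw [← qpow_add]
    congr 1
    ring
  have hbax := congrArg (coeff b) (h.baxter u hu1)
  have hLHS : ((qpow η 1 - qpow η (-1)) * qpow η (-u)) ^ N * coeff b (tHom N η ℓ u (w u)) =
      qpow η (-u) ^ M * ∑ c ∈ finsuppAntidiag univ M, (P b c).eval (qpow η (-u)) *
        g c (qpow η (-u)) := by
    conv_lhs => rw [coeff_eq_sum_of_degree (h.coeff_eq_zero u · hu0)]
    simp only [map_sum, map_smul, coeff_sum, coeff_smul, smul_eq_mul, mul_sum]
    refine sum_congr rfl fun c hc => ?_
    rw [← hP, h.coeff_eq u c hu0 (mem_finsuppAntidiag_iff_degree.1 hc)]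
    ring
  rw [coeff_add, coeff_smul, coeff_smul, smul_eq_mul, smul_eq_mul, h.coeff_eq _ b hum hb,
    h.coeff_eq _ b hu1 hb, e1, e2] at hbax
  rw [hbax] at hLHS
  have hc0 := q_sub_q_inv_ne_zero hη.ne
  have hYM : qpow η (-u) ^ M ≠ 0 := pow_ne_zero _ hY0
  have hcY : (qpow η 1 - qpow η (-1)) * qpow η (-u) ≠ 0 := mul_ne_zero hc0 hY0
  refine mul_left_cancel₀ hYM (hLHS.symm.trans ?_)
  rw [← mul_qnum_eq_qnumDisc hη.ne, ← mul_qnum_eq_qnumDisc hη.ne, ← mul_qnum_eq_qnumDisc hη.ne,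
    show u + (ℓ - 1) = u - 1 + ℓ by ring, show u + -ℓ = u - ℓ by ring,
    show u + (-1 - ℓ) = u - 1 - ℓ by ring]
  generalize (qpow η 1 - qpow η (-1)) * qpow η (-u) = d at *
  have hdN := pow_ne_zero N hcY
  simp only [mul_pow]
  rcases eq_or_ne (qnum η (u - 1 - ℓ) ^ N) 0 with h0 | h0
  · rw [h0]
    simp only [mul_zero, div_zero, zero_mul, zero_add]
    ring
  · field_simp
    try ring

theorem sub_ne_zero_of_norm {S q : ℂ} (hS0 : S ≠ 0) (hS : ‖S‖ < 1) (hq0 : q ≠ 0) (hq : ‖q‖ < 1) :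
    S + S⁻¹ ≠ S * q + S⁻¹ * q⁻¹ := by
  intro h
  have h1 : (1 - q) * (S * S * q - 1) = 0 := by
    have h2 : S * S * q + q = S * S * q * q + 1 := by
      have := congrArg (fun x => x * (S * q)) h
      field_simp at this
      linear_combination this
    linear_combination h2
  rcases mul_eq_zero.1 h1 with h2 | h2
  · rw [← sub_eq_zero.1 h2, norm_one] at hq
    exact lt_irrefl _ hq
  · have h3 := congrArg norm (sub_eq_zero.1 h2)
    rw [norm_mul, norm_mul, norm_one] at h3
    have h4 : ‖S‖ * ‖S‖ * ‖q‖ < 1 :=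
      mul_lt_one_of_nonneg_of_lt_one_left (by positivity)
        (mul_lt_one_of_nonneg_of_lt_one_left (norm_nonneg _) hS hS.le) hq.le
    exact h4.ne h3

/-- A solution of the Baxter equation that vanishes at `Y = 0` vanishes on the whole disc: its order
of vanishing `n` at `Y = 0` would satisfy `S + S⁻¹ = S q ^ n + (S q ^ n)⁻¹` for
`S = q ^ (N ℓ + M)`. -/
theorem IsBaxterSolution.eq_zero {η : ℂ} (hη : η.re < 0) {ℓ : ℂ} (hN : 0 < N)
    (hℓ : (η * ℓ).re < 0) {M : ℕ} {w : ℂ → MvPolynomial (Fin N) ℂ} {g : (Fin N →₀ ℕ) → ℂ → ℂ}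
    (h : IsBaxterSolution η ℓ M w g) (h0 : ∀ b, b.degree = M → g b 0 = 0) {u : ℂ}
    (hu : ‖qpow η (-u)‖ < discRadius η ℓ) : w u = 0 := by
  set D : Finset (Fin N →₀ ℕ) := finsuppAntidiag univ M with hD
  set G : ℂ → D → ℂ := fun Y b => g b Y with hG
  have hGan : AnalyticOnNhd ℂ G (Metric.ball 0 (discRadius η ℓ)) :=
    DifferentiableOn.analyticOnNhd (differentiableOn_pi.2 fun b : D => h.differentiableOn b)
      Metric.isOpen_ball
  have hmem0 : (0 : ℂ) ∈ Metric.ball (0 : ℂ) (discRadius η ℓ) :=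
    Metric.mem_ball_self (discRadius_pos η ℓ)
  suffices hev : ∀ᶠ Y in nhds 0, G Y = 0 by
    have hG0 := hGan.eqOn_zero_of_preconnected_of_eventuallyEq_zero
      (convex_ball 0 _).isPreconnected hmem0 hev
    ext b
    rw [coeff_zero]
    by_cases hb : b.degree = M
    · rw [h.coeff_eq u b hu hb]
      have := congrFun (hG0 (mem_ball_zero_iff.2 hu)) ⟨b, mem_finsuppAntidiag_iff_degree.2 hb⟩
      simp only [hG, Pi.zero_apply] at this
      rw [this, mul_zero]
    · exact h.coeff_eq_zero u b hu hb
  by_contra hne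
  obtain ⟨n, k, hk, hk0, hGk⟩ :=
    (hGan 0 hmem0).exists_eventuallyEq_pow_smul_nonzero_iff.2 hne
  simp only [sub_zero] at hGk
  have hn : n ≠ 0 := by
    rintro rfl
    refine hk0 ?_
    have := hGk.self_of_nhds
    rw [pow_zero, one_smul] at this
    rw [← this]
    funext b
    exact h0 b (mem_finsuppAntidiag_iff_degree.1 b.2)
  choose P hP hP0 using fun b c : Fin N →₀ ℕ =>
    exists_polynomial_tHom N hη.ne ℓ (monomial c 1) b
  set q := qpow η 1 with hq
  have hq0 : q ≠ 0 := qpow_ne_zero η 1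
  -- the equation for the leading coefficients
  have hlead : ∀ b : D, ∑ c : D, (P b c).eval 0 * k 0 c =
      qpow η (N * ℓ) * (q ^ M * (q ^ n * k 0 b)) +
        qpow η (-(N * ℓ)) * (q⁻¹ ^ M * (q⁻¹ ^ n * k 0 b)) := by
    intro b
    have hkc : ContinuousAt k 0 := hk.continuousAt
    have hkq : ∀ c : ℂ, ContinuousAt (fun Y => k (c * Y) b) 0 := by
      intro c
      have h1 : ContinuousAt (fun Y : ℂ => c * Y) 0 := by fun_prop
      have h2 : ContinuousAt k (c * 0) := by rwa [mul_zero]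
      exact (continuousAt_pi.1 (ContinuousAt.comp (f := fun Y => c * Y) h2 h1)) b
    have hd : ∀ x, Continuous (qnumDisc η x) := by
      intro x
      unfold qnumDisc
      fun_prop
    have hd0 : ∀ x, qnumDisc η x 0 = qpow η x := by
      intro x
      simp [qnumDisc]
    have hcL : ContinuousAt (fun Y => ∑ c : D, (P b c).eval Y * k Y c) 0 :=
      tendsto_finsetSum _ fun c _ => ((P b c).continuous.continuousAt.mul
        (continuousAt_pi.1 hkc c))
    have hcR : ContinuousAt (fun Y =>
        qnumDisc η (ℓ - 1) Y ^ N * qnumDisc η (-ℓ) Y ^ N / qnumDisc η (-1 - ℓ) Y ^ N *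
          (q ^ M * (q ^ n * k (q * Y) b)) +
        qnumDisc η (-ℓ) Y ^ N * (q⁻¹ ^ M * (q⁻¹ ^ n * k (q⁻¹ * Y) b))) 0 := by
      refine ((((((hd _).pow N).mul ((hd _).pow N)).continuousAt.div
        ((hd _).pow N).continuousAt ?_).mul ?_).add (((hd _).pow N).continuousAt.mul ?_))
      · rw [Pi.pow_apply, hd0]
        exact pow_ne_zero _ (qpow_ne_zero _ _)
      · exact ((hkq q).const_mul _).const_mul _
      · exact ((hkq q⁻¹).const_mul _).const_mul _
    have heq : ∀ᶠ Y in nhdsWithin (0 : ℂ) {0}ᶜ, ∑ c : D, (P b c).eval Y * k Y c =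
        qnumDisc η (ℓ - 1) Y ^ N * qnumDisc η (-ℓ) Y ^ N / qnumDisc η (-1 - ℓ) Y ^ N *
          (q ^ M * (q ^ n * k (q * Y) b)) +
        qnumDisc η (-ℓ) Y ^ N * (q⁻¹ ^ M * (q⁻¹ ^ n * k (q⁻¹ * Y) b)) := by
      have hsmall : ∀ᶠ Y in nhds (0 : ℂ), ‖Y‖ < ‖qpow η 1‖ * discRadius η ℓ := by
        have : 0 < ‖qpow η 1‖ * discRadius η ℓ :=
          mul_pos (norm_pos_iff.2 hq0) (discRadius_pos η ℓ)
        filter_upwards [Metric.ball_mem_nhds (0 : ℂ) this] with Y hY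
        exact mem_ball_zero_iff.1 hY
      have hdil : ∀ c : ℂ, ∀ᶠ Y in nhds (0 : ℂ), G (c * Y) = (c * Y) ^ n • k (c * Y) := by
        intro c
        have h1 : Filter.Tendsto (fun Y : ℂ => c * Y) (nhds 0) (nhds 0) := by
          have : ContinuousAt (fun Y : ℂ => c * Y) 0 := by fun_prop
          simpa [ContinuousAt] using this
        exact h1.eventually hGk
      filter_upwards [self_mem_nhdsWithin, nhdsWithin_le_nhds hsmall, nhdsWithin_le_nhds hGk,
        nhdsWithin_le_nhds (hdil q), nhdsWithin_le_nhds (hdil q⁻¹)] with Y hY0 hY hY1 hY2 hY3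
      have hY0' : Y ≠ 0 := hY0
      have key := h.disc hη hP (mem_finsuppAntidiag_iff_degree.1 b.2) hY0' hY
      have g1 : ∀ c : D, g c Y = Y ^ n * k Y c := fun c => congrFun hY1 c
      have g2 : g b (q * Y) = (q * Y) ^ n * k (q * Y) b := congrFun hY2 b
      have g3 : g b (q⁻¹ * Y) = (q⁻¹ * Y) ^ n * k (q⁻¹ * Y) b := congrFun hY3 b
      rw [← sum_coe_sort] at key
      simp only [g1] at key
      rw [← hq, g2, g3, mul_pow, mul_pow] at key
      refine mul_left_cancel₀ (pow_ne_zero n hY0') ?_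
      rw [mul_sum]
      refine Eq.trans (sum_congr rfl fun c _ => ?_) (key.trans ?_)
      · ring
      · ring
    have hlim := tendsto_nhds_unique_of_eventuallyEq
      (hcL.tendsto.mono_left nhdsWithin_le_nhds) (hcR.tendsto.mono_left nhdsWithin_le_nhds) heq
    simp only [hd0, mul_zero] at hlim
    rw [hlim]
    congr 2
    · rw [← mul_pow, ← div_pow, ← qpow_add, ← qpow_sub, ← qpow_nat_mul]
      congr 1
      ring
    · rw [← qpow_nat_mul]
      congr 1
      ring
  refine hk0 (funext fun b => ?_)
  have hl := hlead b
  have hP0' : ∀ c : D, (P b c).eval 0 * k 0 c = if b = c then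
      (qpow η (N * ℓ + M) + qpow η (-(N * ℓ + M))) * k 0 c else 0 := by
    intro c
    rw [← Polynomial.coeff_zero_eq_eval_zero, hP0, coeff_monomial,
      mem_finsuppAntidiag_iff_degree.1 b.2]
    by_cases hbc : b = c
    · rw [if_pos hbc, hbc, if_pos rfl, mul_one]
    · rw [if_neg hbc, if_neg (fun h => hbc (Subtype.ext h.symm)), mul_zero, zero_mul]
  simp only [hP0', sum_ite_eq, mem_univ, if_true] at hl
  rw [Pi.zero_apply]
  by_contra hkb
  set S := qpow η (N * ℓ + M) with hS
  have hSM : S = qpow η (N * ℓ) * q ^ M := by rw [hS, qpow_add, qpow_natCast]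
  have hSinv : S⁻¹ = qpow η (-(N * ℓ)) * q⁻¹ ^ M := by rw [hSM, mul_inv, qpow_neg, inv_pow]
  have hSnorm : ‖S‖ < 1 := by
    rw [hS, norm_qpow, Real.exp_lt_one_iff,
      show η * (N * ℓ + M) = (N : ℝ) * (η * ℓ) + (M : ℝ) * η by push_cast; ring, Complex.add_re,
      Complex.re_ofReal_mul, Complex.re_ofReal_mul]
    have h1 : (N : ℝ) * (η * ℓ).re < 0 := mul_neg_of_pos_of_neg (by exact_mod_cast hN) hℓ
    have h2 : (M : ℝ) * η.re ≤ 0 := mul_nonpos_of_nonneg_of_nonpos (Nat.cast_nonneg M) hη.le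
    linarith
  have hqn : ‖q ^ n‖ < 1 := by
    rw [norm_pow]
    exact pow_lt_one₀ (norm_nonneg _) (norm_qpow_one_lt_one hη) hn
  refine sub_ne_zero_of_norm (qpow_ne_zero _ _) hSnorm (pow_ne_zero n hq0) hqn
    (mul_right_cancel₀ hkb ?_)
  rw [qpow_neg, ← hS] at hl
  rw [hl, ← inv_pow, hSinv]
  linear_combination (-(q ^ n * k 0 b)) * hSM

/-! ### Operators commuting with `Q₊` -/

theorem coeff_Qplus (hN : 0 < N) {η : ℂ} (hη : η.re < 0) {ℓ : ℂ}
    (hℓ : ∀ n : ℕ, qpow η (2 * (2 * ℓ + n)) ≠ 1) (hconv : (η * ℓ).re < 0) {u : ℂ}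
    (hu : ‖qpow η (-u)‖ < discRadius η ℓ) (b a : Fin N →₀ ℕ) :
    coeff b (Qplus N η ℓ u (monomial a 1)) =
      qpow η (-u) ^ b.degree * discEntry η ℓ b a (qpow η (-u)) := by
  have h := (isAuxTrace_Qplus hN hη.ne hℓ (mul_pos_of_neg_of_neg hη hconv)
    (regularPlus_of_norm_lt hη hu)).2 b a
  rw [funext (pathTerm_kappaPlus hη.ne ℓ u b a)] at h
  rw [← h.tsum_eq, discEntry, tsum_mul_left]

theorem preservesDegree_Qplus (hN : 0 < N) {η : ℂ} (hη : η.re ≠ 0) {ℓ : ℂ}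
    (hℓ : ∀ n : ℕ, qpow η (2 * (2 * ℓ + n)) ≠ 1) (hconv : 0 < η.re * (η * ℓ).re) {u : ℂ}
    (hu : RegularPlus η ℓ u) : PreservesDegree (Qplus N η ℓ u) :=
  (isAuxTrace_Qplus hN hη hℓ hconv hu).2.preservesDegree (balanced_kappaPlus _ _ _)

/-- At `u = 1 - ℓ` the two parameters of the weights agree, as for `Q₋(ℓ)`. -/
theorem Qplus_eq_rotOp (hN : 0 < N) {η : ℂ} (hη : η.re < 0) {ℓ : ℂ}
    (hℓ : ∀ n : ℕ, qpow η (2 * (2 * ℓ + n)) ≠ 1) (hconv : (η * ℓ).re < 0)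
    (hu : RegularPlus η ℓ (1 - ℓ)) : Qplus N η ℓ (1 - ℓ) = rotOp N := by
  refine (isAuxTrace_Qplus hN hη.ne hℓ (mul_pos_of_neg_of_neg hη hconv) hu).2.unique
    (hasPathSum_rotOp hN ?_)
  rw [show 1 + ℓ - (1 - ℓ) = 2 * ℓ by ring]
  exact kappaPlus_self hη.ne hℓ

/-- The homogeneous polynomial of degree `M` with given coefficients. -/
def homPoly {M : ℕ} (x : finsuppAntidiag (univ : Finset (Fin N)) M → ℂ) :
    MvPolynomial (Fin N) ℂ :=
  ∑ a, x a • monomial a.1 1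

theorem homPoly_eq_zero {M : ℕ} {x : finsuppAntidiag (univ : Finset (Fin N)) M → ℂ}
    (h : homPoly x = 0) : x = 0 := by
  classical
  funext b
  have := congrArg (coeff b.1) h
  simpa [homPoly, coeff_sum, coeff_smul, coeff_monomial, Subtype.ext_iff.symm] using this

theorem rotOp_injective (N : ℕ) : Function.Injective (rotOp N) :=
  rename_injective _ (finRotate N).symm.injective

theorem isBaxterSolution_Qplus (hN : 0 < N) {η : ℂ} (hη : η.re < 0) {ℓ : ℂ}
    (hℓ : ∀ n : ℕ, qpow η (2 * (2 * ℓ + n)) ≠ 1) (hconv : (η * ℓ).re < 0) {M : ℕ}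
    (x : finsuppAntidiag (univ : Finset (Fin N)) M → ℂ) :
    IsBaxterSolution η ℓ M (fun u => Qplus N η ℓ u (homPoly x))
      fun b Y => ∑ a, x a * discEntry η ℓ b a.1 Y := by
  have hconv' := mul_pos_of_neg_of_neg hη hconv
  have hc : ∀ u b, coeff b (Qplus N η ℓ u (homPoly x)) =
      ∑ a, x a * coeff b (Qplus N η ℓ u (monomial a.1 1)) := fun u b => by
    simp only [homPoly, map_sum, map_smul, coeff_sum, coeff_smul, smul_eq_mul]
  refine ⟨fun b => ?_, fun u b hu hb => ?_, fun u b hu hb => ?_, fun u hu => ?_⟩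
  · exact DifferentiableOn.fun_sum fun a _ =>
      (differentiableOn_discEntry hN hη hconv b a).const_mul _
  · rw [hc, mul_sum]
    refine sum_congr rfl fun a _ => ?_
    rw [coeff_Qplus hN hη hℓ hconv hu, hb]
    ring
  · rw [hc]
    refine sum_eq_zero fun a _ => ?_
    have h0 : coeff b (Qplus N η ℓ u (monomial a.1 1)) = 0 := by
      by_contra hne
      exact hb ((preservesDegree_Qplus hN hη.ne hℓ hconv' (regularPlus_of_norm_lt hη hu) b a hne).trans
        (mem_finsuppAntidiag_iff_degree.1 a.2))
    rw [h0, mul_zero]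
  · have := LinearMap.congr_fun (tHom_mul_Qplus hN hη.ne hℓ hconv' (regularPlus_of_norm_lt hη hu))
      (homPoly x)
    simpa only [Module.End.mul_apply, LinearMap.add_apply, LinearMap.smul_apply] using this

theorem norm_qpow_shift_point {η : ℂ} {ℓ : ℂ} (hconv : (η * ℓ).re < 0) :
    ‖qpow η (-(1 - ℓ))‖ < discRadius η ℓ := by
  rw [discRadius, norm_qpow, norm_qpow, Real.exp_lt_exp,
    show η * -(1 - ℓ) = -η + η * ℓ by ring, show η * (-1 - ℓ) = -η - η * ℓ by ring, Complex.add_re,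
    Complex.sub_re]
  linarith

/-- Solutions of the Baxter equation on the disc are determined by their values at `Y = 0`, and at
`Y = q ^ (ℓ - 1)` the operator `Q₊` is the invertible cyclic shift. Hence the commutator of `Q₊(u)`
with `B`, as a solution that vanishes at that point, vanishes on the disc. -/
theorem Qplus_commute_disc (hN : 0 < N) {η : ℂ} (hη : η.re < 0) {ℓ : ℂ}
    (hℓ : ∀ n : ℕ, qpow η (2 * (2 * ℓ + n)) ≠ 1) (hconv : (η * ℓ).re < 0)
    {B : Module.End ℂ (MvPolynomial (Fin N) ℂ)} (hB : PreservesDegree B)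
    (ht : ∀ v, Commute (tHom N η ℓ v) B) (hU : Commute (rotOp N) B) {u : ℂ}
    (hu : ‖qpow η (-u)‖ < discRadius η ℓ) : Commute (Qplus N η ℓ u) B := by
  refine (basisMonomials (Fin N) ℂ).ext fun a₀ => ?_
  rw [coe_basisMonomials, Module.End.mul_apply, Module.End.mul_apply]
  set M := a₀.degree with hM
  have hu₁ := norm_qpow_shift_point (η := η) hconv
  have hU₁ : Qplus N η ℓ (1 - ℓ) = rotOp N :=
    Qplus_eq_rotOp hN hη hℓ hconv (regularPlus_of_norm_lt hη hu₁)
  have hsol := fun x : finsuppAntidiag (univ : Finset (Fin N)) M → ℂ =>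
    isBaxterSolution_Qplus hN hη hℓ hconv x
  -- the value of `Q₊` at `Y = 0`, up to the factor `Y ^ M`
  let F : (finsuppAntidiag (univ : Finset (Fin N)) M → ℂ) →ₗ[ℂ]
      finsuppAntidiag (univ : Finset (Fin N)) M → ℂ :=
    Matrix.mulVecLin (Matrix.of fun b a => discEntry η ℓ b.1 a.1 0)
  have hF : ∀ x b, F x b = ∑ a, x a * discEntry η ℓ b.1 a.1 0 := by
    intro x b
    simp only [F, Matrix.mulVecLin_apply, Matrix.mulVec, dotProduct, Matrix.of_apply, mul_comm]
  have hFinj : Function.Injective F := by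
    rw [injective_iff_map_eq_zero]
    intro x hx
    have h1 := (hsol x).eq_zero hη hN hconv (fun b hb => by
      have := congrFun hx ⟨b, mem_finsuppAntidiag_iff_degree.2 hb⟩
      rwa [hF, Pi.zero_apply] at this) hu₁
    rw [hU₁] at h1
    exact homPoly_eq_zero (rotOp_injective N (h1.trans (map_zero _).symm))
  have hFsurj : Function.Surjective F := LinearMap.injective_iff_surjective.1 hFinj
  -- the commutator applied to the monomial
  have ha₀ : ∃ x : finsuppAntidiag (univ : Finset (Fin N)) M → ℂ, monomial a₀ 1 = homPoly x := by
    classical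
    refine ⟨fun a => if a.1 = a₀ then 1 else 0, ?_⟩
    rw [homPoly, sum_eq_single ⟨a₀, mem_finsuppAntidiag_iff_degree.2 rfl⟩]
    · simp
    · intro a _ ha
      rw [if_neg (fun h => ha (Subtype.ext h)), zero_smul]
    · intro h
      exact absurd (mem_univ _) h
  have hBa₀ : ∃ y : finsuppAntidiag (univ : Finset (Fin N)) M → ℂ,
      B (monomial a₀ 1) = homPoly y := by
    refine ⟨fun a => coeff a.1 (B (monomial a₀ 1)), ?_⟩
    rw [homPoly, sum_coe_sort _ fun a => coeff a (B (monomial a₀ 1)) • monomial a 1]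
    exact hB.eq_sum a₀
  obtain ⟨x, hx⟩ := ha₀
  obtain ⟨y, hy⟩ := hBa₀
  have hC := (hsol y).sub ((hsol x).map hB ht)
  obtain ⟨z, hz⟩ := hFsurj fun b => (∑ a, y a * discEntry η ℓ b.1 a.1 0) -
    ∑ c ∈ finsuppAntidiag univ M, (∑ a, x a * discEntry η ℓ c a.1 0) * coeff b.1 (B (monomial c 1))
  have hzero : ∀ v, ‖qpow η (-v)‖ < discRadius η ℓ →
      Qplus N η ℓ v (homPoly y) - B (Qplus N η ℓ v (homPoly x)) - Qplus N η ℓ v (homPoly z) = 0 := by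
    intro v hv
    refine (hC.sub (hsol z)).eq_zero hη hN hconv (fun b hb => ?_) hv
    have := congrFun hz ⟨b, mem_finsuppAntidiag_iff_degree.2 hb⟩
    rw [hF] at this
    rw [this, sub_self]
  have hz0 : homPoly z = 0 := by
    have h1 := hzero (1 - ℓ) hu₁
    rw [hU₁, ← hx, ← hy] at h1
    have h2 := LinearMap.congr_fun hU.eq (monomial a₀ 1)
    rw [Module.End.mul_apply, Module.End.mul_apply] at h2
    rw [h2, sub_self, zero_sub, neg_eq_zero] at h1
    exact rotOp_injective N (h1.trans (map_zero _).symm)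
  have h1 := hzero u hu
  rw [hz0, map_zero, sub_zero, ← hx, ← hy] at h1
  exact sub_eq_zero.1 h1

/-- The Baxter equation continues the commutation from the disc to all regular `u`. -/
theorem Qplus_commute_of_re_neg (hN : 0 < N) {η : ℂ} (hη : η.re < 0) {ℓ : ℂ}
    (hℓ : ∀ n : ℕ, qpow η (2 * (2 * ℓ + n)) ≠ 1) (hconv : (η * ℓ).re < 0)
    {B : Module.End ℂ (MvPolynomial (Fin N) ℂ)} (hB : PreservesDegree B)
    (ht : ∀ v, Commute (tHom N η ℓ v) B) (hU : Commute (rotOp N) B) {u : ℂ}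
    (hu : RegularPlus η ℓ u) : Commute (Qplus N η ℓ u) B := by
  have hq := norm_qpow_one_lt_one hη
  obtain ⟨n, hn⟩ : ∃ n : ℕ, ‖qpow η (-(u - n))‖ < discRadius η ℓ := by
    have h1 : Filter.Tendsto (fun n : ℕ => ‖qpow η 1‖ ^ n * ‖qpow η (-u)‖) Filter.atTop
        (nhds (0 * ‖qpow η (-u)‖)) :=
      (tendsto_pow_atTop_nhds_zero_of_lt_one (norm_nonneg _) hq).mul_const _
    rw [zero_mul] at h1
    obtain ⟨n, hn⟩ := (h1.eventually (gt_mem_nhds (discRadius_pos η ℓ))).exists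
    refine ⟨n, ?_⟩
    rwa [show -(u - n) = n * 1 + -u by ring, qpow_add, qpow_nat_mul, norm_mul, norm_pow]
  have key : ∀ (n : ℕ) (u : ℂ), RegularPlus η ℓ u → ‖qpow η (-(u - n))‖ < discRadius η ℓ →
      Commute (Qplus N η ℓ u) B := by
    intro n
    induction n with
    | zero =>
      intro u _ h
      rw [Nat.cast_zero, sub_zero] at h
      exact Qplus_commute_disc hN hη hℓ hconv hB ht hU h
    | succ n ih =>
      intro u hu h
      have hu' : RegularPlus η ℓ (u - 1 + 1) := by rwa [sub_add_cancel]
      have hu1 := hu'.sub_one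
      have hu2 : RegularPlus η ℓ (u - 1 - 1) := RegularPlus.sub_one (by rwa [sub_add_cancel])
      have h1 : ‖qpow η (-(u - 1 - n))‖ < discRadius η ℓ := by
        rwa [Nat.cast_succ, show u - (n + 1 : ℂ) = u - 1 - n by ring] at h
      have h2 : ‖qpow η (-(u - 1 - 1 - n))‖ < discRadius η ℓ :=
        norm_lt_of_norm_add_one_lt hη (by rwa [show u - 1 - 1 - (n : ℂ) + 1 = u - 1 - n by ring])
      have hTQ := tHom_mul_Qplus hN hη.ne hℓ (mul_pos_of_neg_of_neg hη hconv) hu'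
      have h3 := (((ht (u - 1)).mul_left (ih _ hu1 h1)).sub_left
        ((ih _ hu2 h2).smul_left (qnum η (u - 1 - 1 + ℓ) ^ N * qnum η (u - 1 - ℓ) ^ N /
          qnum η (u - 1 - 1 - ℓ) ^ N)))
      rw [hTQ, add_sub_cancel_left, sub_add_cancel] at h3
      have hne : qnum η (u - 1 - ℓ) ^ N ≠ 0 := pow_ne_zero _ fun h0 => by
        have h4 := regularPlus_iff.1 hu 0
        rw [Nat.cast_zero, add_zero, Ne, ← qnum_eq_zero_iff hη.ne] at h4
        refine h4 ?_
        rw [← neg_neg (1 + ℓ - u), qnum_neg, show -(1 + ℓ - u) = u - 1 - ℓ by ring, h0, neg_zero]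
      have h4 := h3.smul_left (qnum η (u - 1 - ℓ) ^ N)⁻¹
      rwa [smul_smul, inv_mul_cancel₀ hne, one_smul] at h4
  exact key n u hu hn

/-! ### Reduction to `|q| < 1` -/

theorem lax_neg_eta {σ : Type*} (η u ℓ : ℂ) (k : σ) : lax (-η) k u ℓ = lax η k u ℓ := by
  simp only [lax, qnum_neg_eta]

theorem tHom_neg_eta (N : ℕ) (η ℓ u : ℂ) : tHom N (-η) ℓ u = tHom N η ℓ u := by
  simp only [tHom, transferMatrix, lax_neg_eta]

theorem regularPlus_neg_eta {η ℓ u : ℂ} (h : RegularPlus η ℓ u) : RegularPlus (-η) ℓ u := fun n => by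
  rw [Ne, qpow_neg_eta_eq_one_iff]
  exact h n

/-- `Q₊` does not distinguish `q` from `q⁻¹`, although the operators under the trace do. -/
theorem Qplus_neg_eta (hN : 0 < N) {η : ℂ} (hη : η.re ≠ 0) {ℓ : ℂ}
    (hℓ : ∀ n : ℕ, qpow η (2 * (2 * ℓ + n)) ≠ 1) (hconv : 0 < η.re * (η * ℓ).re) {u : ℂ}
    (hu : RegularPlus η ℓ u) : Qplus N (-η) ℓ u = Qplus N η ℓ u := by
  have h := (isAuxTrace_Qplus hN (η := -η) (by simpa using hη)
    (fun n => by rw [Ne, qpow_neg_eta_eq_one_iff]; exact hℓ n)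
    (by rwa [neg_mul, Complex.neg_re, Complex.neg_re, neg_mul_neg])
    (regularPlus_neg_eta hu)).2
  rw [kappaPlus_neg_eta] at h
  exact h.unique (isAuxTrace_Qplus hN hη hℓ hconv hu).2

theorem Qplus_commute (hN : 0 < N) {η : ℂ} (hη : η.re ≠ 0) {ℓ : ℂ}
    (hℓ : ∀ n : ℕ, qpow η (2 * (2 * ℓ + n)) ≠ 1) (hconv : 0 < η.re * (η * ℓ).re)
    {B : Module.End ℂ (MvPolynomial (Fin N) ℂ)} (hB : PreservesDegree B)
    (ht : ∀ v, Commute (tHom N η ℓ v) B) (hU : Commute (rotOp N) B) {u : ℂ}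
    (hu : RegularPlus η ℓ u) : Commute (Qplus N η ℓ u) B := by
  rcases lt_or_gt_of_ne hη with h | h
  · exact Qplus_commute_of_re_neg hN h hℓ ((neg_iff_neg_of_mul_pos hconv).1 h) hB ht hU hu
  · rw [← Qplus_neg_eta hN hη hℓ hconv hu]
    refine Qplus_commute_of_re_neg hN (by simpa using h)
      (fun n => by rw [Ne, qpow_neg_eta_eq_one_iff]; exact hℓ n) ?_ hB
      (fun v => by rw [tHom_neg_eta]; exact ht v) hU (regularPlus_neg_eta hu)
    rw [neg_mul, Complex.neg_re, neg_lt_zero]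
    exact (pos_iff_pos_of_mul_pos hconv).1 h

end XXZ

end

open XXZ in
theorem proposition9 (N : ℕ) (hN : 0 < N) (η ℓ : ℂ) (hη : η.re ≠ 0)
    (hℓ : ∀ n : ℕ, qpow η (4 * ℓ + 2 * n) ≠ 1) :
    -- the operators `Q₋`
    (∀ u : ℂ,
      IsAuxTrace (monodromy₂ η (fun _ : Fin N => ℓ) (fun _ => 0) (1 - ℓ) u) (Qminus N η ℓ u) ∧
      IsAuxTrace (monodromyMinus N η ℓ u) (Qminus N η ℓ u)) ∧
    (∀ u v : ℂ, Qminus N η ℓ u * Qminus N η ℓ v = Qminus N η ℓ v * Qminus N η ℓ u) ∧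
    (∀ u v : ℂ, Qminus N η ℓ u * tHom N η ℓ v = tHom N η ℓ v * Qminus N η ℓ u) ∧
    (∀ u : ℂ, Qminus N η ℓ u * tHom N η ℓ u =
      qnum η (u + ℓ) ^ N • Qminus N η ℓ (u + 1) + qnum η (u - ℓ) ^ N • Qminus N η ℓ (u - 1)) ∧
    -- the operators `Q₊`, in the domain of convergence of the trace
    (0 < η.re * (η * ℓ).re →
      (∀ u : ℂ, RegularPlus η ℓ u →
        IsAuxTrace (monodromy₂ η (fun _ : Fin N => ℓ) (fun _ => 0) u ℓ) (Qplus N η ℓ u) ∧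
        IsAuxTrace (monodromyPlus N η ℓ u) (Qplus N η ℓ u)) ∧
      (∀ u v : ℂ, RegularPlus η ℓ u → RegularPlus η ℓ v →
        Qplus N η ℓ u * Qplus N η ℓ v = Qplus N η ℓ v * Qplus N η ℓ u) ∧
      (∀ u v : ℂ, RegularPlus η ℓ u →
        Qplus N η ℓ u * Qminus N η ℓ v = Qminus N η ℓ v * Qplus N η ℓ u) ∧
      (∀ u v : ℂ, RegularPlus η ℓ u →
        Qplus N η ℓ u * tHom N η ℓ v = tHom N η ℓ v * Qplus N η ℓ u) ∧
      (∀ u : ℂ, RegularPlus η ℓ (u + 1) →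
        tHom N η ℓ u * Qplus N η ℓ u =
          (qnum η (u - 1 + ℓ) ^ N * qnum η (u - ℓ) ^ N / qnum η (u - 1 - ℓ) ^ N) •
            Qplus N η ℓ (u - 1) +
          qnum η (u - ℓ) ^ N • Qplus N η ℓ (u + 1))) := by
  have hℓ' : ∀ n : ℕ, qpow η (2 * (2 * ℓ + n)) ≠ 1 := fun n => by
    rw [show 2 * (2 * ℓ + (n : ℂ)) = 4 * ℓ + 2 * n by ring]
    exact hℓ n
  have hUt := tHom_commute_rotOp hN η ℓ
  have htt := tHom_commute N hη ℓ
  have hQt : ∀ u v, Commute (Qminus N η ℓ u) (tHom N η ℓ v) := fun u v =>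
    Qminus_commute hN hη hℓ' (fun w => htt w v) (hUt v).symm u
  have hQU : ∀ u, Commute (Qminus N η ℓ u) (rotOp N) :=
    Qminus_commute hN hη hℓ' hUt (Commute.refl _)
  refine ⟨fun u => ⟨?_, (isAuxTrace_Qminus hN hη hℓ' u).1⟩, fun u v => ?_, fun u v => (hQt u v).eq,
    Qminus_mul_tHom hN hη hℓ', fun hconv => ?_⟩
  · rw [monodromy₂_eq_minus hη hℓ']
    exact (isAuxTrace_Qminus hN hη hℓ' u).1
  · exact (Qminus_commute hN hη hℓ' (fun w => (hQt v w).symm) (hQU v).symm u).eq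
  have hPt : ∀ {u}, RegularPlus η ℓ u → ∀ v, Commute (Qplus N η ℓ u) (tHom N η ℓ v) := fun hu v =>
    Qplus_commute hN hη hℓ' hconv (preservesDegree_tHom N η ℓ v) (fun w => htt w v) (hUt v).symm hu
  have hPU : ∀ {v}, RegularPlus η ℓ v → Commute (rotOp N) (Qplus N η ℓ v) := fun hv => by
    have hdeg : PreservesDegree (rotOp N) :=
      Qminus_eq_rotOp hN hη hℓ' ▸ preservesDegree_Qminus hN hη hℓ' ℓ
    exact (Qplus_commute hN hη hℓ' hconv hdeg hUt (Commute.refl _) hv).symm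
  refine ⟨fun u hu => ⟨?_, (isAuxTrace_Qplus hN hη hℓ' hconv hu).1⟩, fun u v hu hv => ?_,
    fun u v hu => ?_, fun u v hu => (hPt hu v).eq, fun u hu => tHom_mul_Qplus hN hη hℓ' hconv hu⟩
  · rw [monodromy₂_eq_plus hη hℓ']
    exact (isAuxTrace_Qplus hN hη hℓ' hconv hu).1
  · exact (Qplus_commute hN hη hℓ' hconv (preservesDegree_Qplus hN hη hℓ' hconv hv)
      (fun w => (hPt hv w).symm) (hPU hv) hu).eq
  · exact (Qplus_commute hN hη hℓ' hconv (preservesDegree_Qminus hN hη hℓ' v)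
      (fun w => (hQt v w).symm) (hQU v).symm hu).eq
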